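/- Let $x=(B,\le_r)$ be an ordered Bratteli diagram with finite non-empty vertex sets $V_k$ ($k\ge 0$), onto range and source maps, and transition matrices $A_k$; write $\mathcal A_{(k)}=A_k\cdots A_1$. Assume that $B$ is strongly minimal (for each $k$ there is $\ell$ such that any $v\in V_k$, $w\in V_{k+\ell}$ are joined by at least two paths), properly ordered (exactly one minimal and one maximal infinite path $x^\mp$), that for every $\varepsilon>0$ there is $K_\varepsilon$ with $|V_k|\le K_\varepsilon e^{\varepsilon k}$ for all $k$, and that for some $\lambda>1$ one has $\frac1n\log\|\mathcal A_{(n)}v\|\to\log\lambda$ for every positive $v\in\mathbb R^{V_0}$. Let $l\in\mathbb R^{V_0}$ be any positive vector. Let $\Gamma^k$ be the graph with one oriented edge $e_v=[0,\lambda^{-k}(\mathcal A_{(k)}l)_v]$ for each $v\in V_k$, where the end of $e_{v_1}$ is glued to the beginning of $e_{v_2}$ if $v_1,v_2$ are the sources of a path and of its successor among the paths from $V_k$ to some vertex of a later level, or are the level-$k$ vertices of $x^+$ and $x^-$. Let $\gamma_k:\Gamma^k\to\Gamma^{k-1}$ stretch $e_v$ by $\lambda$ and lay it along the edges $e_{s(e)}$,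 $e\in r^{-1}(v)$, in their order. Let $\Omega=\varprojlim(\Gamma^k,\gamma_k)$, with projections $\pi_k$ and the flow $\varphi_t$ which moves the $k$-th coordinate along the edges of $\Gamma^k$ with speed $\lambda^{-k}$. Let $\mu$ be a $\varphi$-invariant Borel probability measure on $\Omega$, let $\nu$ be the transverse measure which it induces on $C_k^\perp(z)=\pi_k^{-1}(\pi_k(z))$ (so that locally $\mu=\mathrm{Leb}\times\nu$), and put $\Pi_kf(z)=\nu(C_k^\perp(z))^{-1}\int_{C_k^\perp(z)}f\,d\nu$, $\delta_0=\Pi_0$, $\delta_k=\Pi_k-\Pi_{k-1}$. Write $\delta_kf=(\pi_{k*}\delta_kf)\circ\pi_k$. Let $Xf(z)=\frac{d}{ds}\big|_{s=0}f(\varphi_sz)$, and let $C^1(\Omega)$ be the space of continuous $f$ for which $Xf$ exists everywhere and is continuous. Let $C^r(\Gamma^k)$ be the space of continuous functions on $\Gamma^k$ whose derivatives along the oriented edges up to order $r$ exist (one-sided at the ends of edges) and define continuous functions on $\Gamma^k$, with norm $\|g\|_{C^r}=\sum_{j\le r}\|g^{(j)}\|_\infty$, and $\|g\|_{C^r}=\infty$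 if $g\notin C^r(\Gamma^k)$. Let $C^\infty_{tlc}=\bigcup_k\pi_k^*C^\infty(\Gamma^k)$, $$\|f\|_{r,\alpha}=\sum_{k\ge0}\lambda^{\alpha k}\|\pi_{k*}\delta_kf\|_{C^r(\Gamma^k)},\qquad |||f|||_{r,\alpha,\varepsilon}=\sup_{k\ge0}\lambda^{k(\alpha-\varepsilon)}\|\pi_{k*}\delta_kf\|_{C^r(\Gamma^k)},$$ and let $\mathcal S^r_\alpha$ and $\mathcal R^r_{\alpha,\varepsilon}$ be the completions, realized as spaces of continuous functions on $\Omega$, of the spaces of all $f\in C^\infty_{tlc}$ with $\|f\|_{r,\alpha}<\infty$, respectively $|||f|||_{r,\alpha,\varepsilon}<\infty$. Then: (i) For each $k$, the set of points $z$ for which $\pi_k(z)$ is a vertex of $\Gamma^k$ is $\mu$-null. For $f\in C^1(\Omega)$ and $k\ge 0$, $X\delta_kf(z)$ exists and equals $\delta_kXf(z)$ at every $z$ such that $\pi_k(z)$ and (if $k\ge1$) $\pi_{k-1}(z)$ are not vertices. For $f\in\mathcal S^{r+1}_\alpha$ with $r\ge0$, $\alpha>1$, this holds at every $z\in\Omega$.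 (ii) For $r\ge1$, $\alpha>1$ and $f\in\mathcal S^r_\alpha$: $f\in C^1(\Omega)$, $Xf\in\mathcal S^{r-1}_{\alpha+1}$ and $\|Xf\|_{r-1,\alpha+1}\le\|f\|_{r,\alpha}$. (iii) For every $\varepsilon>0$ there is a constant $C<\infty$, depending only on $\varepsilon$ and on $(x,\lambda,l,\mu)$, such that for all $\alpha>1$, $r\ge0$ and $f\in\mathcal S^{r+1}_\alpha$, in $[0,\infty]$, $$\|f-\mu(f)\|_{r,\alpha}\le C\,\|Xf\|_{r,\alpha+1+\varepsilon}.$$ (iv) For $r\ge0$, $\alpha>1$ and $\varepsilon\in(0,\alpha)$: $\mathcal S^r_\alpha\subset\mathcal R^r_{\alpha,\varepsilon}$, and this inclusion is a continuous embedding with $|||f|||_{r,\alpha,\varepsilon}\le\|f\|_{r,\alpha}$. -/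

import Mathlib

open MeasureTheory Set Filter Topology
open scoped ENNReal NNReal

/-- An ordered Bratteli diagram. `V k` is the (finite, non-empty) vertex set at level `k`. The edges
with range `v : V (k+1)` are listed in their chosen linear order: they are indexed by
`Fin (deg k v)`, and `src k v i` is the source in `V k` of the `i`-th edge of `r⁻¹(v)`. The range map
and the source map are onto. -/
structure OrderedBratteli where
  V : ℕ → Type
  fin : ∀ k, Fintype (V k)
  nonempty : ∀ k, Nonempty (V k)
  deg : ∀ k, V (k + 1) → ℕ
  deg_pos : ∀ k v, 0 < deg k v
  src : ∀ k (v : V (k + 1)), Fin (deg k v) → V k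
  src_surj : ∀ k (w : V k), ∃ v i, src k v i = w

attribute [instance] OrderedBratteli.fin OrderedBratteli.nonempty

namespace OrderedBratteli

variable (B : OrderedBratteli)

/-- The edges between level `k` and level `k + 1`. -/
abbrev Edge (k : ℕ) : Type := Σ v : B.V (k + 1), Fin (B.deg k v)

/-- Source of an edge. -/
def Edge.source {B : OrderedBratteli} {k : ℕ} (e : B.Edge k) : B.V k := B.src k e.1 e.2

/-- Range of an edge. -/
def Edge.range {B : OrderedBratteli} {k : ℕ} (e : B.Edge k) : B.V (k + 1) := e.1

/-- Finite paths of length `n` from `v : V k` to a vertex of `V (k + n)`. -/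
inductive FinPath {k : ℕ} (v : B.V k) : (n : ℕ) → B.V (k + n) → Type
  | nil : FinPath v 0 v
  | snoc {n : ℕ} (w : B.V (k + n + 1)) (i : Fin (B.deg (k + n) w))
      (p : FinPath v n (B.src (k + n) w i)) : FinPath v (n + 1) w

/-- Strong minimality: for each `k` there is an `n` such that any `v : V k` and `w : V (k + n)` are
joined by at least two distinct paths. -/
def StronglyMinimal : Prop :=
  ∀ k, ∃ n, ∀ (v : B.V k) (w : B.V (k + n)), ∃ p q : B.FinPath v n w, p ≠ q

/-- `X_B`, the infinite paths (starting at level `0`). -/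
def InfPath : Type := {p : ∀ k, B.Edge k // ∀ k, (p k).range = (p (k + 1)).source}

/-- Every edge of the path is minimal in its fibre `r⁻¹(v)`. -/
def IsMinPath (p : B.InfPath) : Prop := ∀ k, (p.1 k).2.val = 0

/-- Every edge of the path is maximal in its fibre `r⁻¹(v)`. -/
def IsMaxPath (p : B.InfPath) : Prop := ∀ k, (p.1 k).2.val + 1 = B.deg k (p.1 k).1

/-- Properly ordered: there are exactly one minimal and exactly one maximal infinite path. -/
def ProperlyOrdered : Prop := (∃! p, B.IsMinPath p) ∧ (∃! p, B.IsMaxPath p)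

/-- The transition matrix between levels `k` and `k + 1`: the entry at `(v, w)` is the number of edges
with source `w : V k` and range `v : V (k + 1)`. -/
noncomputable def mat (k : ℕ) : Matrix (B.V (k + 1)) (B.V k) ℝ :=
  fun v w => (Nat.card {i : Fin (B.deg k v) // B.src k v i = w} : ℝ)

open Classical in
/-- The product `A_k ⋯ A_1` of the transition matrices. -/
noncomputable def cocycle : (k : ℕ) → Matrix (B.V k) (B.V 0) ℝ
  | 0 => 1
  | k + 1 => B.mat k * cocycle k

/-- The sources in `V k` of all the paths from level `k` to `w : V (k + n)`, listed in the
(lexicographic) order which the edge orders induce on the set of these paths. -/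
def word (k : ℕ) : (n : ℕ) → B.V (k + n) → List (B.V k)
  | 0, w => [w]
  | n + 1, w => (List.ofFn (B.src (k + n) w)).flatMap (word k n)

/-- Subexponential growth of the number of vertices. -/
def SubexpVertices : Prop :=
  ∀ ε : ℝ, 0 < ε → ∃ K : ℝ, ∀ k : ℕ, (Fintype.card (B.V k) : ℝ) ≤ K * Real.exp (ε * k)

/-- Kesten-Furstenberg regularity with expansion factor `lam`: for every positive vector `v`,
`(1/n) log ‖A_n ⋯ A_1 v‖` converges to `log lam`. -/
def KFRegular (lam : ℝ) : Prop :=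
  ∀ v : B.V 0 → ℝ, (∀ a, 0 < v a) →
    Tendsto (fun n : ℕ => Real.log ‖(B.cocycle n).mulVec v‖ / n) atTop (𝓝 (Real.log lam))

end OrderedBratteli

/-- The data from which the solenoid is built: an ordered diagram, the expansion factor `lam > 1` and
a positive vector `l` of edge lengths at level `0`. -/
structure SolenoidDatum where
  B : OrderedBratteli
  lam : ℝ
  one_lt_lam : 1 < lam
  l : B.V 0 → ℝ
  l_pos : ∀ v, 0 < l v

namespace SolenoidDatum

variable (D : SolenoidDatum)

/-- Length `lam^{-k} (A_k ⋯ A_1 l)_v` of the edge `e_v`, `v : V k`. -/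
noncomputable def len (k : ℕ) (v : D.B.V k) : ℝ :=
  (D.lam ^ k)⁻¹ * (D.B.cocycle k).mulVec D.l v

theorem len_nonneg (k : ℕ) (v : D.B.V k) : 0 ≤ D.len k v := by
  have hl : ∀ k, ∀ v : D.B.V k, ∀ w, 0 ≤ D.B.cocycle k v w := by
    intro k
    induction k with
    | zero =>
      intro v w
      simp only [OrderedBratteli.cocycle, Matrix.one_apply]
      split_ifs <;> norm_num
    | succ k ih =>
      intro v w
      simp only [OrderedBratteli.cocycle, Matrix.mul_apply]
      exact Finset.sum_nonneg fun j _ => mul_nonneg (Nat.cast_nonneg _) (ih j w)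
  have h0 : 0 ≤ D.lam := by linarith [D.one_lt_lam]
  refine mul_nonneg (inv_nonneg.2 (pow_nonneg h0 k)) ?_
  exact Finset.sum_nonneg fun j _ => mul_nonneg (hl k v j) (D.l_pos j).le

/-- The disjoint union of the edges `e_v = [0, len k v]`, `v : V k`. -/
abbrev PreGam (k : ℕ) : Type := Σ v : D.B.V k, Icc (0 : ℝ) (D.len k v)

/-- The end of `e_{v₁}` is to be identified with the beginning of `e_{v₂}`: either `v₁ v₂` are the
sources of a path and of its successor among the paths from level `k` to some `w : V (k + n)`, or
`v₁`, `v₂` are the level-`k` vertices of the maximal and of the minimal infinite path. -/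
def Follows (k : ℕ) (v₁ v₂ : D.B.V k) : Prop :=
  (∃ (n : ℕ) (w : D.B.V (k + n)), [v₁, v₂] <:+: D.B.word k n w) ∨
  (∃ p q : D.B.InfPath, D.B.IsMaxPath p ∧ D.B.IsMinPath q ∧
    (p.1 k).source = v₁ ∧ (q.1 k).source = v₂)

/-- The generating relation of the gluing. -/
def Glue (k : ℕ) (a b : D.PreGam k) : Prop :=
  D.Follows k a.1 b.1 ∧ a.2.1 = D.len k a.1 ∧ b.2.1 = 0

/-- The graph `Γ^k`, with the quotient topology. -/
def Gam (k : ℕ) : Type := Quot (D.Glue k)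

instance (k : ℕ) : TopologicalSpace (D.Gam k) :=
  inferInstanceAs (TopologicalSpace (Quot (D.Glue k)))

/-- The point at position `t ∈ [0, len k v]` of the edge `e_v` (`t` is truncated to this interval). -/
noncomputable def pt (k : ℕ) (v : D.B.V k) (t : ℝ) : D.Gam k :=
  Quot.mk _ ⟨v, projIcc 0 (D.len k v) (D.len_nonneg k v) t⟩

/-- The vertices of `Γ^k`. -/
def IsVertex (k : ℕ) (a : D.Gam k) : Prop :=
  ∃ v, a = D.pt k v 0 ∨ a = D.pt k v (D.len k v)

/-- The graph of the map `γ : Γ^{k+1} → Γ^k`, which stretches `e_v` by `lam` and lays it along the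
concatenation of the edges `e_{src v 0}, e_{src v 1}, …`. -/
def GamMap (k : ℕ) (a : D.Gam (k + 1)) (b : D.Gam k) : Prop :=
  ∃ (v : D.B.V (k + 1)) (i : Fin (D.B.deg k v)), ∃ t ∈ Icc (0 : ℝ) (D.len k (D.B.src k v i)),
    a = D.pt (k + 1) v (((∑ j ∈ Finset.Iio i, D.len k (D.B.src k v j)) + t) / D.lam) ∧
    b = D.pt k (D.B.src k v i) t

/-- The solenoid: the inverse limit of the graphs `Γ^k`, with the topology induced by the product. -/
def Om : Type := {z : ∀ k, D.Gam k // ∀ k, D.GamMap k (z (k + 1)) (z k)}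

instance : TopologicalSpace D.Om :=
  inferInstanceAs (TopologicalSpace {z : ∀ k, D.Gam k // ∀ k, D.GamMap k (z (k + 1)) (z k)})

instance : MeasurableSpace D.Om := borel _

instance : BorelSpace D.Om := ⟨rfl⟩

/-- The projection to `Γ^k`. -/
def proj (k : ℕ) (z : D.Om) : D.Gam k := z.1 k

/-- `c` is a flow line: for every `k`, the `k`-th coordinate of `c` moves along the oriented edges of
`Γ^k` with speed `lam^{-k}`. -/
def IsFlowLine (c : ℝ → D.Om) : Prop :=
  ∀ (k : ℕ) (t : ℝ), ∃ d : ℝ, 0 < d ∧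
    (∃ (v : D.B.V k) (x : ℝ), 0 ≤ x ∧ x + d / D.lam ^ k ≤ D.len k v ∧
      ∀ s ∈ Icc (0 : ℝ) d, D.proj k (c (t + s)) = D.pt k v (x + s / D.lam ^ k)) ∧
    (∃ (v : D.B.V k) (x : ℝ), x ≤ D.len k v ∧ 0 ≤ x - d / D.lam ^ k ∧
      ∀ s ∈ Icc (0 : ℝ) d, D.proj k (c (t - s)) = D.pt k v (x - s / D.lam ^ k))

open Classical in
/-- The flow `φ_t`, i.e. the motion along the flow line through `z`. -/
noncomputable def flow (t : ℝ) (z : D.Om) : D.Om :=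
  if h : ∃ c : ℝ → D.Om, D.IsFlowLine c ∧ c 0 = z then h.choose t else z

/-- The derivative `X f` along the flow. -/
noncomputable def X (f : D.Om → ℝ) (z : D.Om) : ℝ := deriv (fun s => f (D.flow s z)) 0

/-- `C¹(Ω)`: `f` is continuous, `X f` exists everywhere and is continuous. -/
def IsC1 (f : D.Om → ℝ) : Prop :=
  Continuous f ∧ (∀ z, DifferentiableAt ℝ (fun s => f (D.flow s z)) 0) ∧ Continuous (D.X f)

/-- The transverse cylinder set `C_k^⊥(z)`. -/
def fiber (k : ℕ) (z : D.Om) : Set D.Om := {y | ∀ i, i ≤ k → D.proj i y = D.proj i z}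

/-- `ν` is the measure induced by `μ` on the transversal `C`: it is finite, lives on `C`, and on
`{φ_s(y) : y ∈ C, 0 ≤ s < t}`, for all small `t`, `μ` is the product of Lebesgue measure and `ν`. -/
def IsTransverse (μ : Measure D.Om) (C : Set D.Om) (ν : Measure D.Om) : Prop :=
  IsFiniteMeasure ν ∧ ν Cᶜ = 0 ∧
    ∀ᶠ t in 𝓝[>] (0 : ℝ),
      μ.restrict ((fun p : ℝ × D.Om => D.flow p.1 p.2) '' (Ico 0 t ×ˢ C)) =
        ((volume.restrict (Ico (0 : ℝ) t)).prod ν).map (fun p : ℝ × D.Om => D.flow p.1 p.2)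

open Classical in
/-- The transverse measure `ν_{k,z}` on `C_k^⊥(z)`. -/
noncomputable def trans (μ : Measure D.Om) (k : ℕ) (z : D.Om) : Measure D.Om :=
  if h : ∃ ν, D.IsTransverse μ (D.fiber k z) ν then h.choose else 0

/-- `Π_k f(z)`, the average of `f` over `C_k^⊥(z)` with respect to the transverse measure. -/
noncomputable def Pik (μ : Measure D.Om) (k : ℕ) (f : D.Om → ℝ) (z : D.Om) : ℝ :=
  ((D.trans μ k z).real univ)⁻¹ * ∫ y, f y ∂(D.trans μ k z)

/-- The martingale differences: `δ_0 = Π_0` and `δ_{k+1} = Π_{k+1} - Π_k`. -/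
noncomputable def delta (μ : Measure D.Om) : ℕ → (D.Om → ℝ) → D.Om → ℝ
  | 0, f, z => D.Pik μ 0 f z
  | k + 1, f, z => D.Pik μ (k + 1) f z - D.Pik μ k f z

/-- For a function `h` on the solenoid which depends on the `k`-th coordinate only, the function
`π_{k*} h` on `Γ^k` through which it factors. -/
noncomputable def push (k : ℕ) (h : D.Om → ℝ) : D.Gam k → ℝ := Function.extend (D.proj k) h 0

/-- `g'` is the derivative of `g` along the oriented edges of `Γ^k` (one-sided at the ends of each
edge; as `g'` is a function on `Γ^k`, the derivatives of all the edges at a vertex agree). -/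
def IsDerivGam (k : ℕ) (g g' : D.Gam k → ℝ) : Prop :=
  ∀ v, ∀ t ∈ Icc (0 : ℝ) (D.len k v),
    HasDerivWithinAt (fun s => g (D.pt k v s)) (g' (D.pt k v t)) (Icc 0 (D.len k v)) t

/-- The space `C^r(Γ^k)`. -/
def IsCr (k : ℕ) : ℕ → (D.Gam k → ℝ) → Prop
  | 0, g => Continuous g
  | r + 1, g => Continuous g ∧ ∃ g', D.IsDerivGam k g g' ∧ IsCr k r g'

open Classical in
/-- The derivative of a function on `Γ^k`. -/
noncomputable def derivGam (k : ℕ) (g : D.Gam k → ℝ) : D.Gam k → ℝ :=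
  if h : ∃ g', D.IsDerivGam k g g' then h.choose else 0

open Classical in
/-- The `C^r(Γ^k)` norm `∑_{j ≤ r} sup |g^{(j)}|`; it is `∞` if `g` does not belong to `C^r(Γ^k)`. -/
noncomputable def crNorm (k r : ℕ) (g : D.Gam k → ℝ) : ℝ≥0∞ :=
  if D.IsCr k r g then ∑ j ∈ Finset.range (r + 1), ⨆ p, ‖((D.derivGam k)^[j] g) p‖ₑ else ⊤

/-- `C^∞_tlc(Ω)`: the pull-backs of the smooth functions on the graphs `Γ^k`. -/
def Ctlc : Set (D.Om → ℝ) :=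
  {f | ∃ (k : ℕ) (g : D.Gam k → ℝ), (∀ r, D.IsCr k r g) ∧ f = g ∘ D.proj k}

/-- The norm `‖f‖_{r,α}`. -/
noncomputable def normS (μ : Measure D.Om) (r : ℕ) (α : ℝ) (f : D.Om → ℝ) : ℝ≥0∞ :=
  ∑' k : ℕ, ENNReal.ofReal (D.lam ^ (α * k)) * D.crNorm k r (D.push k (D.delta μ k f))

/-- The norm `|||f|||_{r,α,ε}`. -/
noncomputable def normR (μ : Measure D.Om) (r : ℕ) (α ε : ℝ) (f : D.Om → ℝ) : ℝ≥0∞ :=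
  ⨆ k : ℕ, ENNReal.ofReal (D.lam ^ (k * (α - ε))) * D.crNorm k r (D.push k (D.delta μ k f))

/-- The completion of `C^∞_tlc(Ω)` in `‖·‖_{r,α}`, realized as a space of continuous functions
(Cauchy sequences in this norm converge uniformly). -/
def S (μ : Measure D.Om) (r : ℕ) (α : ℝ) : Set (D.Om → ℝ) :=
  {f | Continuous f ∧ ∀ η : ℝ≥0∞, 0 < η →
    ∃ g ∈ D.Ctlc, D.normS μ r α g < ⊤ ∧ D.normS μ r α (f - g) < η}

/-- The completion of `C^∞_tlc(Ω)` in `|||·|||_{r,α,ε}`, realized as a space of continuous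
functions. -/
def R (μ : Measure D.Om) (r : ℕ) (α ε : ℝ) : Set (D.Om → ℝ) :=
  {f | Continuous f ∧ ∀ η : ℝ≥0∞, 0 < η →
    ∃ g ∈ D.Ctlc, D.normR μ r α ε g < ⊤ ∧ D.normR μ r α ε (f - g) < η}

end SolenoidDatum

/-! The flow. Lengths are measured in flow time, where the stretching factor disappears and an edge
of level `k + 1` is the plain concatenation of edges of level `k`. Motion for a time shorter than
every edge of level `k` is an explicit closed relation `EdgeRel` on `Γ^k`, compatible with the
bonding maps. Strong minimality makes the shortest edge grow without bound, so deep levels describe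
motion for any given time. Compactness of `Ω` yields existence; uniqueness comes from the single
minimal and maximal path, since two branches leaving a common vertex of a deep level follow the
minimal path at a given level. A closed graph and compactness make the flow continuous.

The transverse measures. A closed set to which no orbit returns before time `T` is a transversal of
a flow box. On the box `μ` is a product by Fubini and invariance (`NoReturn.restrict_box`), and the
transverse factor is unique and carried along by the flow. Fibres of `π_k` are such transversals,
and their measures do not vanish because every edge of some deeper level contains every edge of
level `k`.

Commutation of `X` and `δ_k`. Inside an edge the flow carries one transverse measure to the next, so
`Π_k f` along an orbit is an integral against a fixed measure and may be differentiated under the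
integral sign. At a vertex the fibres split and merge and this breaks down. For `f` of finite norm,
however, `Π_k f = ∑_{j ≤ k} δ_j f` is already differentiable, with derivative constant on fibres. A
fibre moved by a small `s ≥ 0` is a finite union of fibres, so `∫ Π_k f ∘ φ_s = ∫ f ∘ φ_s` over it;
right derivatives at `0` identify that derivative with `Π_k X f` (`hasDerivAt_Pik_of_normS`).

The estimates. Speed `λ^{-k}` on `Γ^k` gives `π_{k*} δ_k X f = λ^{-k} (π_{k*} δ_k f)'`
(`push_delta_X`), which is (ii) after dropping one term of the norm. For (iii), `δ_k (f - μ(f))` has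
integral zero for some nonzero measure, hence takes values of both signs (possibly zero). The graph
`Γ^k` is connected, so the supremum is at most the supremum of the derivative times the total
length, and the total length is `O(λ^{εk})` by the hypotheses on growth. In (iv) each term of the
supremum is bounded by a term of the sum. -/

/-! ### Partial sums over initial segments of `Fin n`. -/

theorem Fin.sum_Iio_add_le {n : ℕ} {f : Fin n → ℝ} (hf : ∀ i, 0 ≤ f i) {i j : Fin n} (h : i < j) :
    ∑ a ∈ Finset.Iio i, f a + f i ≤ ∑ a ∈ Finset.Iio j, f a := by
  rw [add_comm, ← Finset.sum_insert (f := f) (s := Finset.Iio i) (a := i) (by simp)]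
  refine Finset.sum_le_sum_of_subset_of_nonneg ?_ fun a _ _ => hf a
  intro a ha
  rcases Finset.mem_insert.1 ha with rfl | ha
  · simpa using h
  · exact Finset.mem_Iio.2 ((Finset.mem_Iio.1 ha).trans h)

theorem Fin.sum_Iio_add_le_sum {n : ℕ} {f : Fin n → ℝ} (hf : ∀ i, 0 ≤ f i) (i : Fin n) :
    ∑ a ∈ Finset.Iio i, f a + f i ≤ ∑ a, f a := by
  rw [add_comm, ← Finset.sum_insert (f := f) (s := Finset.Iio i) (a := i) (by simp)]
  exact Finset.sum_le_sum_of_subset_of_nonneg (Finset.subset_univ _) fun a _ _ => hf a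

theorem Fin.sum_Iio_succ {n : ℕ} (f : Fin n → ℝ) {i j : Fin n} (h : j.val = i.val + 1) :
    ∑ a ∈ Finset.Iio j, f a = ∑ a ∈ Finset.Iio i, f a + f i := by
  rw [add_comm, ← Finset.sum_insert (f := f) (s := Finset.Iio i) (a := i) (by simp)]
  congr 1
  ext a
  simp only [Finset.mem_Iio, Finset.mem_insert, Fin.ext_iff, Fin.lt_def]
  omega

theorem Fin.sum_Iio_last {n : ℕ} (f : Fin n → ℝ) {i : Fin n} (h : i.val + 1 = n) :
    ∑ a ∈ Finset.Iio i, f a + f i = ∑ a, f a := by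
  rw [add_comm, ← Finset.sum_insert (f := f) (s := Finset.Iio i) (a := i) (by simp)]
  congr 1
  ext a
  simp only [Finset.mem_Iio, Finset.mem_insert, Fin.ext_iff, Fin.lt_def, Finset.mem_univ, iff_true]
  omega

/-- The largest `i` whose partial sum does not exceed `x` works. It locates a position on an edge
within the subdivision of that edge. -/
theorem Fin.exists_sum_Iio_le_le {n : ℕ} (hn : 0 < n) (f : Fin n → ℝ) {x : ℝ} (h0 : 0 ≤ x)
    (h1 : x ≤ ∑ a, f a) :
    ∃ i, ∑ a ∈ Finset.Iio i, f a ≤ x ∧ x ≤ ∑ a ∈ Finset.Iio i, f a + f i := by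
  classical
  have hne : (Finset.univ.filter fun i : Fin n => ∑ a ∈ Finset.Iio i, f a ≤ x).Nonempty := by
    refine ⟨⟨0, hn⟩, Finset.mem_filter.2 ⟨Finset.mem_univ _, ?_⟩⟩
    have : Finset.Iio (⟨0, hn⟩ : Fin n) = ∅ := by
      ext a; simp [Fin.lt_def]
    simpa [this] using h0
  obtain ⟨i, hi, hmax⟩ := Finset.exists_max_image _ id hne
  refine ⟨i, (Finset.mem_filter.1 hi).2, ?_⟩
  by_cases hlast : i.val + 1 = n
  · rwa [Fin.sum_Iio_last f hlast]
  · have hlt : i.val + 1 < n := by omega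
    rw [← Fin.sum_Iio_succ f (i := i) (j := ⟨i.val + 1, hlt⟩) rfl]
    by_contra hcon
    have := hmax ⟨i.val + 1, hlt⟩ (Finset.mem_filter.2 ⟨Finset.mem_univ _, (not_le.1 hcon).le⟩)
    simp [Fin.le_def] at this

/-! ### Edge lengths in the time scale of the flow. -/

namespace SolenoidDatum

variable (D : SolenoidDatum)

/-- The length of `e_v` in the time scale of the flow. -/
noncomputable def ht (k : ℕ) (v : D.B.V k) : ℝ := (D.B.cocycle k).mulVec D.l v

/-- The position, in the time scale of the flow, at which the `i`-th edge below `e_v` begins. -/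
noncomputable def off (k : ℕ) (v : D.B.V (k + 1)) (i : Fin (D.B.deg k v)) : ℝ :=
  ∑ j ∈ Finset.Iio i, D.ht k (D.B.src k v j)

/-- The point of `e_v` which the flow reaches after time `s` from the beginning of `e_v`. -/
noncomputable def pnt (k : ℕ) (v : D.B.V k) (s : ℝ) : D.Gam k := D.pt k v (s / D.lam ^ k)

theorem lam_pow_pos (k : ℕ) : 0 < D.lam ^ k := pow_pos (by linarith [D.one_lt_lam]) k

theorem len_eq (k : ℕ) (v : D.B.V k) : D.len k v = D.ht k v / D.lam ^ k := by
  rw [len, ht, div_eq_inv_mul]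

/-- Grouping the edges into `v` by their source turns the matrix product into a sum along the list
of sources. No power of `lam` occurs, which is the reason for working in flow time. -/
theorem ht_succ (k : ℕ) (v : D.B.V (k + 1)) :
    D.ht (k + 1) v = ∑ i, D.ht k (D.B.src k v i) := by
  classical
  have h1 : D.ht (k + 1) v = ∑ w, D.B.mat k v w * D.ht k w := by
    simp only [ht, OrderedBratteli.cocycle, ← Matrix.mulVec_mulVec]
    rfl
  rw [h1, ← Finset.sum_fiberwise (s := Finset.univ) (g := D.B.src k v)]
  refine Finset.sum_congr rfl fun w _ => ?_
  rw [Finset.sum_congr rfl (g := fun _ => D.ht k w)]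
  · rw [Finset.sum_const, nsmul_eq_mul, OrderedBratteli.mat, Nat.card_eq_fintype_card,
      Fintype.card_subtype]
  · intro i hi
    rw [(Finset.mem_filter.1 hi).2]

theorem ht_pos (k : ℕ) (v : D.B.V k) : 0 < D.ht k v := by
  induction k with
  | zero => simpa [ht, OrderedBratteli.cocycle] using D.l_pos v
  | succ k ih =>
    rw [ht_succ]
    have : Nonempty (Fin (D.B.deg k v)) := ⟨⟨0, D.B.deg_pos k v⟩⟩
    exact Finset.sum_pos (fun i _ => ih _) Finset.univ_nonempty

theorem len_pos (k : ℕ) (v : D.B.V k) : 0 < D.len k v := by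
  rw [len_eq]; exact div_pos (D.ht_pos k v) (D.lam_pow_pos k)

theorem off_nonneg (k : ℕ) (v : D.B.V (k + 1)) (i : Fin (D.B.deg k v)) : 0 ≤ D.off k v i :=
  Finset.sum_nonneg fun _ _ => (D.ht_pos _ _).le

theorem off_add_le (k : ℕ) (v : D.B.V (k + 1)) (i : Fin (D.B.deg k v)) :
    D.off k v i + D.ht k (D.B.src k v i) ≤ D.ht (k + 1) v := by
  rw [ht_succ]
  exact Fin.sum_Iio_add_le_sum (f := fun i => D.ht k (D.B.src k v i)) (fun _ => (D.ht_pos _ _).le) i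

theorem off_lt (k : ℕ) (v : D.B.V (k + 1)) {i j : Fin (D.B.deg k v)} (h : i < j) :
    D.off k v i + D.ht k (D.B.src k v i) ≤ D.off k v j :=
  Fin.sum_Iio_add_le (f := fun i => D.ht k (D.B.src k v i)) (fun _ => (D.ht_pos _ _).le) h

theorem off_succ (k : ℕ) (v : D.B.V (k + 1)) {i j : Fin (D.B.deg k v)} (h : j.val = i.val + 1) :
    D.off k v j = D.off k v i + D.ht k (D.B.src k v i) :=
  Fin.sum_Iio_succ (fun i => D.ht k (D.B.src k v i)) h

theorem off_last (k : ℕ) (v : D.B.V (k + 1)) {i : Fin (D.B.deg k v)}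
    (h : i.val + 1 = D.B.deg k v) :
    D.off k v i + D.ht k (D.B.src k v i) = D.ht (k + 1) v := by
  rw [ht_succ]
  exact Fin.sum_Iio_last (fun i => D.ht k (D.B.src k v i)) h

theorem off_zero (k : ℕ) (v : D.B.V (k + 1)) {i : Fin (D.B.deg k v)} (h : i.val = 0) :
    D.off k v i = 0 := by
  have : Finset.Iio i = ∅ := by
    ext a; simp [Fin.lt_def, h]
  simp [off, this]

theorem exists_off (k : ℕ) (v : D.B.V (k + 1)) {s : ℝ} (h0 : 0 ≤ s) (h1 : s ≤ D.ht (k + 1) v) :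
    ∃ (i : Fin (D.B.deg k v)) (t : ℝ), 0 ≤ t ∧ t ≤ D.ht k (D.B.src k v i) ∧
      s = D.off k v i + t := by
  rw [ht_succ] at h1
  obtain ⟨i, h2, h3⟩ := Fin.exists_sum_Iio_le_le (D.B.deg_pos k v)
    (fun i => D.ht k (D.B.src k v i)) h0 h1
  exact ⟨i, s - D.off k v i, sub_nonneg.2 h2, by rw [off]; linarith, by ring⟩

/-- The minimal length of the edges of level `k`, in the time scale of the flow. -/
noncomputable def mht (k : ℕ) : ℝ := Finset.univ.inf' Finset.univ_nonempty (D.ht k)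

theorem mht_le (k : ℕ) (v : D.B.V k) : D.mht k ≤ D.ht k v := Finset.inf'_le _ (Finset.mem_univ v)

theorem le_mht {k : ℕ} {c : ℝ} (h : ∀ v, c ≤ D.ht k v) : c ≤ D.mht k :=
  Finset.le_inf' _ _ fun v _ => h v

theorem mht_pos (k : ℕ) : 0 < D.mht k :=
  (Finset.lt_inf'_iff _).2 fun v _ => D.ht_pos k v

theorem mht_le_succ (k : ℕ) : D.mht k ≤ D.mht (k + 1) := by
  refine D.le_mht fun v => ?_
  have := D.off_add_le k v ⟨0, D.B.deg_pos k v⟩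
  linarith [D.off_nonneg k v ⟨0, D.B.deg_pos k v⟩, D.mht_le k (D.B.src k v ⟨0, D.B.deg_pos k v⟩)]

theorem mht_mono : Monotone D.mht := monotone_nat_of_le_succ D.mht_le_succ

/-! ### The graphs -/

theorem pnt_eq_mk (k : ℕ) (v : D.B.V k) {s : ℝ} (h0 : 0 ≤ s) (h1 : s ≤ D.ht k v) :
    D.pnt k v s = Quot.mk _ ⟨v, ⟨s / D.lam ^ k, div_nonneg h0 (D.lam_pow_pos k).le, by
      rw [len_eq]; exact div_le_div_of_nonneg_right h1 (D.lam_pow_pos k).le⟩⟩ := by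
  exact congrArg (fun t => Quot.mk _ (Sigma.mk v t)) (projIcc_of_mem _ _)

theorem pt_eq_pnt (k : ℕ) (v : D.B.V k) (t : ℝ) : D.pt k v t = D.pnt k v (D.lam ^ k * t) := by
  rw [pnt, mul_div_cancel_left₀ _ (D.lam_pow_pos k).ne']

theorem exists_pnt {k : ℕ} (a : D.Gam k) :
    ∃ v s, 0 ≤ s ∧ s ≤ D.ht k v ∧ a = D.pnt k v s := by
  obtain ⟨⟨v, t, ht⟩, rfl⟩ := Quot.exists_rep a
  have hl := D.lam_pow_pos k
  refine ⟨v, D.lam ^ k * t, mul_nonneg hl.le ht.1, ?_, ?_⟩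
  · have := ht.2
    rw [len_eq, le_div_iff₀ hl] at this
    linarith
  · rw [← pt_eq_pnt, pt, projIcc_of_mem _ ht]

theorem continuous_pt (k : ℕ) (v : D.B.V k) : Continuous (D.pt k v) :=
  continuous_quot_mk.comp (continuous_sigmaMk.comp continuous_projIcc)

theorem continuous_pnt (k : ℕ) (v : D.B.V k) : Continuous (D.pnt k v) :=
  (D.continuous_pt k v).comp (continuous_id.div_const _)

theorem isVertex_iff {k : ℕ} {a : D.Gam k} :
    D.IsVertex k a ↔ ∃ v, a = D.pnt k v 0 ∨ a = D.pnt k v (D.ht k v) := by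
  simp only [IsVertex, pnt, len_eq, zero_div]

open Classical in
/-- The position of a point in the interior of an edge. -/
noncomputable def interiorPosition (k : ℕ) : D.Gam k → Option (D.PreGam k) :=
  Quot.lift (fun p => if p.2.1 = 0 ∨ p.2.1 = D.len k p.1 then none else some p) (by
    rintro a b ⟨-, h1, h2⟩
    simp [h1, h2])

/-- Only ends of edges are glued: `interiorPosition` descends to the quotient and recovers edge and
position of every interior point. -/
theorem pnt_eq_pnt {k : ℕ} {v w : D.B.V k} {s t : ℝ} (hs0 : 0 ≤ s) (hs1 : s ≤ D.ht k v)
    (ht0 : 0 ≤ t) (ht1 : t ≤ D.ht k w) (h : D.pnt k v s = D.pnt k w t) :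
    (v = w ∧ s = t) ∨ ((s = 0 ∨ s = D.ht k v) ∧ (t = 0 ∨ t = D.ht k w)) := by
  rw [D.pnt_eq_mk k v hs0 hs1, D.pnt_eq_mk k w ht0 ht1] at h
  have h2 := congrArg (D.interiorPosition k) h
  have hl := (D.lam_pow_pos k).ne'
  simp only [interiorPosition, len_eq, div_eq_zero_iff, hl, or_false, div_left_inj' hl] at h2
  by_cases hs : s = 0 ∨ s = D.ht k v
  · by_cases ht : t = 0 ∨ t = D.ht k w
    · exact Or.inr ⟨hs, ht⟩
    · rw [if_pos hs, if_neg ht] at h2; cases h2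
  · by_cases ht : t = 0 ∨ t = D.ht k w
    · rw [if_neg hs, if_pos ht] at h2; cases h2
    · rw [if_neg hs, if_neg ht] at h2
      left
      have h3 := Option.some.inj h2
      have h4 : v = w := congrArg Sigma.fst h3
      subst h4
      refine ⟨rfl, ?_⟩
      have h5 := congrArg Subtype.val (eq_of_heq (Sigma.mk.inj h3).2)
      simpa [div_left_inj' hl] using h5

/-- The end of `e_v` is the beginning of `e_w`. -/
def Adj (k : ℕ) (v w : D.B.V k) : Prop := D.pnt k v (D.ht k v) = D.pnt k w 0

theorem Follows.adj {D : SolenoidDatum} {k : ℕ} {v w : D.B.V k} (h : D.Follows k v w) :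
    D.Adj k v w := by
  rw [Adj, pnt, pnt, ← len_eq, zero_div, pt, pt, projIcc_right, projIcc_left]
  exact Quot.sound ⟨h, rfl, rfl⟩

theorem continuous_gam {k : ℕ} {Y : Type*} [TopologicalSpace Y] {f : D.Gam k → Y}
    (h : ∀ v, ContinuousOn (fun s => f (D.pnt k v s)) (Icc 0 (D.ht k v))) : Continuous f := by
  refine continuous_quot_lift (f := f ∘ Quot.mk _) (fun a b hab => congrArg f (Quot.sound hab)) ?_
    |>.congr fun x => ?_
  · refine continuous_sigma fun v => ?_
    have hl := D.lam_pow_pos k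
    have h2 : Continuous fun t : Icc 0 (D.len k v) => D.lam ^ k * t.1 := by fun_prop
    refine ((h v).comp_continuous h2 fun t => ⟨mul_nonneg hl.le t.2.1, ?_⟩).congr fun t => ?_
    · have := t.2.2.trans_eq (D.len_eq k v)
      rw [le_div_iff₀ hl] at this
      linarith
    · simp only [← pt_eq_pnt, pt, projIcc_val, Function.comp]
  · induction x using Quot.ind
    rfl

instance (k : ℕ) : CompactSpace (D.Gam k) := inferInstanceAs (CompactSpace (Quot _))

/-- The function on `Γ^k` which is `F v s` at the point of `e_v` at time `s`. -/
theorem exists_gam_fun {k : ℕ} (F : D.B.V k → ℝ → ℝ) (hF : ∀ v, Continuous (F v))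
    (h : ∀ v w, D.Adj k v w → F v (D.ht k v) = F w 0) :
    ∃ f : D.Gam k → ℝ, Continuous f ∧ ∀ v s, 0 ≤ s → s ≤ D.ht k v → f (D.pnt k v s) = F v s := by
  have hl := D.lam_pow_pos k
  have hval : ∀ v s, 0 ≤ s → s ≤ D.ht k v →
      (Quot.lift (fun p : D.PreGam k => F p.1 (D.lam ^ k * p.2.1)) (by
        rintro ⟨v, s⟩ ⟨w, t⟩ ⟨h1, h2, h3⟩
        have h2 : s.1 = D.len k v := h2
        have h3 : t.1 = 0 := h3
        simp only [h2, h3, len_eq, mul_zero, mul_div_cancel₀ _ hl.ne']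
        exact h v w h1.adj) : D.Gam k → ℝ) (D.pnt k v s) = F v s := by
    intro v s h0 h1
    rw [D.pnt_eq_mk k v h0 h1]
    simp only [mul_div_cancel₀ _ hl.ne']
  refine ⟨_, D.continuous_gam fun v => ?_, hval⟩
  exact (hF v).continuousOn.congr fun s hs => hval v s hs.1 hs.2

/-- This makes the quotient Hausdorff. Interior points are detected by functions supported on their
edge, pairs of vertices by functions that are affine on edges. -/
theorem exists_separating {k : ℕ} {x y : D.Gam k} (hxy : x ≠ y) :
    ∃ f : D.Gam k → ℝ, Continuous f ∧ f x ≠ f y := by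
  classical
  have key : ∀ x y : D.Gam k, x ≠ y → ¬ D.IsVertex k y →
      ∃ f : D.Gam k → ℝ, Continuous f ∧ f x ≠ f y := by
    intro x y hxy hy
    obtain ⟨w, t, ht0, ht1, rfl⟩ := D.exists_pnt y
    obtain ⟨v, s, hs0, hs1, rfl⟩ := D.exists_pnt x
    have ht0' : 0 < t := lt_of_le_of_ne ht0 fun h => hy (D.isVertex_iff.2 ⟨w, Or.inl (by rw [h])⟩)
    have ht1' : t < D.ht k w := lt_of_le_of_ne ht1 fun h =>
      hy (D.isVertex_iff.2 ⟨w, Or.inr (by rw [h])⟩)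
    -- Agreement of `f` at `x` and `y` forces `x` onto the edge of `y`; since `g` is the position
    -- times `f`, agreement of `g` then forces equal positions.
    obtain ⟨f, hf, hf'⟩ := D.exists_gam_fun
      (fun u r => if u = w then r * (D.ht k w - r) else 0) (fun u => by split_ifs <;> fun_prop)
      (fun u u' _ => by by_cases h1 : u = w <;> by_cases h2 : u' = w <;> simp [h1, h2])
    obtain ⟨g, hg, hg'⟩ := D.exists_gam_fun
      (fun u r => if u = w then r * (r * (D.ht k w - r)) else 0)
      (fun u => by split_ifs <;> fun_prop)
      (fun u u' _ => by by_cases h1 : u = w <;> by_cases h2 : u' = w <;> simp [h1, h2])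
    by_contra! hcon
    have h1 := hcon f hf
    have h2 := hcon g hg
    rw [hf' v s hs0 hs1, hf' w t ht0 ht1, if_pos rfl] at h1
    rw [hg' v s hs0 hs1, hg' w t ht0 ht1, if_pos rfl] at h2
    have hp : 0 < t * (D.ht k w - t) := mul_pos ht0' (sub_pos.2 ht1')
    by_cases hv : v = w
    · rw [if_pos hv] at h1 h2
      rw [h1] at h2
      exact hxy (by rw [hv, mul_right_cancel₀ hp.ne' h2])
    · rw [if_neg hv] at h1
      exact hp.ne h1
  by_cases hy : D.IsVertex k y
  · by_cases hx : D.IsVertex k x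
    -- The indicator of `x`, restricted to the vertices and extended affinely over the edges,
    -- separates two vertices.
    · let e : D.Gam k → ℝ := fun a => if a = x then 1 else 0
      obtain ⟨f, hf, hf'⟩ := D.exists_gam_fun (k := k)
        (fun v s => (1 - s / D.ht k v) * e (D.pnt k v 0) + s / D.ht k v * e (D.pnt k v (D.ht k v)))
        (fun v => by fun_prop)
        (fun v w h => by
          have h : D.pnt k v (D.ht k v) = D.pnt k w 0 := h
          simp [h, div_self (D.ht_pos k v).ne'])
      have hv : ∀ a, D.IsVertex k a → f a = e a := by
        intro a ha
        obtain ⟨v, rfl | rfl⟩ := D.isVertex_iff.1 ha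
        · rw [hf' v 0 le_rfl (D.ht_pos k v).le]; simp
        · rw [hf' v _ (D.ht_pos k v).le le_rfl]; simp [div_self (D.ht_pos k v).ne']
      refine ⟨f, hf, ?_⟩
      rw [hv x hx, hv y hy]
      simp [e, hxy.symm]
    · exact (key y x hxy.symm hx).imp fun f hf => ⟨hf.1, hf.2.symm⟩
  · exact key x y hxy hy

instance (k : ℕ) : T2Space (D.Gam k) := by
  refine ⟨fun x y hxy => ?_⟩
  obtain ⟨f, hf, hne⟩ := D.exists_separating hxy
  obtain ⟨u, v, hu, hv, hxu, hyv, huv⟩ := t2_separation hne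
  exact ⟨f ⁻¹' u, f ⁻¹' v, hu.preimage hf, hv.preimage hf, hxu, hyv, huv.preimage f⟩

end SolenoidDatum

/-! ### Threads through the levels and the words of sources. -/

/-- In a tower of relations which are solvable downwards, and solvable upwards within `p`, every
element satisfying `p` is part of an infinite thread. -/
theorem exists_thread {V : ℕ → Type*} [∀ k, Nonempty (V k)] (R : ∀ k, V (k + 1) → V k → Prop)
    (p : ∀ k, V k → Prop) (hdown : ∀ k a, ∃ b, R k a b)
    (hup : ∀ k b, p k b → ∃ a, p (k + 1) a ∧ R k a b) (k : ℕ) (x : V k) (hx : p k x) :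
    ∃ z : ∀ j, V j, z k = x ∧ ∀ j, R j (z (j + 1)) (z j) := by
  classical
  have h1 : ∀ k (x : V k), ∃ z : ∀ j, V j, z k = x ∧ ∀ j, j < k → R j (z (j + 1)) (z j) := by
    intro k
    induction k with
    | zero =>
      intro x
      exact ⟨Function.update (fun j => Classical.arbitrary (V j)) 0 x, Function.update_self ..,
        fun j hj => absurd hj (by omega)⟩
    | succ k ih =>
      intro x
      obtain ⟨b, hb⟩ := hdown k x
      obtain ⟨z, rfl, hz⟩ := ih b
      refine ⟨Function.update z (k + 1) x, Function.update_self .., fun j hj => ?_⟩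
      rcases Nat.lt_succ_iff_lt_or_eq.1 hj with hj | rfl
      · rw [Function.update_of_ne (by omega), Function.update_of_ne (by omega)]
        exact hz j hj
      · rw [Function.update_self, Function.update_of_ne (by omega)]
        exact hb
  obtain ⟨z, rfl, hz⟩ := h1 k x
  have hup' : ∀ k b, ∃ a, p k b → p (k + 1) a ∧ R k a b := fun k b => by
    by_cases hb : p k b
    · exact (hup k b hb).imp fun a ha _ => ha
    · exact ⟨Classical.arbitrary _, fun h => absurd h hb⟩
  choose r hr using hup'
  let y : ∀ j, V j := fun j => Nat.rec (z 0)
    (fun j b => if j + 1 ≤ k then z (j + 1) else r j b) j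
  have hy : ∀ j, y (j + 1) = if j + 1 ≤ k then z (j + 1) else r j (y j) := fun j => rfl
  have hyz : ∀ j, j ≤ k → y j = z j := by
    intro j hj
    cases j with
    | zero => rfl
    | succ j => rw [hy, if_pos hj]
  have hp : ∀ j, k ≤ j → p j (y j) := by
    intro j hj
    induction j, hj using Nat.le_induction with
    | base => rwa [hyz k le_rfl]
    | succ j hj ih => rw [hy, if_neg (by omega)]; exact (hr j _ ih).1
  refine ⟨y, hyz k le_rfl, fun j => ?_⟩
  rw [hy]
  split_ifs with hj
  · rw [hyz j (by omega)]
    exact hz j (by omega)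
  · exact (hr j (y j) (hp j (by omega))).2

namespace OrderedBratteli

variable {B : OrderedBratteli}

/-- The index of the first edge with range `v`. -/
def fstIdx (k : ℕ) (v : B.V (k + 1)) : Fin (B.deg k v) := ⟨0, B.deg_pos k v⟩

/-- The index of the last edge with range `v`. -/
def lstIdx (k : ℕ) (v : B.V (k + 1)) : Fin (B.deg k v) :=
  ⟨B.deg k v - 1, Nat.sub_lt (B.deg_pos k v) one_pos⟩

theorem lstIdx_val (k : ℕ) (v : B.V (k + 1)) : (lstIdx k v).val + 1 = B.deg k v :=
  Nat.sub_add_cancel (B.deg_pos k v)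

/-- The source of the first edge with range `v`. -/
def fst (k : ℕ) (v : B.V (k + 1)) : B.V k := B.src k v (fstIdx k v)

/-- The source of the last edge with range `v`. -/
def lst (k : ℕ) (v : B.V (k + 1)) : B.V k := B.src k v (lstIdx k v)

theorem word_ne_nil (k n : ℕ) (w : B.V (k + n)) : B.word k n w ≠ [] := by
  induction n with
  | zero => simp [word]
  | succ n ih =>
    intro h
    rw [word, List.flatMap_eq_nil_iff] at h
    exact ih _ (h (B.src (k + n) w (fstIdx _ w)) ((List.mem_ofFn' _ _).2 ⟨_, rfl⟩))

/-- The levels `k + 1 + n` and `k + (n + 1)` are only propositionally equal, so their vertices are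
compared by `HEq`. -/
theorem flatMap_ofFn_congr {α : Type*} {a b : ℕ} (hab : a = b) {w : B.V (a + 1)} {w' : B.V (b + 1)}
    (hw : w ≍ w') {F : B.V a → List α} {F' : B.V b → List α}
    (hF : ∀ x x', x ≍ x' → F x = F' x') :
    (List.ofFn (B.src a w)).flatMap F = (List.ofFn (B.src b w')).flatMap F' := by
  subst hab
  obtain rfl := eq_of_heq hw
  rw [funext fun x => hF x x HEq.rfl]

/-- `word` recurses at the top level; here it is unfolded at the bottom, as a substitution applied
to the word of level `k + 1`. This is the form needed to let adjacency descend. -/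
theorem word_succ_eq (k n : ℕ) (w : B.V (k + 1 + n)) (w' : B.V (k + (n + 1))) (hw : w ≍ w') :
    B.word k (n + 1) w' = (B.word (k + 1) n w).flatMap fun v => List.ofFn (B.src k v) := by
  induction n with
  | zero =>
    obtain rfl := eq_of_heq hw
    simp [word, List.flatMap_singleton']
  | succ n ih =>
    rw [word, word, List.flatMap_assoc]
    refine flatMap_ofFn_congr (show k + (n + 1) = k + 1 + n by omega) hw.symm fun x x' hx => ?_
    exact ih x' x hx.symm

theorem exists_heq {a b : ℕ} (h : a = b) (w : B.V a) : ∃ w' : B.V b, w ≍ w' := by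
  subst h; exact ⟨w, HEq.rfl⟩

theorem infix_ofFn {α : Type*} {n : ℕ} (f : Fin n → α) {i j : Fin n} (h : j.val = i.val + 1) :
    [f i, f j] <:+: List.ofFn f := by
  refine ⟨(List.ofFn f).take i, (List.ofFn f).drop (j + 1), ?_⟩
  have hj : j.val < (List.ofFn f).length := by simp
  have hi : i.val < (List.ofFn f).length := by simp
  conv_rhs => rw [← List.take_append_drop i (List.ofFn f), List.drop_eq_getElem_cons hi,
    ← h, List.drop_eq_getElem_cons hj]
  simp

end OrderedBratteli

namespace SolenoidDatum

open OrderedBratteli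

variable (D : SolenoidDatum)

theorem adj_src {k : ℕ} {v : D.B.V (k + 1)} {i j : Fin (D.B.deg k v)} (h : j.val = i.val + 1) :
    D.Adj k (D.B.src k v i) (D.B.src k v j) := by
  refine Follows.adj (Or.inl ⟨1, v, ?_⟩)
  simpa [word, List.flatMap_singleton'] using infix_ofFn (D.B.src k v) h

/-- After substitution, the last letter of the block of `v` stands next to the first letter of the
block of `w`. This makes the bonding maps compatible with the gluing. -/
theorem Follows.lst_fst {D : SolenoidDatum} {k : ℕ} {v w : D.B.V (k + 1)}
    (h : D.Follows (k + 1) v w) : D.Follows k (lst k v) (fst k w) := by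
  obtain ⟨n, u, p, q, h⟩ | ⟨p, q, hp, hq, h1, h2⟩ := h
  · left
    obtain ⟨u', hu⟩ := exists_heq (B := D.B) (show k + 1 + n = k + (n + 1) by omega) u
    refine ⟨n + 1, u', ?_⟩
    rw [word_succ_eq k n u u' hu, ← h]
    simp only [List.flatMap_append, List.flatMap_cons, List.flatMap_nil, List.append_nil]
    have h1 : ∃ l, List.ofFn (D.B.src k v) = l ++ [lst k v] := by
      refine ⟨(List.ofFn (D.B.src k v)).dropLast, ?_⟩
      have hne : List.ofFn (D.B.src k v) ≠ [] := by
        simpa using (D.B.deg_pos k v).ne'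
      conv_lhs => rw [← List.dropLast_append_getLast hne, List.getLast_ofFn]
      rfl
    have h2 : ∃ l, List.ofFn (D.B.src k w) = fst k w :: l := by
      have hne : List.ofFn (D.B.src k w) ≠ [] := by
        simpa using (D.B.deg_pos k w).ne'
      refine ⟨(List.ofFn (D.B.src k w)).tail, ?_⟩
      conv_lhs => rw [← List.cons_head_tail hne, List.head_ofFn]
      rfl
    obtain ⟨l1, h1⟩ := h1
    obtain ⟨l2, h2⟩ := h2
    rw [h1, h2]
    exact ⟨p.flatMap (fun v => List.ofFn (D.B.src k v)) ++ l1,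
      l2 ++ q.flatMap (fun v => List.ofFn (D.B.src k v)), by simp⟩
  · right
    refine ⟨p, q, hp, hq, ?_, ?_⟩
    · rw [← h1, ← p.2 k]
      have : (p.1 k).2 = lstIdx k (p.1 k).1 := Fin.ext (by
        have := hp k; have := lstIdx_val k (p.1 k).1; omega)
      simp only [Edge.source, Edge.range, lst, this]
    · rw [← h2, ← q.2 k]
      have : (q.1 k).2 = fstIdx k (q.1 k).1 := Fin.ext (hq k)
      simp only [Edge.source, Edge.range, fst, this]

theorem gamMap_iff {k : ℕ} {a : D.Gam (k + 1)} {b : D.Gam k} :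
    D.GamMap k a b ↔ ∃ v i s, 0 ≤ s ∧ s ≤ D.ht k (D.B.src k v i) ∧
      a = D.pnt (k + 1) v (D.off k v i + s) ∧ b = D.pnt k (D.B.src k v i) s := by
  have hl := D.lam_pow_pos k
  have hl' := D.lam_pow_pos (k + 1)
  have h1 : 0 < D.lam := by linarith [D.one_lt_lam]
  have key : ∀ v i t, D.pt (k + 1) v
      ((∑ j ∈ Finset.Iio i, D.len k (D.B.src k v j) + t) / D.lam) =
      D.pnt (k + 1) v (D.off k v i + D.lam ^ k * t) := by
    intro v i t
    rw [pt_eq_pnt]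
    congr 1
    have : D.off k v i = D.lam ^ k * ∑ j ∈ Finset.Iio i, D.len k (D.B.src k v j) := by
      rw [Finset.mul_sum]
      exact Finset.sum_congr rfl fun j _ => by rw [len_eq, mul_div_cancel₀ _ hl.ne']
    rw [this, pow_succ]
    field_simp
  constructor
  · rintro ⟨v, i, t, ⟨h0, h2⟩, rfl, rfl⟩
    rw [len_eq, le_div_iff₀ hl] at h2
    exact ⟨v, i, D.lam ^ k * t, mul_nonneg hl.le h0, by linarith, key v i t, D.pt_eq_pnt k _ t⟩
  · rintro ⟨v, i, s, h0, h2, rfl, rfl⟩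
    refine ⟨v, i, s / D.lam ^ k, ⟨div_nonneg h0 hl.le, ?_⟩, ?_, rfl⟩
    · rw [len_eq]; exact div_le_div_of_nonneg_right h2 hl.le
    · rw [key, mul_div_cancel₀ _ hl.ne']

theorem exists_gamMap {k : ℕ} (a : D.Gam (k + 1)) : ∃ b, D.GamMap k a b := by
  obtain ⟨v, s, h0, h1, rfl⟩ := D.exists_pnt a
  obtain ⟨i, t, h2, h3, rfl⟩ := D.exists_off k v h0 h1
  exact ⟨_, D.gamMap_iff.2 ⟨v, i, t, h2, h3, rfl, rfl⟩⟩

theorem exists_gamMap_of_snd {k : ℕ} (b : D.Gam k) : ∃ a, D.GamMap k a b := by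
  obtain ⟨w, s, h0, h1, rfl⟩ := D.exists_pnt b
  obtain ⟨v, i, rfl⟩ := D.B.src_surj k w
  exact ⟨_, D.gamMap_iff.2 ⟨v, i, s, h0, h1, rfl, rfl⟩⟩

/-- Two subdivisions of the same point of an edge. -/
theorem pnt_src_eq {k : ℕ} {v : D.B.V (k + 1)} {i j : Fin (D.B.deg k v)} {s t : ℝ}
    (hs0 : 0 ≤ s) (hs1 : s ≤ D.ht k (D.B.src k v i)) (ht0 : 0 ≤ t)
    (ht1 : t ≤ D.ht k (D.B.src k v j)) (h : D.off k v i + s = D.off k v j + t) :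
    D.pnt k (D.B.src k v i) s = D.pnt k (D.B.src k v j) t := by
  have key : ∀ {i j : Fin (D.B.deg k v)} {s t : ℝ}, 0 ≤ s → s ≤ D.ht k (D.B.src k v i) → 0 ≤ t →
      D.off k v i + s = D.off k v j + t → i < j →
      D.pnt k (D.B.src k v i) s = D.pnt k (D.B.src k v j) t := by
    intro i j s t hs0 hs1 ht0 h hij
    have hi1 : i.val + 1 < D.B.deg k v := by have := j.2; have := Fin.lt_def.1 hij; omega
    have h1 := D.off_succ k v (i := i) (j := ⟨i.val + 1, hi1⟩) rfl
    have hj : j = ⟨i.val + 1, hi1⟩ := by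
      by_contra hne
      have hlt : (⟨i.val + 1, hi1⟩ : Fin (D.B.deg k v)) < j := by
        rw [Fin.lt_def] at hij ⊢
        have : j.val ≠ i.val + 1 := fun h => hne (Fin.ext h)
        simp only
        omega
      have h2 := D.off_lt k v hlt
      linarith [D.ht_pos k (D.B.src k v ⟨i.val + 1, hi1⟩)]
    subst hj
    have hs : s = D.ht k (D.B.src k v i) := by linarith
    have ht : t = 0 := by linarith
    rw [hs, ht]
    exact D.adj_src rfl
  rcases lt_trichotomy i j with hij | hij | hij
  · exact key hs0 hs1 ht0 h hij
  · subst hij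
    rw [add_left_cancel h]
  · exact (key ht0 ht1 hs0 h.symm hij).symm

/-- A map `G` on the unglued edges is defined by choosing a subdivision of each position. It passes
to the quotient by `Follows.lst_fst`, and ambiguous positions at subdivision points are harmless by
`pnt_src_eq`. -/
theorem GamMap.unique {D : SolenoidDatum} {k : ℕ} {a : D.Gam (k + 1)} {b b' : D.Gam k}
    (h : D.GamMap k a b) (h' : D.GamMap k a b') : b = b' := by
  have hex : ∀ p : D.PreGam (k + 1), ∃ b, ∃ i s, 0 ≤ s ∧ s ≤ D.ht k (D.B.src k p.1 i) ∧
      D.lam ^ (k + 1) * p.2.1 = D.off k p.1 i + s ∧ b = D.pnt k (D.B.src k p.1 i) s := by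
    rintro ⟨v, t, ht0, ht1⟩
    have hl := D.lam_pow_pos (k + 1)
    rw [len_eq, le_div_iff₀ hl] at ht1
    obtain ⟨i, s, h2, h3, h4⟩ := D.exists_off k v (mul_nonneg hl.le ht0) (by linarith)
    exact ⟨_, i, s, h2, h3, h4, rfl⟩
  choose G hG using hex
  have hGlue : ∀ a b, D.Glue (k + 1) a b → G a = G b := by
    rintro ⟨v, s⟩ ⟨w, t⟩ ⟨h1, h2, h3⟩
    have h1 : D.Follows (k + 1) v w := h1
    have h2 : s.1 = D.len (k + 1) v := h2
    have h3 : t.1 = 0 := h3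
    obtain ⟨i, s', hi0, hi1, hi2, hi3⟩ := hG ⟨v, s⟩
    obtain ⟨j, t', hj0, hj1, hj2, hj3⟩ := hG ⟨w, t⟩
    dsimp only at hi0 hi1 hi2 hi3 hj0 hj1 hj2 hj3
    rw [hi3, hj3]
    have hv : D.off k v (lstIdx k v) + D.ht k (lst k v) = D.off k v i + s' := by
      rw [← hi2, h2, len_eq, mul_div_cancel₀ _ (D.lam_pow_pos (k + 1)).ne']
      exact D.off_last k v (lstIdx_val k v)
    have hw : D.off k w (fstIdx k w) + 0 = D.off k w j + t' := by
      rw [← hj2, h3, mul_zero, D.off_zero k w rfl, add_zero]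
    rw [← D.pnt_src_eq (D.ht_pos _ _).le le_rfl hi0 hi1 hv,
      ← D.pnt_src_eq le_rfl (D.ht_pos _ _).le hj0 hj1 hw]
    exact h1.lst_fst.adj
  have key : ∀ {a b}, D.GamMap k a b → b = Quot.lift G hGlue a := by
    intro a b h
    obtain ⟨v, i, s, h0, h1, rfl, rfl⟩ := D.gamMap_iff.1 h
    have h2 := D.off_add_le k v i
    have h3 := D.off_nonneg k v i
    rw [D.pnt_eq_mk (k + 1) v (by linarith) (by linarith)]
    obtain ⟨j, t', hj0, hj1, hj2, hj3⟩ := hG ⟨v, ⟨(D.off k v i + s) / D.lam ^ (k + 1),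
      div_nonneg (by linarith) (D.lam_pow_pos _).le, by
        rw [len_eq]; exact div_le_div_of_nonneg_right (by linarith) (D.lam_pow_pos _).le⟩⟩
    simp only [hj3]
    rw [mul_div_cancel₀ _ (D.lam_pow_pos (k + 1)).ne'] at hj2
    exact D.pnt_src_eq h0 h1 hj0 hj1 hj2
  rw [key h, key h']

/-- The graph of the bonding map is a finite union of compact arcs, one for each edge of the
diagram. Compactness of `Ω` rests on this. -/
theorem isClosed_gamMap (k : ℕ) : IsClosed {p : D.Gam (k + 1) × D.Gam k | D.GamMap k p.1 p.2} := by
  have : {p : D.Gam (k + 1) × D.Gam k | D.GamMap k p.1 p.2} = ⋃ e : D.B.Edge k,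
      (fun s => (D.pnt (k + 1) e.1 (D.off k e.1 e.2 + s), D.pnt k (D.B.src k e.1 e.2) s)) ''
        Icc 0 (D.ht k (D.B.src k e.1 e.2)) := by
    ext ⟨a, b⟩
    simp only [mem_ofPred_eq, gamMap_iff, mem_iUnion, mem_image, Prod.mk.injEq, Sigma.exists,
      mem_Icc]
    constructor
    · rintro ⟨v, i, s, h0, h1, rfl, rfl⟩; exact ⟨v, i, s, ⟨h0, h1⟩, rfl, rfl⟩
    · rintro ⟨v, i, s, ⟨h0, h1⟩, rfl, rfl⟩; exact ⟨v, i, s, h0, h1, rfl, rfl⟩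
  rw [this]
  refine isClosed_iUnion_of_finite fun e => (isCompact_Icc.image ?_).isClosed
  exact ((D.continuous_pnt _ _).comp (by fun_prop)).prodMk (D.continuous_pnt _ _)

/-! ### The solenoid -/

theorem continuous_proj (k : ℕ) : Continuous (D.proj k) :=
  (continuous_apply k).comp continuous_subtype_val

variable {D} in
theorem Om.ext {z y : D.Om} (h : ∀ k, D.proj k z = D.proj k y) : z = y :=
  Subtype.ext (funext h)

instance : CompactSpace D.Om := by
  have h : IsClosed {z : ∀ k, D.Gam k | ∀ k, D.GamMap k (z (k + 1)) (z k)} := ?_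
  · exact isCompact_iff_compactSpace.1 h.isCompact
  rw [ofPred_forall]
  exact isClosed_iInter fun k => (D.isClosed_gamMap k).preimage
    ((continuous_apply (k + 1)).prodMk (continuous_apply k))

theorem proj_src {z : D.Om} {k : ℕ} {v : D.B.V (k + 1)} {i : Fin (D.B.deg k v)} {s : ℝ}
    (h0 : 0 ≤ s) (h1 : s ≤ D.ht k (D.B.src k v i))
    (h : D.proj (k + 1) z = D.pnt (k + 1) v (D.off k v i + s)) :
    D.proj k z = D.pnt k (D.B.src k v i) s :=
  GamMap.unique (z.2 k) (D.gamMap_iff.2 ⟨v, i, s, h0, h1, h, rfl⟩)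

theorem proj_eq_of_le {z y : D.Om} {j k : ℕ} (hjk : j ≤ k) (h : D.proj k z = D.proj k y) :
    D.proj j z = D.proj j y := by
  induction k, hjk using Nat.le_induction with
  | base => exact h
  | succ k _ ih =>
    apply ih
    refine GamMap.unique (z.2 k) ?_
    have : z.1 (k + 1) = y.1 (k + 1) := h
    rw [this]
    exact y.2 k

theorem mem_fiber {k : ℕ} {y z : D.Om} : y ∈ D.fiber k z ↔ D.proj k y = D.proj k z :=
  ⟨fun h => h k le_rfl, fun h _ hi => D.proj_eq_of_le hi h⟩

theorem proj_surjective (k : ℕ) : Function.Surjective (D.proj k) := by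
  intro x
  have : ∀ k, Nonempty (D.Gam k) := fun k => ⟨D.pnt k (Classical.arbitrary _) 0⟩
  obtain ⟨z, hz, h⟩ := exists_thread D.GamMap (fun _ _ => True) (fun k a => D.exists_gamMap a)
    (fun k b _ => (D.exists_gamMap_of_snd b).imp fun a ha => ⟨trivial, ha⟩) k x trivial
  exact ⟨⟨z, h⟩, hz⟩

end SolenoidDatum

/-- A thread of finite sets which is determined at level `k` is so by finitely many levels. -/
theorem exists_level_of_unique_thread {V : ℕ → Type*} [∀ k, Finite (V k)]
    (r : ∀ k, V (k + 1) → V k) (k : ℕ) (x : V k)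
    (huniq : ∀ u : ∀ j, V j, (∀ j, u j = r j (u (j + 1))) → u k = x) :
    ∃ K, ∀ u : ∀ j, V j, (∀ j, j < K → u j = r j (u (j + 1))) → u k = x := by
  by_contra! hcon
  let _ : ∀ k, TopologicalSpace (V k) := fun _ => ⊥
  have : ∀ k, DiscreteTopology (V k) := fun _ => ⟨rfl⟩
  -- In the compact product of finite discrete sets, the partial threads missing `x` are decreasing,
  -- closed and nonempty; a common point would be a full thread missing `x`.
  let S : ℕ → Set (∀ j, V j) := fun n => {u | (∀ j, j < n → u j = r j (u (j + 1))) ∧ u k ≠ x}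
  have hS : ∀ n, IsClosed (S n) := by
    intro n
    refine IsClosed.inter (s₁ := {u : ∀ j, V j | ∀ j, j < n → u j = r j (u (j + 1))})
      ?_ ((isClosed_discrete {y | y ≠ x}).preimage (continuous_apply k))
    simp only [ofPred_forall]
    exact isClosed_iInter fun j => isClosed_iInter fun _ => isClosed_eq (continuous_apply j)
      (continuous_of_discreteTopology.comp (continuous_apply (j + 1)))
  obtain ⟨u, hu⟩ := IsCompact.nonempty_iInter_of_sequence_nonempty_isCompact_isClosed S
    (fun n u hu => ⟨fun j hj => hu.1 j (by omega), hu.2⟩) (fun n => hcon n) (hS 0).isCompact hS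
  rw [mem_iInter] at hu
  exact (hu 0).2 (huniq u fun j => (hu (j + 1)).1 j (by omega))

/-! ### Motion along edges -/

section EdgeRel

variable {V X : Type*} {P : V → ℝ → X} {h : V → ℝ} {m s t : ℝ} {x y y' w : X}

/-- Different descriptions of the same point as `P v s`, `0 ≤ s ≤ h v`, occur at ends only. -/
def IsEdgeSystem (P : V → ℝ → X) (h : V → ℝ) : Prop :=
  ∀ ⦃v w s t⦄, 0 ≤ s → s ≤ h v → 0 ≤ t → t ≤ h w → P v s = P w t →
    (v = w ∧ s = t) ∨ ((s = 0 ∨ s = h v) ∧ (t = 0 ∨ t = h w))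

/-- The motion with unit speed leads from `x` to `y` in time `t ≥ 0`, passing the end of an edge
at most once. -/
def EdgeRel (P : V → ℝ → X) (h : V → ℝ) (t : ℝ) (x y : X) : Prop :=
  (∃ v a b, 0 ≤ a ∧ a ≤ b ∧ b ≤ h v ∧ b - a = t ∧ x = P v a ∧ y = P v b) ∨
  ∃ v w a b, P v (h v) = P w 0 ∧ 0 ≤ a ∧ a ≤ h v ∧ 0 ≤ b ∧ b ≤ h w ∧ h v - a + b = t ∧
    x = P v a ∧ y = P w b

theorem IsEdgeSystem.mirror (hU : IsEdgeSystem P h) :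
    IsEdgeSystem (fun v s => P v (h v - s)) h := by
  intro v w s t hs0 hs1 ht0 ht1 he
  rcases hU (by linarith) (by linarith) (by linarith) (by linarith) he with ⟨rfl, h1⟩ | ⟨h1, h2⟩
  · exact Or.inl ⟨rfl, by linarith⟩
  · refine Or.inr ⟨h1.symm.imp ?_ ?_, h2.symm.imp ?_ ?_⟩ <;> intro <;> linarith

/-- Time reversal: results on forward motion apply to backward motion by parametrizing every edge
from its other end. -/
theorem EdgeRel.mirror (he : EdgeRel P h t x y) : EdgeRel (fun v s => P v (h v - s)) h t y x := by
  rcases he with ⟨v, a, b, h1, h2, h3, h4, rfl, rfl⟩ | ⟨v, w, a, b, h1, h2, h3, h4, h5, h6, rfl, rfl⟩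
  · exact Or.inl ⟨v, h v - b, h v - a, by linarith, by linarith, by linarith, by linarith,
      by simp, by simp⟩
  · exact Or.inr ⟨w, v, h w - b, h v - a, by simp [h1], by linarith, by linarith, by linarith,
      by linarith, by linarith, by simp, by simp⟩

theorem EdgeRel.nonneg (he : EdgeRel P h t x y) : 0 ≤ t := by
  rcases he with ⟨v, a, b, h1, h2, h3, h4, -, -⟩ | ⟨v, w, a, b, h1, h2, h3, h4, h5, h6, -, -⟩ <;>
    linarith

theorem EdgeRel.eq_of_zero (he : EdgeRel P h 0 x y) : x = y := by
  rcases he with ⟨v, a, b, h1, h2, h3, h4, rfl, rfl⟩ | ⟨v, w, a, b, h1, h2, h3, h4, h5, h6, rfl, rfl⟩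
  · rw [sub_eq_zero.1 h4]
  · rw [show a = h v by linarith, show b = 0 by linarith, h1]

/-- The total time is less than the length of any edge, so two ends can be passed only when they
coincide, namely when the middle point is itself an end. The cases record which of the motions
passes an end and how the middle point is described. -/
theorem EdgeRel.trans (hU : IsEdgeSystem P h) (hm : ∀ v, m ≤ h v) (hst : s + t < m)
    (h1 : EdgeRel P h s x y) (h2 : EdgeRel P h t y w) : EdgeRel P h (s + t) x w := by
  rcases h1.nonneg.eq_or_lt with rfl | hs
  · rw [h1.eq_of_zero, zero_add]; exact h2
  rcases h2.nonneg.eq_or_lt with rfl | ht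
  · rw [← h2.eq_of_zero, add_zero]; exact h1
  rcases h1 with ⟨v, a, b, h1, h3, h4, h5, rfl, hy⟩ | ⟨v, v', a, b, h1, h3, h4, h5, h6, h7, rfl, hy⟩ <;>
  rcases h2 with ⟨u, c, d, k1, k2, k3, k4, hy', rfl⟩ | ⟨u, u', c, d, k1, k2, k3, k4, k5, k6, hy', rfl⟩
  · rw [hy] at hy'
    rcases hU (by linarith) h4 k1 (by linarith) hy' with ⟨rfl, rfl⟩ | ⟨rfl | rfl, rfl | rfl⟩
    · exact Or.inl ⟨v, a, d, h1, by linarith, k3, by linarith, rfl, rfl⟩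
    · linarith
    · linarith
    · exact Or.inr ⟨v, u, a, d, hy', h1, by linarith, by linarith, k3, by linarith, rfl, rfl⟩
    · linarith
  · rw [hy] at hy'
    rcases hU (by linarith) h4 k2 k3 hy' with ⟨rfl, rfl⟩ | ⟨rfl | rfl, rfl | rfl⟩
    · exact Or.inr ⟨v, u', a, d, k1, h1, by linarith, k4, k5, by linarith, rfl, rfl⟩
    · linarith
    · linarith
    · linarith [hm u]
    · exact Or.inr ⟨v, u', a, d, hy'.trans k1, h1, by linarith, k4, k5, by linarith, rfl, rfl⟩
  · rw [hy] at hy'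
    rcases hU h5 h6 k1 (by linarith) hy' with ⟨rfl, rfl⟩ | ⟨rfl | rfl, rfl | rfl⟩
    · exact Or.inr ⟨v, v', a, d, h1, h3, h4, by linarith, k3, by linarith, rfl, rfl⟩
    · exact Or.inr ⟨v, u, a, d, h1.trans hy', h3, h4, by linarith, k3, by linarith, rfl, rfl⟩
    · linarith
    · linarith [hm v']
    · linarith
  · rw [hy] at hy'
    rcases hU h5 h6 k2 k3 hy' with ⟨rfl, rfl⟩ | ⟨rfl | rfl, rfl | rfl⟩
    · linarith [hm v']
    · linarith [hm u]
    · exact Or.inr ⟨v, u', a, d, h1.trans (hy'.trans k1), h3, h4, k4, k5, by linarith, rfl, rfl⟩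
    · linarith [hm u]
    · linarith [hm v']

/-- Motions from the same point can be told apart only after passing the end of an edge. -/
theorem EdgeRel.eq_or_exists (hU : IsEdgeSystem P h) (hm : ∀ v, m ≤ h v) (ht : t < m)
    (h1 : EdgeRel P h t x y) (h2 : EdgeRel P h t x y') :
    y = y' ∨ ∃ v w b, 0 ≤ b ∧ b ≤ t ∧ y = P v b ∧ y' = P w b := by
  rcases h1.nonneg.eq_or_lt with rfl | ht0
  · left; rw [← h1.eq_of_zero, ← h2.eq_of_zero]
  rcases h1 with ⟨v, a, b, h1, h3, h4, h5, hx, rfl⟩ | ⟨v, v', a, b, h1, h3, h4, h5, h6, h7, hx, rfl⟩ <;>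
  rcases h2 with ⟨u, c, d, k1, k2, k3, k4, hx', rfl⟩ | ⟨u, u', c, d, k1, k2, k3, k4, k5, k6, hx', rfl⟩
  · rw [hx] at hx'
    rcases hU h1 (by linarith) k1 (by linarith) hx' with ⟨rfl, rfl⟩ | ⟨rfl | rfl, rfl | rfl⟩
    · left; rw [show b = d by linarith]
    · exact Or.inr ⟨v, u, t, by linarith, le_rfl, by rw [← h5, sub_zero], by rw [← k4, sub_zero]⟩
    · linarith
    · linarith
    · linarith
  · rw [hx] at hx'
    rcases hU h1 (by linarith) k2 k3 hx' with ⟨rfl, rfl⟩ | ⟨rfl | rfl, rfl | rfl⟩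
    · left
      rw [show b = h v by linarith, show d = 0 by linarith, k1]
    · linarith [hm u]
    · exact Or.inr ⟨v, u', t, by linarith, le_rfl, by rw [← h5, sub_zero], by
        rw [← k6, sub_self, zero_add]⟩
    · linarith
    · linarith
  · rw [hx] at hx'
    rcases hU h3 h4 k1 (by linarith) hx' with ⟨rfl, rfl⟩ | ⟨rfl | rfl, rfl | rfl⟩
    · left
      rw [show d = h v by linarith, show b = 0 by linarith, h1]
    · linarith [hm v]
    · linarith
    · exact Or.inr ⟨v', u, t, by linarith, le_rfl, by rw [← h7, sub_self, zero_add], by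
        rw [← k4, sub_zero]⟩
    · linarith
  · rw [hx] at hx'
    rcases hU h3 h4 k2 k3 hx' with ⟨rfl, rfl⟩ | ⟨rfl | rfl, rfl | rfl⟩
    · exact Or.inr ⟨v', u', b, h5, by linarith, rfl, by rw [show b = d by linarith]⟩
    · linarith [hm v]
    · linarith [hm v]
    · linarith [hm u]
    · exact Or.inr ⟨v', u', b, h5, by linarith, rfl, by rw [show b = d by linarith]⟩

theorem EdgeRel.eq_of_interior (hU : IsEdgeSystem P h) {v : V} {a : ℝ}
    (h1 : EdgeRel P h t (P v a) y) (ha0 : 0 < a) (ha1 : a < h v) (hat : a + t ≤ h v) :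
    y = P v (a + t) := by
  rcases h1 with ⟨u, c, d, k1, k2, k3, k4, hx, rfl⟩ | ⟨u, u', c, d, k1, k2, k3, k4, k5, k6, hx, rfl⟩
  · rcases hU ha0.le ha1.le k1 (by linarith) hx with ⟨rfl, rfl⟩ | ⟨h1 | h1, -⟩
    · rw [← k4]; ring_nf
    · linarith
    · linarith
  · rcases hU ha0.le ha1.le k2 k3 hx with ⟨rfl, rfl⟩ | ⟨h1 | h1, -⟩
    · rw [show d = 0 by linarith, show a + t = h v by linarith, k1]
    · linarith
    · linarith

theorem EdgeRel.exists_of_end (hU : IsEdgeSystem P h) (hm : ∀ v, m ≤ h v) (ht0 : 0 < t) (ht : t < m)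
    {v : V} {a : ℝ} (h1 : EdgeRel P h t (P v a) y) (ha : a = 0 ∨ a = h v) :
    ∃ w, P v a = P w 0 ∧ y = P w t := by
  have hv := hm v
  have ha0 : 0 ≤ a := by rcases ha with rfl | rfl <;> linarith
  have ha1 : a ≤ h v := by rcases ha with rfl | rfl <;> linarith
  rcases h1 with ⟨u, c, d, k1, k2, k3, k4, hx, rfl⟩ | ⟨u, u', c, d, k1, k2, k3, k4, k5, k6, hx, rfl⟩
  · have hc : c = 0 ∨ c = h u := by
      rcases hU ha0 ha1 k1 (by linarith) hx with ⟨rfl, rfl⟩ | ⟨-, h2⟩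
      exacts [ha, h2]
    rcases hc with rfl | rfl
    · exact ⟨u, hx, by rw [← k4, sub_zero]⟩
    · linarith
  · have hc : c = 0 ∨ c = h u := by
      rcases hU ha0 ha1 k2 k3 hx with ⟨rfl, rfl⟩ | ⟨-, h2⟩
      exacts [ha, h2]
    rcases hc with rfl | rfl
    · linarith [hm u]
    · exact ⟨u', hx.trans k1, by rw [← k6, sub_self, zero_add]⟩

/-- A closed motion takes at least the time of one full edge. This is the source of the no-return
property of fibres. -/
theorem EdgeRel.ne (hU : IsEdgeSystem P h) (hm : ∀ v, m ≤ h v) (ht0 : 0 < t) (ht : t < m) :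
    ¬ EdgeRel P h t x x := by
  rintro (⟨u, c, d, k1, k2, k3, k4, hx, hy⟩ | ⟨u, u', c, d, k1, k2, k3, k4, k5, k6, hx, hy⟩)
  · rw [hx] at hy
    have := hm u
    rcases hU k1 (by linarith) (by linarith) k3 hy with ⟨-, rfl⟩ | ⟨rfl | rfl, rfl | rfl⟩ <;> linarith
  · rw [hx] at hy
    have := hm u
    have := hm u'
    rcases hU k2 k3 k4 k5 hy with ⟨rfl, rfl⟩ | ⟨rfl | rfl, rfl | rfl⟩ <;> linarith

end EdgeRel

/-! ### Extremal paths, growth of edges, and neighbours. -/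

namespace OrderedBratteli

variable {B : OrderedBratteli}

/-- An infinite thread of first sources is a minimal path, hence it is `q`; compactness reduces this
to finitely many levels. -/
theorem IsMinPath.exists_level (hprop : B.ProperlyOrdered) {q : B.InfPath} (hq : B.IsMinPath q)
    (k : ℕ) : ∃ K, ∀ u : ∀ j, B.V j, (∀ j, j < K → u j = fst j (u (j + 1))) →
      u k = (q.1 k).source := by
  refine exists_level_of_unique_thread fst k _ fun u hu => ?_
  let p : B.InfPath := ⟨fun j => ⟨u (j + 1), fstIdx j (u (j + 1))⟩, fun j => hu (j + 1)⟩
  rw [hprop.1.unique hq (y₂ := p) fun j => rfl]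
  exact hu k

theorem IsMaxPath.eq_source (hprop : B.ProperlyOrdered) {q : B.InfPath} (hq : B.IsMaxPath q)
    (k : ℕ) {u : ∀ j, B.V j} (hu : ∀ j, u j = lst j (u (j + 1))) : u k = (q.1 k).source := by
  let p : B.InfPath := ⟨fun j => ⟨u (j + 1), lstIdx j (u (j + 1))⟩, fun j => hu (j + 1)⟩
  rw [hprop.2.unique hq (y₂ := p) fun j => lstIdx_val _ _]
  exact hu k

theorem IsMinPath.eq_source (hprop : B.ProperlyOrdered) {q : B.InfPath} (hq : B.IsMinPath q)
    (k : ℕ) {u : ∀ j, B.V j} (hu : ∀ j, u j = fst j (u (j + 1))) : u k = (q.1 k).source := by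
  obtain ⟨K, hK⟩ := hq.exists_level hprop k
  exact hK u fun j _ => hu j

theorem IsMaxPath.exists_level (hprop : B.ProperlyOrdered) {q : B.InfPath} (hq : B.IsMaxPath q)
    (k : ℕ) : ∃ K, ∀ u : ∀ j, B.V j, (∀ j, j < K → u j = lst j (u (j + 1))) →
      u k = (q.1 k).source :=
  exists_level_of_unique_thread lst k _ fun _ hu => hq.eq_source hprop k hu

theorem exists_down (r : ∀ k, B.V (k + 1) → B.V k) (K : ℕ) (w : B.V K) :
    ∃ u : ∀ j, B.V j, u K = w ∧ ∀ j, j < K → u j = r j (u (j + 1)) := by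
  classical
  induction K with
  | zero =>
    exact ⟨Function.update (fun j => Classical.arbitrary (B.V j)) 0 w, Function.update_self ..,
      fun j hj => absurd hj (by omega)⟩
  | succ K ih =>
    obtain ⟨u, hu, hz⟩ := ih (r K w)
    refine ⟨Function.update u (K + 1) w, Function.update_self .., fun j hj => ?_⟩
    rcases Nat.lt_succ_iff_lt_or_eq.1 hj with hj | rfl
    · rw [Function.update_of_ne (by omega), Function.update_of_ne (by omega)]
      exact hz j hj
    · rw [Function.update_self, Function.update_of_ne (by omega), hu]

theorem one_le_length_word (k n : ℕ) (w : B.V (k + n)) : 1 ≤ (B.word k n w).length :=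
  List.length_pos_iff.2 (word_ne_nil k n w)

/-- Either the last edges coincide and the difference lies lower down, or they differ and each
contributes a nonempty block. -/
theorem two_le_length_word {k n : ℕ} {v : B.V k} {w : B.V (k + n)} {p q : B.FinPath v n w}
    (h : p ≠ q) : 2 ≤ (B.word k n w).length := by
  induction p with
  | nil => cases q; exact absurd rfl h
  | @snoc n w i p ih =>
    cases q with
    | snoc _ j q =>
      rw [word, List.length_flatMap, List.map_ofFn, List.sum_ofFn]
      have hpos : ∀ i, 1 ≤ (List.length ∘ B.word k n ∘ B.src (k + n) w) i := fun i =>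
        one_le_length_word k n _
      by_cases hij : i = j
      · subst hij
        exact (ih (q := q) fun hpq => h (by rw [hpq])).trans
          (Finset.single_le_sum (f := List.length ∘ B.word k n ∘ B.src (k + n) w)
            (fun i _ => Nat.zero_le _) (Finset.mem_univ i))
      · have := Finset.add_le_sum (f := List.length ∘ B.word k n ∘ B.src (k + n) w)
          (fun i _ => Nat.zero_le _) (Finset.mem_univ i) (Finset.mem_univ j) hij
        have h1 := hpos i
        have h2 := hpos j
        simp only [Function.comp_def] at *
        omega

end OrderedBratteli

namespace SolenoidDatum

open OrderedBratteli

variable (D : SolenoidDatum)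

theorem ht_eq_sum_word (k n : ℕ) (w : D.B.V (k + n)) :
    D.ht (k + n) w = ((D.B.word k n w).map (D.ht k)).sum := by
  induction n with
  | zero => simp [word]
  | succ n ih =>
    rw [word, List.map_flatMap, List.flatMap, List.sum_flatten, List.map_map, List.map_ofFn,
      List.sum_ofFn]
    refine (D.ht_succ (k + n) w).trans ?_
    exact Finset.sum_congr rfl fun i _ => ih _

/-- Strong minimality at least doubles the shortest edge after finitely many levels. Hence `EdgeRel`
at deep levels covers motion for any time. -/
theorem exists_lt_mht (hmin : D.B.StronglyMinimal) (t : ℝ) : ∃ k, t < D.mht k := by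
  have key : ∀ N : ℕ, ∃ k, 2 ^ N * D.mht 0 ≤ D.mht k := by
    intro N
    induction N with
    | zero => exact ⟨0, by simp⟩
    | succ N ih =>
      obtain ⟨k, hk⟩ := ih
      obtain ⟨n, hn⟩ := hmin k
      refine ⟨k + n, D.le_mht fun w => ?_⟩
      obtain ⟨p, q, hpq⟩ := hn (Classical.arbitrary _) w
      have h2 := two_le_length_word hpq
      have h3 : 2 * D.mht k ≤ D.ht (k + n) w := by
        rw [ht_eq_sum_word]
        have := List.card_nsmul_le_sum ((D.B.word k n w).map (D.ht k)) (D.mht k) (by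
          intro x hx
          obtain ⟨v, -, rfl⟩ := List.mem_map.1 hx
          exact D.mht_le k v)
        rw [List.length_map, nsmul_eq_mul] at this
        refine le_trans (mul_le_mul_of_nonneg_right ?_ (D.mht_pos k).le) this
        exact_mod_cast h2
      rw [pow_succ]
      linarith
  obtain ⟨N, hN⟩ := pow_unbounded_of_one_lt (t / D.mht 0) one_lt_two
  obtain ⟨k, hk⟩ := key N
  rw [div_lt_iff₀ (D.mht_pos 0)] at hN
  exact ⟨k, hN.trans_le hk⟩

theorem Adj.lst_fst {D : SolenoidDatum} {k : ℕ} {v w : D.B.V (k + 1)} (h : D.Adj (k + 1) v w) :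
    D.Adj k (lst k v) (fst k w) := by
  refine GamMap.unique (a := D.pnt (k + 1) v (D.ht (k + 1) v)) (D.gamMap_iff.2 ⟨v, lstIdx k v,
    _, (D.ht_pos _ _).le, le_rfl, ?_, rfl⟩) (D.gamMap_iff.2 ⟨w, fstIdx k w, _, le_rfl,
    (D.ht_pos _ _).le, ?_, rfl⟩)
  · rw [D.off_last k v (lstIdx_val k v)]
  · rw [D.off_zero k w rfl, add_zero]; exact h

theorem adj_max_min {p q : D.B.InfPath} (hp : D.B.IsMaxPath p) (hq : D.B.IsMinPath q) (k : ℕ) :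
    D.Adj k (p.1 k).source (q.1 k).source :=
  Follows.adj (Or.inr ⟨p, q, hp, hq, rfl, rfl⟩)

/-- A vertex without right neighbour is the source of last edges only, and their ranges have no
right neighbour either. The thread so obtained is the maximal path, which is followed by the minimal
one. -/
theorem exists_adj_right (hprop : D.B.ProperlyOrdered) {k : ℕ} (v : D.B.V k) :
    ∃ w, D.Adj k v w := by
  by_contra hv
  obtain ⟨u, rfl, hu⟩ := exists_thread (fun k a b => b = lst k a) (fun k v => ¬ ∃ w, D.Adj k v w)
    (fun k a => ⟨_, rfl⟩) (by
      intro k b hb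
      obtain ⟨v, i, rfl⟩ := D.B.src_surj k b
      have hi : i.val + 1 = D.B.deg k v := by
        by_contra hne
        exact hb ⟨_, D.adj_src (i := i) (j := ⟨i.val + 1, by omega⟩) rfl⟩
      have hl : D.B.src k v i = lst k v := by
        have := lstIdx_val k v
        rw [lst, show lstIdx k v = i from Fin.ext (by omega)]
      refine ⟨v, ?_, hl⟩
      rintro ⟨w, hw⟩
      exact hb ⟨_, hl ▸ hw.lst_fst⟩) k v hv
  obtain ⟨p, hp, -⟩ := hprop.2
  obtain ⟨q, hq, -⟩ := hprop.1
  exact hv ⟨_, (hp.eq_source hprop k hu) ▸ D.adj_max_min hp hq k⟩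

theorem exists_adj_left (hprop : D.B.ProperlyOrdered) {k : ℕ} (w : D.B.V k) :
    ∃ v, D.Adj k v w := by
  by_contra hw
  obtain ⟨u, rfl, hu⟩ := exists_thread (fun k a b => b = fst k a) (fun k w => ¬ ∃ v, D.Adj k v w)
    (fun k a => ⟨_, rfl⟩) (by
      intro k b hb
      obtain ⟨w, i, rfl⟩ := D.B.src_surj k b
      have hi : i.val = 0 := by
        by_contra hne
        exact hb ⟨_, D.adj_src (i := ⟨i.val - 1, by omega⟩) (j := i) (by simp only; omega)⟩
      have hl : D.B.src k w i = fst k w := by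
        rw [fst, show fstIdx k w = i from Fin.ext (by rw [hi]; rfl)]
      refine ⟨w, ?_, hl⟩
      rintro ⟨v, hv⟩
      exact hb ⟨_, hl ▸ hv.lst_fst⟩) k w hw
  obtain ⟨p, hp, -⟩ := hprop.2
  obtain ⟨q, hq, -⟩ := hprop.1
  exact hw ⟨_, (hq.eq_source hprop k hu) ▸ D.adj_max_min hp hq k⟩

/-! ### The flow as a relation -/

theorem isEdgeSystem (k : ℕ) : IsEdgeSystem (D.pnt k) (D.ht k) :=
  fun _ _ _ _ hs0 hs1 ht0 ht1 h => D.pnt_eq_pnt hs0 hs1 ht0 ht1 h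

theorem edgeRel_refl (k : ℕ) (x : D.Gam k) : EdgeRel (D.pnt k) (D.ht k) 0 x x := by
  obtain ⟨v, s, h0, h1, rfl⟩ := D.exists_pnt x
  exact Or.inl ⟨v, s, s, h0, le_rfl, h1, sub_self s, rfl, rfl⟩

theorem isClosed_edgeRel (k : ℕ) :
    IsClosed {p : ℝ × D.Gam k × D.Gam k | EdgeRel (D.pnt k) (D.ht k) p.1 p.2.1 p.2.2} := by
  have : {p : ℝ × D.Gam k × D.Gam k | EdgeRel (D.pnt k) (D.ht k) p.1 p.2.1 p.2.2} =
      (⋃ v, (fun q : ℝ × ℝ => (q.2 - q.1, D.pnt k v q.1, D.pnt k v q.2)) ''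
        (Icc 0 (D.ht k v) ×ˢ Icc 0 (D.ht k v) ∩ {q | q.1 ≤ q.2})) ∪
      ⋃ e : {e : D.B.V k × D.B.V k // D.Adj k e.1 e.2},
        (fun q : ℝ × ℝ => (D.ht k e.1.1 - q.1 + q.2, D.pnt k e.1.1 q.1, D.pnt k e.1.2 q.2)) ''
        (Icc 0 (D.ht k e.1.1) ×ˢ Icc 0 (D.ht k e.1.2)) := by
    ext ⟨t, x, y⟩
    simp only [mem_ofPred_eq, mem_union, mem_iUnion, mem_image, mem_inter_iff, mem_prod, mem_Icc,
      Prod.mk.injEq, Prod.exists, Subtype.exists, EdgeRel]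
    refine or_congr (exists_congr fun v => exists_congr fun a => exists_congr fun b => ?_)
      (exists_congr fun v => exists_congr fun w => ?_)
    · constructor
      · rintro ⟨h1, h2, h3, rfl, rfl, rfl⟩
        exact ⟨⟨⟨⟨h1, h2.trans h3⟩, h1.trans h2, h3⟩, h2⟩, rfl, rfl, rfl⟩
      · rintro ⟨⟨⟨⟨h1, h2⟩, h3, h4⟩, h5⟩, rfl, rfl, rfl⟩
        exact ⟨h1, h5, h4, rfl, rfl, rfl⟩
    · constructor
      · rintro ⟨a, b, h, h1, h2, h3, h4, rfl, rfl, rfl⟩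
        exact ⟨h, a, b, ⟨⟨h1, h2⟩, h3, h4⟩, rfl, rfl, rfl⟩
      · rintro ⟨h, a, b, ⟨⟨h1, h2⟩, h3, h4⟩, rfl, rfl, rfl⟩
        exact ⟨a, b, h, h1, h2, h3, h4, rfl, rfl, rfl⟩
  rw [this]
  refine IsClosed.union (isClosed_iUnion_of_finite fun v => (IsCompact.image ?_ ?_).isClosed)
    (isClosed_iUnion_of_finite fun e => (IsCompact.image ?_ ?_).isClosed)
  · exact (isCompact_Icc.prod isCompact_Icc).inter_right (isClosed_le continuous_fst continuous_snd)
  · exact (by fun_prop : Continuous fun q : ℝ × ℝ => q.2 - q.1).prodMk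
      (((D.continuous_pnt k v).comp continuous_fst).prodMk
        ((D.continuous_pnt k v).comp continuous_snd))
  · exact isCompact_Icc.prod isCompact_Icc
  · exact (by fun_prop : Continuous fun q : ℝ × ℝ => D.ht k e.1.1 - q.1 + q.2).prodMk
      (((D.continuous_pnt k _).comp continuous_fst).prodMk
        ((D.continuous_pnt k _).comp continuous_snd))

/-- In less time than the shortest edge of level `k`, at most one subdivision point is passed within
an edge of level `k + 1`. Passing between two such edges becomes passing from the last subedge of
one to the first of the other. -/
theorem edgeRel_of_succ {k : ℕ} {t : ℝ} (ht : t < D.mht k) {z y : D.Om}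
    (h : EdgeRel (D.pnt (k + 1)) (D.ht (k + 1)) t (D.proj (k + 1) z) (D.proj (k + 1) y)) :
    EdgeRel (D.pnt k) (D.ht k) t (D.proj k z) (D.proj k y) := by
  rcases h.nonneg.eq_or_lt with rfl | ht0
  · rw [D.proj_eq_of_le (Nat.le_succ k) h.eq_of_zero]
    exact D.edgeRel_refl k _
  rcases h with ⟨v, a, b, h1, h2, h3, h4, hz, hy⟩ | ⟨v, w, a, b, h1, h2, h3, h4, h5, h6, hz, hy⟩
  · obtain ⟨i, s, i1, i2, rfl⟩ := D.exists_off k v h1 (h2.trans h3)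
    obtain ⟨j, s', j1, j2, rfl⟩ := D.exists_off k v (h1.trans h2) h3
    have hz' := D.proj_src i1 i2 hz
    have hy' := D.proj_src j1 j2 hy
    rcases lt_trichotomy i j with hij | rfl | hij
    · have hi1 : i.val + 1 < D.B.deg k v := by have := j.2; have := Fin.lt_def.1 hij; omega
      have h5 := D.off_succ k v (i := i) (j := ⟨i.val + 1, hi1⟩) rfl
      have hj : j = ⟨i.val + 1, hi1⟩ := by
        by_contra hne
        have hlt : (⟨i.val + 1, hi1⟩ : Fin (D.B.deg k v)) < j := by
          rw [Fin.lt_def] at hij ⊢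
          have : j.val ≠ i.val + 1 := fun h => hne (Fin.ext h)
          simp only
          omega
        have h2 := D.off_lt k v hlt
        linarith [D.mht_le k (D.B.src k v ⟨i.val + 1, hi1⟩)]
      subst hj
      exact Or.inr ⟨_, _, s, s', D.adj_src rfl, i1, i2, j1, j2, by linarith, hz', hy'⟩
    · exact Or.inl ⟨_, s, s', i1, by linarith, j2, by linarith, hz', hy'⟩
    · linarith [D.off_lt k v hij]
  · have h7 := D.off_last k v (lstIdx_val k v)
    have h8 := D.mht_le k (lst k v)
    have h9 := D.mht_le k (fst k w)
    refine Or.inr ⟨lst k v, fst k w, a - D.off k v (lstIdx k v), b, Adj.lst_fst h1, ?_, ?_, h4, ?_,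
      ?_, D.proj_src ?_ ?_ ?_, D.proj_src (i := fstIdx k w) h4 ?_ ?_⟩
    any_goals simp only [lst, fst] at *
    any_goals linarith
    · rw [hz]; congr 1; ring
    · rw [hy, D.off_zero k w rfl, zero_add]

theorem edgeRel_trans {k : ℕ} {s t : ℝ} (hst : s + t < D.mht k) {x y w : D.Gam k}
    (h1 : EdgeRel (D.pnt k) (D.ht k) s x y) (h2 : EdgeRel (D.pnt k) (D.ht k) t y w) :
    EdgeRel (D.pnt k) (D.ht k) (s + t) x w :=
  h1.trans (D.isEdgeSystem k) (D.mht_le k) hst h2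

theorem exists_edgeRel_right (hprop : D.B.ProperlyOrdered) {k : ℕ} {t : ℝ} (h0 : 0 ≤ t)
    (ht : t < D.mht k) (x : D.Gam k) : ∃ y, EdgeRel (D.pnt k) (D.ht k) t x y := by
  obtain ⟨v, a, ha0, ha1, rfl⟩ := D.exists_pnt x
  by_cases h : a + t ≤ D.ht k v
  · exact ⟨_, Or.inl ⟨v, a, a + t, ha0, by linarith, h, by ring, rfl, rfl⟩⟩
  · obtain ⟨w, hw⟩ := D.exists_adj_right hprop v
    have := D.mht_le k w
    exact ⟨_, Or.inr ⟨v, w, a, a + t - D.ht k v, hw, ha0, ha1, by linarith, by linarith, by ring,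
      rfl, rfl⟩⟩

theorem exists_edgeRel_left (hprop : D.B.ProperlyOrdered) {k : ℕ} {t : ℝ} (h0 : 0 ≤ t)
    (ht : t < D.mht k) (y : D.Gam k) : ∃ x, EdgeRel (D.pnt k) (D.ht k) t x y := by
  obtain ⟨w, b, hb0, hb1, rfl⟩ := D.exists_pnt y
  by_cases h : 0 ≤ b - t
  · exact ⟨_, Or.inl ⟨w, b - t, b, h, by linarith, hb1, by ring, rfl, rfl⟩⟩
  · obtain ⟨v, hv⟩ := D.exists_adj_left hprop w
    have := D.mht_le k v
    exact ⟨_, Or.inr ⟨v, w, D.ht k v - (t - b), b, hv, by linarith, by linarith, hb0, hb1,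
      by ring, rfl, rfl⟩⟩

/-- `y` is reached from `z` in time `t ≥ 0`. -/
def Fwd (t : ℝ) (z y : D.Om) : Prop :=
  0 ≤ t ∧ ∀ k, D.mht k ≤ t ∨ EdgeRel (D.pnt k) (D.ht k) t (D.proj k z) (D.proj k y)

theorem isClosed_fwd : IsClosed {p : ℝ × D.Om × D.Om | D.Fwd p.1 p.2.1 p.2.2} := by
  refine IsClosed.inter (s₁ := {p : ℝ × D.Om × D.Om | 0 ≤ p.1}) (s₂ := {p : ℝ × D.Om × D.Om |
    ∀ k, D.mht k ≤ p.1 ∨ EdgeRel (D.pnt k) (D.ht k) p.1 (D.proj k p.2.1) (D.proj k p.2.2)})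
    (isClosed_le continuous_const continuous_fst) ?_
  rw [ofPred_forall]
  refine isClosed_iInter fun k => IsClosed.union (s₁ := {p : ℝ × D.Om × D.Om | D.mht k ≤ p.1})
    (isClosed_le continuous_const continuous_fst) ?_
  exact (D.isClosed_edgeRel k).preimage (continuous_fst.prodMk
    (((D.continuous_proj k).comp (continuous_fst.comp continuous_snd)).prodMk
      ((D.continuous_proj k).comp (continuous_snd.comp continuous_snd))))

/-- Levels with `mht k ≤ t` impose nothing; since `mht` is monotone, the conditions of the other
levels form a decreasing sequence of closed nonempty sets in a compact space. -/
theorem exists_of_levels {t : ℝ} (E : ℕ → Set (D.Om)) (hE : ∀ k, IsClosed (E k))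
    (hdec : ∀ k, t < D.mht k → E (k + 1) ⊆ E k) (hne : ∀ k, t < D.mht k → (E k).Nonempty) :
    ∃ y, ∀ k, D.mht k ≤ t ∨ y ∈ E k := by
  have : Nonempty D.Om := ⟨(D.proj_surjective 0 (D.pnt 0 (Classical.arbitrary _) 0)).choose⟩
  have hcl : ∀ k, IsClosed {y | D.mht k ≤ t ∨ y ∈ E k} := fun k =>
    isClosed_const.union (s₁ := {_y | D.mht k ≤ t}) (hE k)
  obtain ⟨y, hy⟩ := IsCompact.nonempty_iInter_of_sequence_nonempty_isCompact_isClosed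
    (fun k => {y | D.mht k ≤ t ∨ y ∈ E k})
    (fun k y hy => by
      by_cases hk : D.mht k ≤ t
      · exact Or.inl hk
      · refine Or.inr (hdec k (not_le.1 hk) (hy.resolve_left fun h => ?_))
        exact hk ((D.mht_le_succ k).trans h))
    (fun k => by
      by_cases hk : D.mht k ≤ t
      · exact ⟨Classical.arbitrary _, Or.inl hk⟩
      · exact (hne k (not_le.1 hk)).mono fun y hy => Or.inr hy)
    (hcl 0).isCompact hcl
  exact ⟨y, mem_iInter.1 hy⟩

theorem exists_fwd_right (hprop : D.B.ProperlyOrdered) {t : ℝ} (h0 : 0 ≤ t) (z : D.Om) :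
    ∃ y, D.Fwd t z y := by
  obtain ⟨y, hy⟩ := D.exists_of_levels (t := t)
    (fun k => {y | EdgeRel (D.pnt k) (D.ht k) t (D.proj k z) (D.proj k y)})
    (fun k => (D.isClosed_edgeRel k).preimage (continuous_const.prodMk
      (continuous_const.prodMk (D.continuous_proj k))))
    (fun k hk y hy => D.edgeRel_of_succ hk hy) fun k hk => by
      obtain ⟨x, hx⟩ := D.exists_edgeRel_right hprop h0 hk (D.proj k z)
      obtain ⟨y, rfl⟩ := D.proj_surjective k x
      exact ⟨y, hx⟩
  exact ⟨y, h0, hy⟩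

theorem exists_fwd_left (hprop : D.B.ProperlyOrdered) {t : ℝ} (h0 : 0 ≤ t) (y : D.Om) :
    ∃ z, D.Fwd t z y := by
  obtain ⟨z, hz⟩ := D.exists_of_levels (t := t)
    (fun k => {z | EdgeRel (D.pnt k) (D.ht k) t (D.proj k z) (D.proj k y)})
    (fun k => (D.isClosed_edgeRel k).preimage (continuous_const.prodMk
      ((D.continuous_proj k).prodMk continuous_const)))
    (fun k hk y hy => D.edgeRel_of_succ hk hy) fun k hk => by
      obtain ⟨x, hx⟩ := D.exists_edgeRel_left hprop h0 hk (D.proj k y)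
      obtain ⟨y, rfl⟩ := D.proj_surjective k x
      exact ⟨y, hx⟩
  exact ⟨z, h0, hz⟩

theorem Fwd.trans {D : SolenoidDatum} {s t : ℝ} {z y x : D.Om} (h1 : D.Fwd s z y)
    (h2 : D.Fwd t y x) : D.Fwd (s + t) z x := by
  refine ⟨add_nonneg h1.1 h2.1, fun k => ?_⟩
  by_cases hk : D.mht k ≤ s + t
  · exact Or.inl hk
  · rw [not_le] at hk
    refine Or.inr (D.edgeRel_trans hk ((h1.2 k).resolve_left ?_) ((h2.2 k).resolve_left ?_))
    · linarith [h2.1]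
    · linarith [h1.1]

/-- An edge and its first subedge begin together, so a short elapsed time `b` is read identically on
all levels from `k` down to `j`. -/
theorem proj_fst_of_le {j k : ℕ} (hjk : j ≤ k) {u : ∀ i, D.B.V i}
    (hu : ∀ i, i < k → u i = fst i (u (i + 1))) {b : ℝ} (h0 : 0 ≤ b) (hb : b ≤ D.mht j) {y : D.Om}
    (hy : D.proj k y = D.pnt k (u k) b) : D.proj j y = D.pnt j (u j) b := by
  induction k, hjk using Nat.le_induction with
  | base => exact hy
  | succ k hk ih =>
    refine ih (fun i hi => hu i (by omega)) ?_
    rw [hu k (Nat.lt_succ_self k)]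
    refine D.proj_src (i := fstIdx k _) h0 (hb.trans ((D.mht_mono hk).trans (D.mht_le k _))) ?_
    rw [hy, D.off_zero k _ rfl, zero_add]

theorem proj_lst_of_le {j k : ℕ} (hjk : j ≤ k) {u : ∀ i, D.B.V i}
    (hu : ∀ i, i < k → u i = lst i (u (i + 1))) {b : ℝ} (h0 : 0 ≤ b) (hb : b ≤ D.mht j) {y : D.Om}
    (hy : D.proj k y = D.pnt k (u k) (D.ht k (u k) - b)) :
    D.proj j y = D.pnt j (u j) (D.ht j (u j) - b) := by
  induction k, hjk using Nat.le_induction with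
  | base => exact hy
  | succ k hk ih =>
    refine ih (fun i hi => hu i (by omega)) ?_
    rw [hu k (Nat.lt_succ_self k)]
    have h1 := hb.trans ((D.mht_mono hk).trans (D.mht_le k (lst k (u (k + 1)))))
    refine D.proj_src (i := lstIdx k _) (sub_nonneg.2 h1) (sub_le_self _ h0) ?_
    rw [hy, ← D.off_last k _ (lstIdx_val k _), lst, add_sub_assoc]

/-- Two motions can differ at level `K` only by having entered different edges, in which both have
spent the same time `b`. If `K` is deep enough, the first subedges of level `k` of both edges are
the one on the minimal path, so the images at level `k` coincide. -/
theorem Fwd.unique_right {D : SolenoidDatum} (hmin : D.B.StronglyMinimal)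
    (hprop : D.B.ProperlyOrdered) {t : ℝ} {z y y' : D.Om} (h : D.Fwd t z y) (h' : D.Fwd t z y') :
    y = y' := by
  refine Om.ext fun j => ?_
  obtain ⟨k₀, hk₀⟩ := D.exists_lt_mht hmin t
  set k := max j k₀
  have hk : t < D.mht k := hk₀.trans_le (D.mht_mono (le_max_right _ _))
  refine D.proj_eq_of_le (le_max_left j k₀) ?_
  obtain ⟨q, hq, -⟩ := hprop.1
  obtain ⟨K₀, hK₀⟩ := hq.exists_level hprop k
  set K := max k K₀
  have hK : t < D.mht K := hk.trans_le (D.mht_mono (le_max_left _ _))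
  rcases ((h.2 K).resolve_left hK.not_ge).eq_or_exists (D.isEdgeSystem K) (D.mht_le K) hK
    ((h'.2 K).resolve_left hK.not_ge) with he | ⟨v, w, b, hb0, hb1, hv, hw⟩
  · exact D.proj_eq_of_le (le_max_left _ _) he
  · obtain ⟨u, rfl, hu⟩ := exists_down fst K v
    obtain ⟨u', rfl, hu'⟩ := exists_down fst K w
    rw [D.proj_fst_of_le (le_max_left k K₀) hu hb0 (by linarith) hv,
      D.proj_fst_of_le (le_max_left k K₀) hu' hb0 (by linarith) hw,
      hK₀ u fun i hi => hu i (hi.trans_le (le_max_right _ _)),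
      hK₀ u' fun i hi => hu' i (hi.trans_le (le_max_right _ _))]

theorem Fwd.unique_left {D : SolenoidDatum} (hmin : D.B.StronglyMinimal)
    (hprop : D.B.ProperlyOrdered) {t : ℝ} {z z' y : D.Om} (h : D.Fwd t z y) (h' : D.Fwd t z' y) :
    z = z' := by
  refine Om.ext fun j => ?_
  obtain ⟨k₀, hk₀⟩ := D.exists_lt_mht hmin t
  set k := max j k₀
  have hk : t < D.mht k := hk₀.trans_le (D.mht_mono (le_max_right _ _))
  refine D.proj_eq_of_le (le_max_left j k₀) ?_
  obtain ⟨q, hq, -⟩ := hprop.2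
  obtain ⟨K₀, hK₀⟩ := hq.exists_level hprop k
  set K := max k K₀
  have hK : t < D.mht K := hk.trans_le (D.mht_mono (le_max_left _ _))
  rcases ((h.2 K).resolve_left hK.not_ge).mirror.eq_or_exists (D.isEdgeSystem K).mirror
    (D.mht_le K) hK ((h'.2 K).resolve_left hK.not_ge).mirror with he | ⟨v, w, b, hb0, hb1, hv, hw⟩
  · exact D.proj_eq_of_le (le_max_left _ _) he
  · obtain ⟨u, rfl, hu⟩ := exists_down lst K v
    obtain ⟨u', rfl, hu'⟩ := exists_down lst K w
    rw [D.proj_lst_of_le (le_max_left k K₀) hu hb0 (by linarith) hv,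
      D.proj_lst_of_le (le_max_left k K₀) hu' hb0 (by linarith) hw,
      hK₀ u fun i hi => hu i (hi.trans_le (le_max_right _ _)),
      hK₀ u' fun i hi => hu' i (hi.trans_le (le_max_right _ _))]

/-- `y` is reached from `z` in time `t`. -/
def Fl (t : ℝ) (z y : D.Om) : Prop := D.Fwd t z y ∨ D.Fwd (-t) y z

theorem fwd_zero_iff {z y : D.Om} : D.Fwd 0 z y ↔ z = y := by
  constructor
  · intro h
    exact Om.ext fun k => ((h.2 k).resolve_left (D.mht_pos k).not_ge).eq_of_zero
  · rintro rfl
    exact ⟨le_rfl, fun k => Or.inr (D.edgeRel_refl k _)⟩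

theorem exists_fl (hprop : D.B.ProperlyOrdered) (t : ℝ) (z : D.Om) : ∃ y, D.Fl t z y := by
  rcases le_total 0 t with ht | ht
  · exact (D.exists_fwd_right hprop ht z).imp fun y => Or.inl
  · exact (D.exists_fwd_left hprop (neg_nonneg.2 ht) z).imp fun y => Or.inr

theorem fl_iff_of_nonneg {t : ℝ} (ht : 0 ≤ t) {z y : D.Om} : D.Fl t z y ↔ D.Fwd t z y := by
  refine ⟨fun h => h.elim id fun h => ?_, Or.inl⟩
  obtain rfl : t = 0 := le_antisymm (neg_nonneg.1 h.1) ht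
  rw [neg_zero, fwd_zero_iff] at h
  rw [h, fwd_zero_iff]

theorem fl_neg {t : ℝ} {z y : D.Om} : D.Fl (-t) z y ↔ D.Fl t y z := by
  rw [Fl, Fl, neg_neg, or_comm]

theorem Fl.unique {D : SolenoidDatum} (hmin : D.B.StronglyMinimal)
    (hprop : D.B.ProperlyOrdered) {t : ℝ} {z y y' : D.Om} (h : D.Fl t z y) (h' : D.Fl t z y') :
    y = y' := by
  rcases le_total 0 t with ht | ht
  · rw [fl_iff_of_nonneg D ht] at h h'
    exact h.unique_right hmin hprop h'
  · rw [← neg_neg t, fl_neg, fl_iff_of_nonneg D (neg_nonneg.2 ht)] at h h'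
    exact h.unique_left hmin hprop h'

/-- For times of opposite sign, a motion of duration `|s + t|` ending or starting at a corner is
supplied by existence, and its other end is identified by one-sided composition and uniqueness. -/
theorem Fl.trans {D : SolenoidDatum} (hmin : D.B.StronglyMinimal)
    (hprop : D.B.ProperlyOrdered) {s t : ℝ} {z y x : D.Om} (h1 : D.Fl s z y) (h2 : D.Fl t y x) :
    D.Fl (s + t) z x := by
  rcases h1 with h1 | h1 <;> rcases h2 with h2 | h2
  · exact Or.inl (h1.trans h2)
  · rcases le_total 0 (s + t) with hst | hst
    · obtain ⟨q, hq⟩ := D.exists_fwd_left hprop hst x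
      have := hq.trans h2
      rw [add_neg_cancel_right] at this
      rw [h1.unique_left hmin hprop this]
      exact Or.inl hq
    · obtain ⟨q, hq⟩ := D.exists_fwd_right hprop (neg_nonneg.2 hst) x
      have := hq
      right
      obtain ⟨r, hr⟩ := D.exists_fwd_left hprop (neg_nonneg.2 hst) z
      have := hr.trans h1
      rw [show -(s + t) + s = -t by ring] at this
      rw [h2.unique_left hmin hprop this]
      exact hr
  · rcases le_total 0 (s + t) with hst | hst
    · obtain ⟨q, hq⟩ := D.exists_fwd_right hprop hst z
      have := h1.trans hq
      rw [show -s + (s + t) = t by ring] at this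
      rw [h2.unique_right hmin hprop this]
      exact Or.inl hq
    · obtain ⟨q, hq⟩ := D.exists_fwd_right hprop (neg_nonneg.2 hst) x
      have := h2.trans hq
      rw [show t + -(s + t) = -s by ring] at this
      rw [h1.unique_right hmin hprop this]
      exact Or.inr hq
  · right
    rw [show -(s + t) = -t + -s by ring]
    exact h2.trans h1

theorem isClosed_fl : IsClosed {p : ℝ × D.Om × D.Om | D.Fl p.1 p.2.1 p.2.2} :=
  D.isClosed_fwd.union (s₁ := {p : ℝ × D.Om × D.Om | D.Fwd p.1 p.2.1 p.2.2}) <|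
    D.isClosed_fwd.preimage (f := fun p : ℝ × D.Om × D.Om => (-p.1, p.2.2, p.2.1)) (by fun_prop)

theorem Fl.edgeRel {D : SolenoidDatum} {t : ℝ} {z y : D.Om} (h : D.Fl t z y) (h0 : 0 ≤ t) {k : ℕ}
    (hk : t < D.mht k) : EdgeRel (D.pnt k) (D.ht k) t (D.proj k z) (D.proj k y) :=
  (((D.fl_iff_of_nonneg h0).1 h).2 k).resolve_left hk.not_ge

end SolenoidDatum

/-! ### Orbits and flow lines. -/

namespace SolenoidDatum

variable {D : SolenoidDatum}

/-- `c` is an orbit of the flow, parametrized by time. -/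
def IsOrbit (c : ℝ → D.Om) : Prop := ∀ s t, D.Fl t (c s) (c (s + t))

theorem IsOrbit.proj_of_lt {c : ℝ → D.Om} (hc : IsOrbit c) {k : ℕ} {s₀ s x : ℝ} {v : D.B.V k}
    (h : D.proj k (c s₀) = D.pnt k v x) (hx0 : 0 < x) (hx1 : x < D.ht k v)
    (hs0 : 0 ≤ x + s) (hs1 : x + s ≤ D.ht k v) (hs : |s| < D.mht k) :
    D.proj k (c (s₀ + s)) = D.pnt k v (x + s) := by
  rw [abs_lt] at hs
  rcases le_total 0 s with h0 | h0
  · have he := (hc s₀ s).edgeRel h0 hs.2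
    rw [h] at he
    exact he.eq_of_interior (D.isEdgeSystem k) hx0 hx1 hs1
  · have hfl := hc (s₀ + s) (-s)
    rw [add_neg_cancel_right] at hfl
    have he := (hfl.edgeRel (neg_nonneg.2 h0) (by linarith)).mirror
    rw [h, show x = D.ht k v - (D.ht k v - x) by ring] at he
    rw [he.eq_of_interior (D.isEdgeSystem k).mirror (by linarith) (by linarith) (by linarith)]
    ring_nf

theorem IsOrbit.proj_of_interior {c : ℝ → D.Om} (hc : IsOrbit c) {k : ℕ} {s₀ s x : ℝ} {v : D.B.V k}
    (h : D.proj k (c s₀) = D.pnt k v x) (hx0 : 0 < x) (hx1 : x < D.ht k v)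
    (hs0 : 0 ≤ x + s) (hs1 : x + s ≤ D.ht k v) :
    D.proj k (c (s₀ + s)) = D.pnt k v (x + s) := by
  -- The time is cut into `N` steps shorter than the shortest edge. Before the last step the
  -- position is strictly inside the edge, so `IsOrbit.proj_of_lt` applies each time.
  obtain ⟨N, hN⟩ := exists_nat_gt (|s| / D.mht k)
  have hN0 : (0 : ℝ) < N := lt_of_le_of_lt (div_nonneg (abs_nonneg s) (D.mht_pos k).le) hN
  have key : ∀ j : ℕ, j ≤ N → D.proj k (c (s₀ + j / N * s)) = D.pnt k v (x + j / N * s) := by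
    intro j
    induction j with
    | zero => intro _; simpa using h
    | succ j ih =>
      intro hj
      have hjN : (j : ℝ) / N < 1 := by
        rw [div_lt_one hN0]; exact_mod_cast hj
      have hj0 : 0 ≤ (j : ℝ) / N := by positivity
      have hjN' : ((j + 1 : ℕ) : ℝ) / N ≤ 1 := by
        rw [div_le_one hN0]; exact_mod_cast hj
      have hj0' : 0 ≤ ((j + 1 : ℕ) : ℝ) / N := by positivity
      have e : ((j + 1 : ℕ) : ℝ) / N * s = j / N * s + s / N := by
        push_cast; field_simp
      rw [e, ← add_assoc, ← add_assoc]
      refine hc.proj_of_lt (ih (by omega)) ?_ ?_ ?_ ?_ ?_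
      · nlinarith
      · nlinarith
      · rw [add_assoc, ← e]; nlinarith
      · rw [add_assoc, ← e]; nlinarith
      · rw [abs_div, Nat.abs_cast, div_lt_iff₀ hN0]
        rwa [div_lt_iff₀ (D.mht_pos k), mul_comm] at hN
  simpa [div_self hN0.ne'] using key N le_rfl

theorem IsOrbit.exists_start {c : ℝ → D.Om} (hc : IsOrbit c) (k : ℕ) (s₀ : ℝ) :
    ∃ v a, 0 ≤ a ∧ a < D.ht k v ∧ D.proj k (c s₀) = D.pnt k v a ∧
      ∀ s, 0 ≤ s → s ≤ D.ht k v - a → D.proj k (c (s₀ + s)) = D.pnt k v (a + s) := by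
  obtain ⟨v, a, ha0, ha1, h⟩ := D.exists_pnt (D.proj k (c s₀))
  by_cases ha : a = 0 ∨ a = D.ht k v
  -- At a vertex, the outgoing edge taken by the orbit is read off from its position after time `mht
  -- k / 2`.
  · have hm := D.mht_pos k
    have he := (hc s₀ (D.mht k / 2)).edgeRel (k := k) (by linarith) (by linarith)
    rw [h] at he
    obtain ⟨w, hw0, hw⟩ := he.exists_of_end (D.isEdgeSystem k) (D.mht_le k) (by linarith)
      (by linarith) ha
    have hw1 := D.mht_le k w
    refine ⟨w, 0, le_rfl, D.ht_pos k w, h.trans hw0, fun s hs0 hs1 => ?_⟩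
    have := hc.proj_of_interior (s := s - D.mht k / 2) hw (by linarith) (by linarith)
      (by linarith) (by linarith)
    rw [add_assoc, add_sub_cancel] at this
    rw [this, zero_add]
  · rw [not_or] at ha
    have ha0' := lt_of_le_of_ne ha0 (Ne.symm ha.1)
    have ha1' := lt_of_le_of_ne ha1 ha.2
    exact ⟨v, a, ha0, ha1', h, fun s hs0 hs1 =>
      hc.proj_of_interior h ha0' ha1' (by linarith) (by linarith)⟩

theorem IsOrbit.exists_end {c : ℝ → D.Om} (hc : IsOrbit c) (k : ℕ) (s₀ : ℝ) :
    ∃ v a, 0 < a ∧ a ≤ D.ht k v ∧ D.proj k (c s₀) = D.pnt k v a ∧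
      ∀ s, 0 ≤ s → s ≤ a → D.proj k (c (s₀ - s)) = D.pnt k v (a - s) := by
  obtain ⟨v, a, ha0, ha1, h⟩ := D.exists_pnt (D.proj k (c s₀))
  by_cases ha : a = 0 ∨ a = D.ht k v
  · have hm := D.mht_pos k
    have hfl := hc (s₀ - D.mht k / 2) (D.mht k / 2)
    rw [sub_add_cancel] at hfl
    have he := (hfl.edgeRel (k := k) (by linarith) (by linarith)).mirror
    rw [h, show a = D.ht k v - (D.ht k v - a) by ring] at he
    obtain ⟨w, hw0, hw⟩ := he.exists_of_end (D.isEdgeSystem k).mirror (D.mht_le k) (by linarith)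
      (by linarith) (by rcases ha with rfl | rfl <;> simp)
    simp only [sub_sub_cancel, sub_zero] at hw0 hw
    have hw1 := D.mht_le k w
    refine ⟨w, D.ht k w, D.ht_pos k w, le_rfl, h.trans hw0, fun s hs0 hs1 => ?_⟩
    have := hc.proj_of_interior (s := D.mht k / 2 - s) hw (by linarith) (by linarith)
      (by linarith) (by linarith)
    rw [sub_add_sub_cancel, sub_add_sub_cancel] at this
    exact this
  · rw [not_or] at ha
    have ha0' := lt_of_le_of_ne ha0 (Ne.symm ha.1)
    have ha1' := lt_of_le_of_ne ha1 ha.2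
    exact ⟨v, a, ha0', ha1, h, fun s hs0 hs1 =>
      hc.proj_of_interior h ha0' ha1' (by linarith) (by linarith)⟩

theorem IsOrbit.isFlowLine {c : ℝ → D.Om} (hc : IsOrbit c) : D.IsFlowLine c := by
  intro k t
  obtain ⟨v, a, ha0, ha1, -, h⟩ := hc.exists_start k t
  obtain ⟨w, b, hb0, hb1, -, h'⟩ := hc.exists_end k t
  have hl := D.lam_pow_pos k
  have hd : 0 < min (D.ht k v - a) b := lt_min (sub_pos.2 ha1) hb0
  have hd1 := min_le_left (D.ht k v - a) b
  have hd2 := min_le_right (D.ht k v - a) b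
  refine ⟨min (D.ht k v - a) b, hd, ⟨v, a / D.lam ^ k, div_nonneg ha0 hl.le, ?_, fun s hs => ?_⟩,
    w, b / D.lam ^ k, ?_, ?_, fun s hs => ?_⟩
  · rw [← add_div, len_eq]
    exact div_le_div_of_nonneg_right (by linarith) hl.le
  · rw [h s hs.1 (hs.2.trans hd1), pnt, add_div]
  · rw [len_eq]
    exact div_le_div_of_nonneg_right hb1 hl.le
  · rw [← sub_div]
    exact div_nonneg (by linarith) hl.le
  · rw [h' s hs.1 (hs.2.trans hd2), pnt, sub_div]

theorem IsFlowLine.exists_pnt {c : ℝ → D.Om} (hc : D.IsFlowLine c) (k : ℕ) (t : ℝ) :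
    ∃ d, 0 < d ∧ (∃ v a, 0 ≤ a ∧ a + d ≤ D.ht k v ∧ ∀ s ∈ Icc 0 d,
      D.proj k (c (t + s)) = D.pnt k v (a + s)) ∧ ∃ v a, a ≤ D.ht k v ∧ 0 ≤ a - d ∧
      ∀ s ∈ Icc 0 d, D.proj k (c (t - s)) = D.pnt k v (a - s) := by
  have hl := D.lam_pow_pos k
  obtain ⟨d, hd, ⟨v, x, h1, h2, h3⟩, w, y, h4, h5, h6⟩ := hc k t
  refine ⟨d, hd, ⟨v, D.lam ^ k * x, mul_nonneg hl.le h1, ?_, fun s hs => ?_⟩,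
    w, D.lam ^ k * y, ?_, ?_, fun s hs => ?_⟩
  · rw [len_eq, ← sub_nonneg] at h2
    have := mul_nonneg hl.le h2
    field_simp at this
    linarith
  · rw [h3 s hs, pnt]
    congr 1
    field_simp
  · rw [len_eq, ← sub_nonneg] at h4
    have := mul_nonneg hl.le h4
    field_simp at this
    linarith
  · have := mul_nonneg hl.le h5
    field_simp at this
    linarith
  · rw [h6 s hs, pnt]
    congr 1
    field_simp

theorem IsFlowLine.continuous_proj {c : ℝ → D.Om} (hc : D.IsFlowLine c) (k : ℕ) :
    Continuous fun t => D.proj k (c t) := by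
  refine continuous_iff_continuousAt.2 fun t => continuousAt_iff_continuous_left_right.2 ?_
  obtain ⟨d, hd, ⟨v, a, -, -, h⟩, w, b, -, -, h'⟩ := hc.exists_pnt k t
  constructor
  · have h1 : ∀ r ∈ Icc (t - d) t, D.proj k (c r) = D.pnt k w (b - (t - r)) := fun r hr => by
      rw [← h' (t - r) ⟨by linarith [hr.2], by linarith [hr.1]⟩, sub_sub_cancel]
    have h2 : ContinuousWithinAt (fun t => D.proj k (c t)) (Icc (t - d) t) t :=
      ((D.continuous_pnt k w).comp (by fun_prop : Continuous fun r => b - (t - r))).continuousWithinAt.congr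
        h1 (h1 t ⟨by linarith, le_rfl⟩)
    exact h2.mono_of_mem_nhdsWithin (Icc_mem_nhdsLE (by linarith))
  · have h1 : ∀ r ∈ Icc t (t + d), D.proj k (c r) = D.pnt k v (a + (r - t)) := fun r hr => by
      rw [← h (r - t) ⟨by linarith [hr.1], by linarith [hr.2]⟩, add_sub_cancel]
    have h2 : ContinuousWithinAt (fun t => D.proj k (c t)) (Icc t (t + d)) t :=
      ((D.continuous_pnt k v).comp (by fun_prop : Continuous fun r => a + (r - t))).continuousWithinAt.congr
        h1 (h1 t ⟨le_rfl, by linarith⟩)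
    exact h2.mono_of_mem_nhdsWithin (Icc_mem_nhdsGE (by linarith))

/-- Continuous induction: the times at which the relation holds form a closed set containing `0`,
and the local description of a flow line extends this set to the right. -/
theorem IsFlowLine.fwd {c : ℝ → D.Om} (hc : D.IsFlowLine c) (t : ℝ) {s : ℝ} (hs : 0 ≤ s) :
    D.Fwd s (c t) (c (t + s)) := by
  refine ⟨hs, fun k => ?_⟩
  by_cases hk : D.mht k ≤ s
  · exact Or.inl hk
  right
  rw [not_le] at hk
  let S : Set ℝ := {r | EdgeRel (D.pnt k) (D.ht k) r (D.proj k (c t)) (D.proj k (c (t + r)))}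
  have hS : IsClosed S := (D.isClosed_edgeRel k).preimage (continuous_id.prodMk
    (continuous_const.prodMk ((hc.continuous_proj k).comp (continuous_const_add t))))
  have h0 : (0 : ℝ) ∈ S := by
    change EdgeRel _ _ _ _ _
    rw [add_zero]
    exact D.edgeRel_refl k _
  refine (hS.inter isClosed_Icc).Icc_subset_of_forall_mem_nhdsWithin h0 ?_ ⟨hs, le_rfl⟩
  rintro x ⟨hx, hx0, hxs⟩
  obtain ⟨d, hd, ⟨v, a, ha0, ha1, h⟩, -⟩ := hc.exists_pnt k (t + x)
  have hmem : Ioo x (min (x + d) s) ∈ 𝓝[>] x :=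
    Ioo_mem_nhdsGT (lt_min (by linarith) hxs)
  refine mem_of_superset hmem fun r hr => ?_
  have hr1 := hr.2.trans_le (min_le_left _ _)
  have hr2 := hr.2.trans_le (min_le_right _ _)
  have hr0 := hr.1
  have h1 := h (r - x) ⟨by linarith, by linarith⟩
  have h2 := h 0 ⟨le_rfl, hd.le⟩
  rw [add_zero, add_zero] at h2
  rw [show t + x + (r - x) = t + r by ring] at h1
  have he : EdgeRel (D.pnt k) (D.ht k) (r - x) (D.proj k (c (t + x))) (D.proj k (c (t + r))) :=
    Or.inl ⟨v, a, a + (r - x), ha0, by linarith, by linarith, by ring, h2, h1⟩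
  have := D.edgeRel_trans (by linarith) hx he
  rwa [add_sub_cancel] at this

/-! ### The flow: group law and continuity. -/

section Flow

variable (hmin : D.B.StronglyMinimal) (hprop : D.B.ProperlyOrdered)

include hmin hprop

/-- Orbits of `Fl` supply a flow line, so the default branch of `flow` does not occur; whichever
flow line is chosen satisfies `Fl` by `IsFlowLine.fwd`. -/
theorem fl_flow (t : ℝ) (z : D.Om) : D.Fl t z (D.flow t z) := by
  choose ψ hψ using D.exists_fl hprop
  have hex : ∃ c : ℝ → D.Om, D.IsFlowLine c ∧ c 0 = z := by
    refine ⟨fun t => ψ t z, IsOrbit.isFlowLine fun s t => ?_, ?_⟩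
    · have := (D.fl_neg.2 (hψ s z)).trans hmin hprop (hψ (s + t) z)
      rwa [neg_add_cancel_left] at this
    · exact ((D.fwd_zero_iff).1 ((D.fl_iff_of_nonneg le_rfl).1 (hψ 0 z))).symm
  rw [flow, dif_pos hex]
  obtain ⟨h1, h2⟩ := hex.choose_spec
  rcases le_total 0 t with ht | ht
  · have := h1.fwd 0 ht
    rw [h2, zero_add] at this
    exact Or.inl this
  · have := h1.fwd t (neg_nonneg.2 ht)
    rw [add_neg_cancel, h2] at this
    exact Or.inr this

theorem flow_eq_of_fl {t : ℝ} {z y : D.Om} (h : D.Fl t z y) : D.flow t z = y :=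
  (fl_flow hmin hprop t z).unique hmin hprop h

theorem flow_zero (z : D.Om) : D.flow 0 z = z :=
  flow_eq_of_fl hmin hprop (Or.inl (D.fwd_zero_iff.2 rfl))

theorem flow_add (s t : ℝ) (z : D.Om) : D.flow (s + t) z = D.flow t (D.flow s z) :=
  flow_eq_of_fl hmin hprop
    ((fl_flow hmin hprop s z).trans hmin hprop (fl_flow hmin hprop t _))

theorem flow_neg_flow (t : ℝ) (z : D.Om) : D.flow (-t) (D.flow t z) = z := by
  rw [← flow_add hmin hprop, add_neg_cancel, flow_zero hmin hprop]

theorem flow_flow_neg (t : ℝ) (z : D.Om) : D.flow t (D.flow (-t) z) = z := by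
  rw [← flow_add hmin hprop, neg_add_cancel, flow_zero hmin hprop]

/-- The graph is closed and `Ω` is compact, so the preimage of a closed set is the projection of a
closed set along a compact factor. -/
theorem continuous_flow : Continuous fun p : ℝ × D.Om => D.flow p.1 p.2 := by
  refine continuous_iff_isClosed.2 fun C hC => ?_
  have h1 : IsClosed {p : (ℝ × D.Om) × D.Om | D.Fl p.1.1 p.1.2 p.2 ∧ p.2 ∈ C} :=
    (D.isClosed_fl.preimage (f := fun p : (ℝ × D.Om) × D.Om => (p.1.1, p.1.2, p.2))
      (by fun_prop)).inter (hC.preimage continuous_snd)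
  have h2 := isClosedMap_fst_of_compactSpace _ h1
  convert h2 using 1
  ext p
  constructor
  · intro hp
    exact ⟨(p, D.flow p.1 p.2), ⟨fl_flow hmin hprop _ _, hp⟩, rfl⟩
  · rintro ⟨⟨q, y⟩, ⟨h3, h4⟩, rfl⟩
    change D.flow q.1 q.2 ∈ C
    rw [flow_eq_of_fl hmin hprop h3]
    exact h4

theorem continuous_flow_right (t : ℝ) : Continuous (D.flow t) :=
  (continuous_flow hmin hprop).comp (Continuous.prodMk_right t)

theorem isOrbit_flow (z : D.Om) : IsOrbit fun t => D.flow t z := fun s t => by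
  beta_reduce
  rw [flow_add hmin hprop]
  exact fl_flow hmin hprop t _

theorem proj_flow_of_interior {k : ℕ} {z : D.Om} {s x : ℝ} {v : D.B.V k}
    (h : D.proj k z = D.pnt k v x) (hx0 : 0 < x) (hx1 : x < D.ht k v)
    (hs0 : 0 ≤ x + s) (hs1 : x + s ≤ D.ht k v) :
    D.proj k (D.flow s z) = D.pnt k v (x + s) := by
  have := (isOrbit_flow hmin hprop z).proj_of_interior (s₀ := 0) (s := s)
    (by rwa [flow_zero hmin hprop]) hx0 hx1 hs0 hs1
  rwa [zero_add] at this

theorem exists_start (k : ℕ) (z : D.Om) :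
    ∃ v a, 0 ≤ a ∧ a < D.ht k v ∧ D.proj k z = D.pnt k v a ∧
      ∀ s, 0 ≤ s → s ≤ D.ht k v - a → D.proj k (D.flow s z) = D.pnt k v (a + s) := by
  have := (isOrbit_flow hmin hprop z).exists_start k 0
  simpa only [zero_add, flow_zero hmin hprop] using this

theorem exists_end (k : ℕ) (z : D.Om) :
    ∃ v a, 0 < a ∧ a ≤ D.ht k v ∧ D.proj k z = D.pnt k v a ∧
      ∀ s, 0 ≤ s → s ≤ a → D.proj k (D.flow (-s) z) = D.pnt k v (a - s) := by
  have := (isOrbit_flow hmin hprop z).exists_end k 0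
  simpa only [zero_sub, flow_zero hmin hprop] using this

theorem proj_flow_ne {k : ℕ} {z : D.Om} {s : ℝ} (h0 : 0 < s) (h1 : s < D.mht k) :
    D.proj k (D.flow s z) ≠ D.proj k z := by
  intro h
  have he := (fl_flow hmin hprop s z).edgeRel h0.le h1
  rw [h] at he
  exact EdgeRel.ne (D.isEdgeSystem k) (D.mht_le k) h0 h1 he

end Flow

end SolenoidDatum

/-! ### Flow boxes and induced transverse measures. -/

namespace SolenoidDatum

variable {D : SolenoidDatum}

/-- The points which leave `C` at some time in `[0, t)`. -/
def box (C : Set D.Om) (t : ℝ) : Set D.Om := {z | ∃ s, 0 ≤ s ∧ s < t ∧ D.flow (-s) z ∈ C}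

/-- No point of `C` returns to `C` before time `T`. -/
def NoReturn (C : Set D.Om) (T : ℝ) : Prop := ∀ y ∈ C, ∀ s, 0 < s → s < T → D.flow s y ∉ C

open Classical in
/-- The time since the last visit of `C`. -/
noncomputable def sinceVisit (C : Set D.Om) (T : ℝ) (z : D.Om) : ℝ :=
  if h : z ∈ box C T then h.choose else 0

/-- The last point of `C` on the orbit. -/
noncomputable def lastVisit (C : Set D.Om) (T : ℝ) (z : D.Om) : D.Om :=
  D.flow (-sinceVisit C T z) z

/-- The measure induced on the transversal `C`. -/
noncomputable def sectionMeasure (μ : Measure D.Om) (C : Set D.Om) (T : ℝ) : Measure D.Om :=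
  (ENNReal.ofReal T)⁻¹ • (μ.restrict (box C T)).map (lastVisit C T)

theorem sinceVisit_spec {C : Set D.Om} {T : ℝ} {z : D.Om} (hz : z ∈ box C T) :
    0 ≤ sinceVisit C T z ∧ sinceVisit C T z < T ∧ lastVisit C T z ∈ C := by
  rw [lastVisit, sinceVisit, dif_pos hz]
  exact hz.choose_spec

theorem NoReturn.mono {C C' : Set D.Om} {T T' : ℝ} (h : NoReturn C T) (hC : C' ⊆ C) (hT : T' ≤ T) :
    NoReturn C' T' := fun y hy s h0 h1 hs => h y (hC hy) s h0 (h1.trans_le hT) (hC hs)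

theorem box_mono {C : Set D.Om} {s t : ℝ} (h : s ≤ t) : box C s ⊆ box C t :=
  fun _ ⟨r, h0, h1, h2⟩ => ⟨r, h0, h1.trans_le h, h2⟩

section Box

variable (hmin : D.B.StronglyMinimal) (hprop : D.B.ProperlyOrdered)

include hmin hprop

theorem image_eq_box (C : Set D.Om) (t : ℝ) :
    (fun p : ℝ × D.Om => D.flow p.1 p.2) '' (Ico 0 t ×ˢ C) = box C t := by
  ext z
  constructor
  · rintro ⟨⟨s, y⟩, ⟨⟨h0, h1⟩, h2⟩, rfl⟩
    exact ⟨s, h0, h1, by simpa only [flow_neg_flow hmin hprop] using h2⟩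
  · rintro ⟨s, h0, h1, h2⟩
    exact ⟨(s, D.flow (-s) z), ⟨⟨h0, h1⟩, h2⟩, flow_flow_neg hmin hprop s z⟩

theorem measurable_flow : Measurable fun p : ℝ × D.Om => D.flow p.1 p.2 :=
  (continuous_flow hmin hprop).measurable

theorem measurable_flow_right (t : ℝ) : Measurable (D.flow t) :=
  (continuous_flow_right hmin hprop t).measurable

theorem NoReturn.sinceVisit_eq {C : Set D.Om} {T s : ℝ} (hN : NoReturn C T) {z : D.Om}
    (h0 : 0 ≤ s) (h1 : s < T) (h2 : D.flow (-s) z ∈ C) : sinceVisit C T z = s := by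
  have key : ∀ s s', 0 ≤ s → s' < T → D.flow (-s) z ∈ C → D.flow (-s') z ∈ C → ¬ s < s' := by
    intro s s' h0 h1 h2 h3 h4
    refine hN _ h3 (s' - s) (by linarith) (by linarith) ?_
    rw [← flow_add hmin hprop, show -s' + (s' - s) = -s by ring]
    exact h2
  obtain ⟨k0, k1, k2⟩ := sinceVisit_spec (show z ∈ box C T from ⟨s, h0, h1, h2⟩)
  rw [lastVisit] at k2
  exact le_antisymm (not_lt.1 (key _ _ h0 k1 h2 k2)) (not_lt.1 (key _ _ k0 h1 k2 h2))

theorem NoReturn.lastVisit_flow {C : Set D.Om} {T s : ℝ} (hN : NoReturn C T) {y : D.Om}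
    (h0 : 0 ≤ s) (h1 : s < T) (hy : y ∈ C) : lastVisit C T (D.flow s y) = y := by
  rw [lastVisit, hN.sinceVisit_eq hmin hprop h0 h1 (by rwa [flow_neg_flow hmin hprop]),
    flow_neg_flow hmin hprop]

theorem isClosed_visit {C : Set D.Om} (hC : IsClosed C) (a : ℝ) :
    IsClosed {z | ∃ s, 0 ≤ s ∧ s ≤ a ∧ D.flow (-s) z ∈ C} := by
  have h1 : IsClosed {p : D.Om × Icc (0 : ℝ) a | D.flow (-p.2.1) p.1 ∈ C} :=
    hC.preimage ((continuous_flow hmin hprop).comp (f := fun p : D.Om × Icc (0 : ℝ) a =>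
      (-p.2.1, p.1)) (by fun_prop))
  convert isClosedMap_fst_of_compactSpace _ h1 using 1
  ext z
  constructor
  · rintro ⟨s, h0, h1, h2⟩
    exact ⟨(z, ⟨s, h0, h1⟩), h2, rfl⟩
  · rintro ⟨⟨z, s⟩, h, rfl⟩
    exact ⟨s.1, s.2.1, s.2.2, h⟩

theorem measurableSet_box {C : Set D.Om} (hC : IsClosed C) (t : ℝ) : MeasurableSet (box C t) := by
  have : box C t = ⋃ n : ℕ, {z | ∃ s, 0 ≤ s ∧ s ≤ t - 1 / (n + 1) ∧ D.flow (-s) z ∈ C} := by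
    ext z
    simp only [mem_iUnion]
    constructor
    · rintro ⟨s, h0, h1, h2⟩
      obtain ⟨n, hn⟩ := exists_nat_one_div_lt (sub_pos.2 h1)
      exact ⟨n, s, h0, by linarith, h2⟩
    · rintro ⟨n, s, h0, h1, h2⟩
      have : (0 : ℝ) < 1 / (n + 1) := by positivity
      exact ⟨s, h0, by linarith, h2⟩
  rw [this]
  exact MeasurableSet.iUnion fun n => (isClosed_visit hmin hprop hC _).measurableSet

theorem NoReturn.measurable_sinceVisit {C : Set D.Om} (hC : IsClosed C) {T : ℝ}
    (hN : NoReturn C T) : Measurable (sinceVisit C T) := by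
  refine measurable_of_Iic fun a => ?_
  -- The values lie in `[0, T)`, with the value `0` outside the box, so only `0 ≤ a < T` gives a
  -- nontrivial sublevel set.
  by_cases ha0 : a < 0
  · convert MeasurableSet.empty
    refine eq_empty_of_forall_notMem fun z hz => ?_
    have hz : sinceVisit C T z ≤ a := hz
    by_cases hzb : z ∈ box C T
    · linarith [(sinceVisit_spec hzb).1]
    · rw [sinceVisit, dif_neg hzb] at hz
      linarith
  · rw [not_lt] at ha0
    by_cases haT : a < T
    · have : sinceVisit C T ⁻¹' Iic a =
          {z | ∃ s, 0 ≤ s ∧ s ≤ a ∧ D.flow (-s) z ∈ C} ∪ (box C T)ᶜ := by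
        ext z
        constructor
        · intro hz
          have hz : sinceVisit C T z ≤ a := hz
          by_cases hzb : z ∈ box C T
          · obtain ⟨h1, h2, h3⟩ := sinceVisit_spec hzb
            exact Or.inl ⟨_, h1, hz, h3⟩
          · exact Or.inr hzb
        · rintro (⟨s, h0, h1, h2⟩ | hz)
          · change _ ≤ a
            rwa [hN.sinceVisit_eq hmin hprop h0 (h1.trans_lt haT) h2]
          · change _ ≤ a
            rwa [sinceVisit, dif_neg hz]
      rw [this]
      exact (isClosed_visit hmin hprop hC a).measurableSet.union
        (measurableSet_box hmin hprop hC T).compl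
    · convert MeasurableSet.univ
      refine eq_univ_of_forall fun z => ?_
      change _ ≤ a
      by_cases hzb : z ∈ box C T
      · linarith [(sinceVisit_spec hzb).2.1]
      · rwa [sinceVisit, dif_neg hzb]

theorem NoReturn.measurable_lastVisit {C : Set D.Om} (hC : IsClosed C) {T : ℝ}
    (hN : NoReturn C T) : Measurable (lastVisit C T) :=
  (measurable_flow hmin hprop).comp
    ((hN.measurable_sinceVisit hmin hprop hC).neg.prodMk measurable_id)

variable {μ : Measure D.Om} [IsProbabilityMeasure μ]

omit hmin hprop in
theorem isFiniteMeasure_sectionMeasure (C : Set D.Om) {T : ℝ} (hT : 0 < T) :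
    IsFiniteMeasure (sectionMeasure μ C T) :=
  Measure.smul_finite _ (ENNReal.inv_ne_top.2 (by simpa using hT))

omit [IsProbabilityMeasure μ] in
theorem sectionMeasure_compl {C : Set D.Om} (hC : IsClosed C) {T : ℝ} (hN : NoReturn C T) :
    sectionMeasure μ C T Cᶜ = 0 := by
  rw [sectionMeasure, Measure.smul_apply,
    Measure.map_apply (hN.measurable_lastVisit hmin hprop hC) hC.measurableSet.compl,
    Measure.restrict_apply (hN.measurable_lastVisit hmin hprop hC hC.measurableSet.compl)]
  have : lastVisit C T ⁻¹' Cᶜ ∩ box C T = ∅ :=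
    eq_empty_of_forall_notMem fun z hz => hz.1 (sinceVisit_spec hz.2).2.2
  rw [this, measure_empty, smul_zero]

variable (hμ : ∀ t : ℝ, μ.map (D.flow t) = μ)

include hμ

/-- On a flow box, an invariant measure is the product of Lebesgue measure and the measure induced
on the transversal. -/
theorem NoReturn.restrict_box {C : Set D.Om} (hC : IsClosed C) {T t : ℝ} (hT : 0 < T)
    (hN : NoReturn C T) (ht : t ≤ T) : μ.restrict (box C t) =
      ((volume.restrict (Ico (0 : ℝ) t)).prod (sectionMeasure μ C T)).map
        (fun p : ℝ × D.Om => D.flow p.1 p.2) := by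
  have := isFiniteMeasure_sectionMeasure (μ := μ) C hT
  have hfl := measurable_flow hmin hprop
  have hsv := hN.measurable_sinceVisit hmin hprop hC
  have hlv := hN.measurable_lastVisit hmin hprop hC
  have hW := measurableSet_box hmin hprop hC T
  have hWt := measurableSet_box hmin hprop hC t
  refine Measure.ext_of_lintegral _ fun F hF => ?_
  have hFf : Measurable fun p : ℝ × D.Om => F (D.flow p.1 p.2) := hF.comp hfl
  -- With `u` the time relative to `z` instead of relative to its last visit, `F` is evaluated at
  -- `φ_u z`, which no longer involves the last visit except through the indicator.
  let G : ℝ → D.Om → ℝ≥0∞ := fun u z =>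
    (Ico 0 t).indicator (fun _ => F (D.flow u z)) (u + sinceVisit C T z)
  have hset : MeasurableSet {p : ℝ × D.Om | p.1 + sinceVisit C T p.2 ∈ Ico 0 t} :=
    (measurable_fst.add (hsv.comp measurable_snd)) measurableSet_Ico
  have hG : Measurable (Function.uncurry G) := by
    have : Function.uncurry G = {p : ℝ × D.Om | p.1 + sinceVisit C T p.2 ∈ Ico 0 t}.indicator
        fun p => F (D.flow p.1 p.2) := by
      ext ⟨u, z⟩
      simp only [Function.uncurry, G, indicator, mem_ofPred_eq]
    rw [this]
    exact hFf.indicator hset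
  have step1 : ∀ s, ∫⁻ y, F (D.flow s y) ∂(sectionMeasure μ C T) =
      (ENNReal.ofReal T)⁻¹ * ∫⁻ z in box C T, F (D.flow s (lastVisit C T z)) ∂μ := by
    intro s
    have hFs : Measurable fun y => F (D.flow s y) := hFf.comp measurable_prodMk_left
    rw [sectionMeasure, lintegral_smul_measure, lintegral_map hFs hlv, smul_eq_mul]
  have step2 : ∀ z, ∫⁻ s in Ico 0 t, F (D.flow s (lastVisit C T z)) = ∫⁻ u, G u z := by
    intro z
    rw [← lintegral_indicator measurableSet_Ico, ← lintegral_add_right_eq_self _ (sinceVisit C T z)]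
    refine lintegral_congr fun u => ?_
    simp only [G, indicator]
    rw [lastVisit, ← flow_add hmin hprop, show -sinceVisit C T z + (u + sinceVisit C T z) = u by ring]
  have step3 : ∀ u, ∫⁻ z in box C T, G u z ∂μ = ∫⁻ z, (box C t).indicator F z *
      (Ico 0 T).indicator 1 (sinceVisit C T z - u) ∂μ := by
    intro u
    have hGu : Measurable (G u) := hG.comp measurable_prodMk_left
    rw [← lintegral_indicator hW]
    -- For fixed `u`, invariance under `φ_{-u}` moves the evaluation point of `F` back to `z`; what
    -- remains of `u` is an indicator of an interval of length `T`.
    have e : ∫⁻ z, (box C T).indicator (G u) z ∂μ =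
        ∫⁻ z, (box C T).indicator (G u) (D.flow (-u) z) ∂μ := by
      conv_lhs => rw [← hμ (-u)]
      exact lintegral_map (hGu.indicator hW) (measurable_flow_right hmin hprop _)
    rw [e]
    refine lintegral_congr fun z => ?_
    by_cases hz : z ∈ box C t ∧ sinceVisit C T z - u ∈ Ico 0 T
    · obtain ⟨h0, h1, h2⟩ := sinceVisit_spec (box_mono ht hz.1)
      obtain ⟨s, k0, k1, k2⟩ := hz.1
      have hs := hN.sinceVisit_eq hmin hprop k0 (k1.trans_le ht) k2
      have h3 : D.flow (-(sinceVisit C T z - u)) (D.flow (-u) z) ∈ C := by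
        rw [← flow_add hmin hprop, show -u + -(sinceVisit C T z - u) = -sinceVisit C T z by ring]
        exact h2
      have h4 := hN.sinceVisit_eq hmin hprop hz.2.1 hz.2.2 h3
      rw [indicator_of_mem (show D.flow (-u) z ∈ box C T from ⟨_, hz.2.1, hz.2.2, h3⟩),
        indicator_of_mem hz.1, indicator_of_mem hz.2]
      simp only [G, h4]
      rw [indicator_of_mem (by rw [add_sub_cancel, hs]; exact ⟨k0, k1⟩),
        flow_flow_neg hmin hprop, Pi.one_apply, mul_one]
    · have hr : (box C t).indicator F z * (Ico 0 T).indicator 1 (sinceVisit C T z - u) = 0 := by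
        rw [not_and_or] at hz
        rcases hz with hz | hz
        · rw [indicator_of_notMem hz, zero_mul]
        · rw [indicator_of_notMem hz, mul_zero]
      rw [hr]
      by_contra hne
      have hy : D.flow (-u) z ∈ box C T := mem_of_indicator_ne_zero hne
      rw [indicator_of_mem hy] at hne
      have hy' : u + sinceVisit C T (D.flow (-u) z) ∈ Ico 0 t := mem_of_indicator_ne_zero hne
      obtain ⟨h0, h1, h2⟩ := sinceVisit_spec hy
      have h3 : D.flow (-(u + sinceVisit C T (D.flow (-u) z))) z ∈ C := by
        rw [neg_add, flow_add hmin hprop]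
        exact h2
      refine hz ⟨⟨_, hy'.1, hy'.2, h3⟩, ?_⟩
      rw [hN.sinceVisit_eq hmin hprop hy'.1 (hy'.2.trans_le ht) h3, add_sub_cancel_left]
      exact ⟨h0, h1⟩
  -- Integration over `u` yields the factor `T`, which cancels the normalization of
  -- `sectionMeasure`.
  have step4 : ∀ z, ∫⁻ u, (box C t).indicator F z *
      (Ico 0 T).indicator 1 (sinceVisit C T z - u) = (box C t).indicator F z * ENNReal.ofReal T := by
    intro z
    have hI : Measurable ((Ico (0 : ℝ) T).indicator (1 : ℝ → ℝ≥0∞)) :=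
      measurable_one.indicator measurableSet_Ico
    have hI' : Measurable fun u => (Ico (0 : ℝ) T).indicator (1 : ℝ → ℝ≥0∞) (sinceVisit C T z - u) :=
      hI.comp (measurable_const.sub measurable_id)
    rw [lintegral_const_mul _ hI',
      lintegral_sub_left_eq_self ((Ico (0 : ℝ) T).indicator (1 : ℝ → ℝ≥0∞)),
      lintegral_indicator_one measurableSet_Ico, Real.volume_Ico, sub_zero]
  have hI2 : Measurable fun p : ℝ × D.Om => (box C t).indicator F p.2 *
      (Ico (0 : ℝ) T).indicator (1 : ℝ → ℝ≥0∞) (sinceVisit C T p.2 - p.1) :=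
    ((hF.indicator hWt).comp measurable_snd).mul ((measurable_one.indicator measurableSet_Ico).comp
      ((hsv.comp measurable_snd).sub measurable_fst))
  rw [lintegral_map hF hfl, lintegral_prod _ hFf.aemeasurable]
  simp only [step1]
  rw [lintegral_const_mul' _ _ (ENNReal.inv_ne_top.2 (by simpa using hT)),
    lintegral_lintegral_swap (f := fun s z => F (D.flow s (lastVisit C T z))) (hF.comp (hfl.comp (measurable_fst.prodMk
      (hlv.comp measurable_snd)))).aemeasurable]
  simp only [step2]
  rw [lintegral_lintegral_swap (f := fun z u => G u z) (hG.comp measurable_swap).aemeasurable]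
  simp only [step3]
  rw [lintegral_lintegral_swap (f := fun u z => (box C t).indicator F z *
    (Ico (0 : ℝ) T).indicator (1 : ℝ → ℝ≥0∞) (sinceVisit C T z - u)) hI2.aemeasurable]
  simp only [step4]
  rw [lintegral_mul_const _ (hF.indicator hWt), lintegral_indicator hWt, mul_comm _ (ENNReal.ofReal T),
    ← mul_assoc, ENNReal.inv_mul_cancel (by simpa using hT) ENNReal.ofReal_ne_top, one_mul]

theorem NoReturn.isTransverse {C : Set D.Om} (hC : IsClosed C) {T : ℝ} (hT : 0 < T)
    (hN : NoReturn C T) : D.IsTransverse μ C (sectionMeasure μ C T) := by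
  refine ⟨isFiniteMeasure_sectionMeasure C hT, sectionMeasure_compl hmin hprop hC hN, ?_⟩
  filter_upwards [Ioo_mem_nhdsGT hT] with t ht
  rw [image_eq_box hmin hprop]
  exact hN.restrict_box hmin hprop hμ hC hT ht.2.le

-- In product coordinates `lastVisit` is the second projection, so pushing `μ` forward from a thin
-- box recovers `t` times any transverse measure.
omit hμ [IsProbabilityMeasure μ] in
theorem NoReturn.unique {C : Set D.Om} (hC : IsClosed C) {T : ℝ} (hT : 0 < T)
    (hN : NoReturn C T) {ν ν' : Measure D.Om} (h : D.IsTransverse μ C ν)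
    (h' : D.IsTransverse μ C ν') : ν = ν' := by
  have hlv := hN.measurable_lastVisit hmin hprop hC
  have hfl := measurable_flow hmin hprop
  have key : ∀ {ν : Measure D.Om}, D.IsTransverse μ C ν → ∀ᶠ t in 𝓝[>] (0 : ℝ),
      (μ.restrict (box C t)).map (lastVisit C T) = ENNReal.ofReal t • ν := by
    rintro ν ⟨hfin, hνC, hev⟩
    filter_upwards [hev, Ioo_mem_nhdsGT hT] with t ht htT
    rw [image_eq_box hmin hprop] at ht
    rw [ht, Measure.map_map hlv hfl, Measure.map_congr (g := Prod.snd)]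
    · rw [Measure.map_snd_prod]
      simp
    · have h1 : ∀ᵐ p ∂((volume.restrict (Ico (0 : ℝ) t)).prod ν), p.2 ∈ C :=
        (Measure.quasiMeasurePreserving_snd).ae (show ∀ᵐ y ∂ν, y ∈ C from hνC)
      have h2 : ∀ᵐ p ∂((volume.restrict (Ico (0 : ℝ) t)).prod ν), p.1 ∈ Ico 0 t :=
        (Measure.quasiMeasurePreserving_fst).ae (ae_restrict_mem measurableSet_Ico)
      filter_upwards [h1, h2] with p hp1 hp2
      exact hN.lastVisit_flow hmin hprop hp2.1 (hp2.2.trans htT.2) hp1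
  obtain ⟨t, h1, h2, ht⟩ := ((key h).and ((key h').and self_mem_nhdsWithin)).exists
  have ht : 0 < t := ht
  rw [h1] at h2
  have h3 := congrArg (fun m => (ENNReal.ofReal t)⁻¹ • m) h2
  simpa only [smul_smul, ENNReal.inv_mul_cancel (by simpa using ht : ENNReal.ofReal t ≠ 0)
    ENNReal.ofReal_ne_top, one_smul] using h3

-- The points of the box of `C` whose last visit lies in `C'` are exactly the box of `C'`.
omit hμ [IsProbabilityMeasure μ] in
theorem NoReturn.sectionMeasure_restrict {C C' : Set D.Om} (hC : IsClosed C) (hC' : IsClosed C')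
    {T : ℝ} (hN : NoReturn C T) (hCC : C' ⊆ C) :
    sectionMeasure μ C' T = (sectionMeasure μ C T).restrict C' := by
  have hN' := hN.mono hCC le_rfl
  have hlv := hN.measurable_lastVisit hmin hprop hC
  have hbox : lastVisit C T ⁻¹' C' ∩ box C T = box C' T := by
    ext z
    constructor
    · rintro ⟨h1, h2⟩
      obtain ⟨k0, k1, -⟩ := sinceVisit_spec h2
      exact ⟨_, k0, k1, h1⟩
    · rintro ⟨s, h0, h1, h2⟩
      refine ⟨?_, s, h0, h1, hCC h2⟩
      change D.flow (-sinceVisit C T z) z ∈ C'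
      rwa [hN.sinceVisit_eq hmin hprop h0 h1 (hCC h2)]
  rw [sectionMeasure, sectionMeasure, Measure.restrict_smul,
    Measure.restrict_map hlv hC'.measurableSet,
    Measure.restrict_restrict (hlv hC'.measurableSet), hbox]
  congr 1
  refine Measure.map_congr ?_
  filter_upwards [ae_restrict_mem (measurableSet_box hmin hprop hC' T)] with z hz
  obtain ⟨s, h0, h1, h2⟩ := hz
  rw [lastVisit, lastVisit, hN.sinceVisit_eq hmin hprop h0 h1 (hCC h2),
    hN'.sinceVisit_eq hmin hprop h0 h1 h2]

-- Boxes and last visits are equivariant under the flow, so invariance of `μ` passes to the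
-- transverse measures.
omit [IsProbabilityMeasure μ] in
theorem sectionMeasure_image {C : Set D.Om} (hC : IsClosed C) {T : ℝ} (hN : NoReturn C T) (a : ℝ) :
    sectionMeasure μ (D.flow (-a) ⁻¹' C) T = (sectionMeasure μ C T).map (D.flow a) := by
  have hfa := measurable_flow_right hmin hprop a
  have hC' : IsClosed (D.flow (-a) ⁻¹' C) := hC.preimage (continuous_flow_right hmin hprop _)
  have hcomm : ∀ s t z, D.flow s (D.flow t z) = D.flow t (D.flow s z) := fun s t z => by
    rw [← flow_add hmin hprop, ← flow_add hmin hprop, add_comm]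
  have hN' : NoReturn (D.flow (-a) ⁻¹' C) T := fun y hy s h0 h1 h2 =>
    hN _ hy s h0 h1 (by rw [hcomm]; exact h2)
  have hbox : D.flow a ⁻¹' box (D.flow (-a) ⁻¹' C) T = box C T := by
    ext z
    refine exists_congr fun s => and_congr_right fun _ => and_congr_right fun _ => ?_
    rw [mem_preimage, hcomm, hcomm (-a), flow_flow_neg hmin hprop]
  have hlv := hN.measurable_lastVisit hmin hprop hC
  have hlv' := hN'.measurable_lastVisit hmin hprop hC'
  have hB := measurableSet_box hmin hprop hC' T
  rw [sectionMeasure, sectionMeasure, Measure.map_smul]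
  congr 1
  conv_lhs => rw [← hμ a]
  rw [Measure.restrict_map hfa hB, hbox, Measure.map_map hlv' hfa, Measure.map_map hfa hlv]
  refine Measure.map_congr ?_
  filter_upwards [ae_restrict_mem (measurableSet_box hmin hprop hC T)] with z hz
  obtain ⟨s, h0, h1, h2⟩ := hz
  have h3 : D.flow (-s) (D.flow a z) ∈ D.flow (-a) ⁻¹' C := by
    rw [mem_preimage, hcomm, hcomm (-a), flow_flow_neg hmin hprop]
    exact h2
  simp only [Function.comp_apply]
  rw [lastVisit, lastVisit, hN.sinceVisit_eq hmin hprop h0 h1 h2,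
    hN'.sinceVisit_eq hmin hprop h0 h1 h3, hcomm]

end Box

end SolenoidDatum

/-! ### Fibres and edge beginnings as transversals. -/

/-- A path is an occurrence of `e_v` inside `e_w`; `c` is the time at which this occurrence begins.
-/
theorem OrderedBratteli.FinPath.exists_offset {D : SolenoidDatum} {k n : ℕ} {v : D.B.V k}
    {w : D.B.V (k + n)} (p : D.B.FinPath v n w) :
    ∃ c, 0 ≤ c ∧ c + D.ht k v ≤ D.ht (k + n) w ∧ ∀ z a, 0 ≤ a → a ≤ D.ht k v →
      D.proj (k + n) z = D.pnt (k + n) w (c + a) → D.proj k z = D.pnt k v a := by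
  induction p with
  | nil => exact ⟨0, le_rfl, by simp, fun z a _ _ h => by rw [zero_add] at h; exact h⟩
  | @snoc n w i p ih =>
    obtain ⟨c, h0, h1, h2⟩ := ih
    have h3 := D.off_add_le (k + n) w i
    refine ⟨D.off (k + n) w i + c, add_nonneg (D.off_nonneg _ _ _) h0, le_trans ?_ h3,
      fun z a ha0 ha1 h => h2 z a ha0 ha1 ?_⟩
    · rw [add_assoc]; gcongr
    · rw [add_assoc] at h
      exact D.proj_src (add_nonneg h0 ha0) (by linarith) h

namespace SolenoidDatum

variable {D : SolenoidDatum}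

theorem fiber_eq_preimage (k : ℕ) (z : D.Om) : D.fiber k z = D.proj k ⁻¹' {D.proj k z} := by
  ext y
  exact D.mem_fiber

theorem isClosed_fiber (k : ℕ) (z : D.Om) : IsClosed (D.fiber k z) := by
  rw [fiber_eq_preimage]
  exact isClosed_singleton.preimage (D.continuous_proj k)

theorem fiber_congr {k : ℕ} {y z : D.Om} (h : D.proj k y = D.proj k z) :
    D.fiber k y = D.fiber k z := by
  rw [fiber_eq_preimage, fiber_eq_preimage, h]

theorem trans_congr (μ : Measure D.Om) {k : ℕ} {y z : D.Om} (h : D.proj k y = D.proj k z) :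
    D.trans μ k y = D.trans μ k z := by
  rw [trans, trans, fiber_congr h]

theorem Pik_congr (μ : Measure D.Om) {k : ℕ} (f : D.Om → ℝ) {y z : D.Om}
    (h : D.proj k y = D.proj k z) : D.Pik μ k f y = D.Pik μ k f z := by
  rw [Pik, Pik, trans_congr μ h]

theorem integrable_of_continuous {ν : Measure D.Om} [IsFiniteMeasure ν] {f : D.Om → ℝ}
    (hf : Continuous f) : Integrable f ν :=
  hf.integrable_of_hasCompactSupport (HasCompactSupport.of_compactSpace f)

variable (hmin : D.B.StronglyMinimal) (hprop : D.B.ProperlyOrdered)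

section

include hmin hprop

/-- The time-`t` map of the flow. -/
noncomputable def flowHomeo (t : ℝ) : D.Om ≃ₜ D.Om where
  toFun := D.flow t
  invFun := D.flow (-t)
  left_inv := flow_neg_flow hmin hprop t
  right_inv := flow_flow_neg hmin hprop t
  continuous_toFun := continuous_flow_right hmin hprop t
  continuous_invFun := continuous_flow_right hmin hprop (-t)

theorem measurableEmbedding_flow (t : ℝ) : MeasurableEmbedding (D.flow t) :=
  (flowHomeo hmin hprop t).measurableEmbedding

theorem noReturn_fiber (k : ℕ) (z : D.Om) : NoReturn (D.fiber k z) (D.mht k) := by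
  intro y hy s h0 h1 hs
  exact proj_flow_ne hmin hprop h0 h1 ((D.mem_fiber.1 hs).trans (D.mem_fiber.1 hy).symm)

/-- The points at which an orbit begins to run through the edge `e_v`. -/
def edgeStart (k : ℕ) (v : D.B.V k) : Set D.Om :=
  {z | D.proj k (D.flow (D.ht k v / 2) z) = D.pnt k v (D.ht k v / 2)}

omit hmin hprop in
theorem mem_edgeStart {k : ℕ} {v : D.B.V k} {z : D.Om} :
    z ∈ edgeStart k v ↔ D.proj k (D.flow (D.ht k v / 2) z) = D.pnt k v (D.ht k v / 2) := Iff.rfl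

theorem isClosed_edgeStart (k : ℕ) (v : D.B.V k) : IsClosed (edgeStart k v) :=
  isClosed_singleton.preimage ((D.continuous_proj k).comp (continuous_flow_right hmin hprop _))

theorem proj_flow_of_mem_edgeStart {k : ℕ} {v : D.B.V k} {z : D.Om} (hz : z ∈ edgeStart k v) {s : ℝ}
    (h0 : 0 ≤ s) (h1 : s ≤ D.ht k v) : D.proj k (D.flow s z) = D.pnt k v s := by
  have h := D.ht_pos k v
  have := proj_flow_of_interior hmin hprop (s := s - D.ht k v / 2) hz (by linarith) (by linarith)
    (by linarith) (by linarith)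
  rwa [← flow_add hmin hprop, add_sub_cancel] at this

theorem mem_edgeStart_of_proj {k : ℕ} {v : D.B.V k} {z : D.Om} {a : ℝ} (h0 : 0 < a)
    (h1 : a < D.ht k v) (h : D.proj k z = D.pnt k v a) : D.flow (-a) z ∈ edgeStart k v := by
  have := proj_flow_of_interior hmin hprop (s := D.ht k v / 2 - a) h h0 h1 (by linarith)
    (by linarith)
  rw [add_sub_cancel] at this
  rwa [mem_edgeStart, ← flow_add hmin hprop, neg_add_eq_sub]

theorem preimage_edgeStart {k : ℕ} {v : D.B.V k} {s : ℝ} (h0 : 0 < s) (h1 : s < D.ht k v) {z : D.Om}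
    (hz : D.proj k z = D.pnt k v s) : D.flow (-s) ⁻¹' edgeStart k v = D.fiber k z := by
  ext y
  rw [mem_fiber, hz]
  constructor
  · intro hy
    have := proj_flow_of_mem_edgeStart hmin hprop hy h0.le h1.le
    rwa [flow_flow_neg hmin hprop] at this
  · exact mem_edgeStart_of_proj hmin hprop h0 h1

omit hmin hprop in
theorem eq_of_proj_pnt_eq {k : ℕ} {v w : D.B.V k} {s t : ℝ} (hs0 : 0 < s) (hs1 : s < D.ht k v)
    (ht0 : 0 ≤ t) (ht1 : t ≤ D.ht k w) (h : D.pnt k v s = D.pnt k w t) : v = w ∧ s = t := by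
  rcases D.pnt_eq_pnt hs0.le hs1.le ht0 ht1 h with h | ⟨h | h, -⟩
  · exact h
  · linarith
  · linarith

theorem noReturn_edgeStart (k : ℕ) (v : D.B.V k) : NoReturn (edgeStart k v) (D.ht k v) := by
  intro y hy s h0 h1 hs
  have h2 := proj_flow_of_mem_edgeStart hmin hprop hy (s := s + (D.ht k v - s) / 2) (by linarith)
    (by linarith)
  have h3 := proj_flow_of_mem_edgeStart hmin hprop hs (s := (D.ht k v - s) / 2) (by linarith)
    (by linarith)
  rw [← flow_add hmin hprop, h2] at h3
  have := (eq_of_proj_pnt_eq (by linarith) (by linarith) (by linarith) (by linarith) h3).2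
  linarith

/-- Every point lies on exactly one edge, if the vertices are counted to the outgoing edges. -/
theorem existsUnique_mem_box (k : ℕ) (z : D.Om) :
    ∃! v, z ∈ box (edgeStart k v) (D.ht k v) := by
  obtain ⟨v, a, ha0, ha1, h, h'⟩ := exists_start hmin hprop k z
  have hv := D.ht_pos k v
  refine ⟨v, ?_, fun w hw => ?_⟩
  · rcases ha0.eq_or_lt with rfl | ha0
    · refine ⟨0, le_rfl, hv, ?_⟩
      rw [neg_zero, flow_zero hmin hprop, mem_edgeStart, h' _ (by linarith) (by linarith), zero_add]
    · exact ⟨a, ha0.le, ha1, mem_edgeStart_of_proj hmin hprop ha0 ha1 h⟩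
  · obtain ⟨s, hs0, hs1, hs⟩ := hw
    have hw := D.ht_pos k w
    have hd1 := min_le_left ((D.ht k v - a) / 2) ((D.ht k w - s) / 2)
    have hd2 := min_le_right ((D.ht k v - a) / 2) ((D.ht k w - s) / 2)
    have hd0 : 0 < min ((D.ht k v - a) / 2) ((D.ht k w - s) / 2) :=
      lt_min (by linarith) (by linarith)
    set d := min ((D.ht k v - a) / 2) ((D.ht k w - s) / 2)
    have h1 := h' d hd0.le (by linarith)
    have h2 := proj_flow_of_mem_edgeStart hmin hprop hs (s := s + d) (by linarith) (by linarith)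
    rw [← flow_add hmin hprop, neg_add_cancel_left, h1] at h2
    exact (eq_of_proj_pnt_eq (by linarith) (by linarith) (by linarith) (by linarith)
      h2).1.symm

/-- Near the points of a fibre, all orbits run along edges in the same way. -/
theorem exists_fiber_start (k : ℕ) (z : D.Om) : ∃ a d, 0 ≤ a ∧ 0 < d ∧ ∀ y ∈ D.fiber k z, ∃ v,
    a + d ≤ D.ht k v ∧ ∀ s, 0 ≤ s → s ≤ d → D.proj k (D.flow s y) = D.pnt k v (a + s) := by
  obtain ⟨v, a, ha0, ha1, h, h'⟩ := exists_start hmin hprop k z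
  -- Starting positions are never at the end of an edge, so a vertex always has position `0`. The
  -- edges can differ within a fibre only there, and then `mht k` bounds their lengths from below.
  refine ⟨a, min (D.mht k) (D.ht k v - a), ha0, lt_min (D.mht_pos k) (sub_pos.2 ha1),
    fun y hy => ?_⟩
  obtain ⟨w, b, hb0, hb1, k1, k2⟩ := exists_start hmin hprop k y
  have hd1 := min_le_left (D.mht k) (D.ht k v - a)
  have hd2 := min_le_right (D.mht k) (D.ht k v - a)
  have hw := D.mht_le k w
  rw [mem_fiber, k1, h] at hy
  rcases D.pnt_eq_pnt hb0 hb1.le ha0 ha1.le hy with ⟨rfl, rfl⟩ | ⟨h1 | h1, h2 | h2⟩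
  · exact ⟨w, by linarith, fun s h0 h1 => k2 s h0 (by linarith)⟩
  · subst h1 h2
    exact ⟨w, by linarith, fun s h0 h1 => k2 s h0 (by linarith)⟩
  all_goals linarith

omit hmin hprop in
theorem finite_pnt_eq (k : ℕ) (v : D.B.V k) (x : D.Gam k) :
    {s | 0 ≤ s ∧ s ≤ D.ht k v ∧ D.pnt k v s = x}.Finite := by
  rcases eq_empty_or_nonempty {s | 0 ≤ s ∧ s ≤ D.ht k v ∧ D.pnt k v s = x} with h | ⟨s₀, h0, h1, h2⟩
  · rw [h]; exact finite_empty
  · refine (Set.toFinite {s₀, 0, D.ht k v}).subset ?_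
    rintro s ⟨k0, k1, k2⟩
    rcases D.pnt_eq_pnt k0 k1 h0 h1 (k2.trans h2.symm) with ⟨-, rfl⟩ | ⟨rfl | rfl, -⟩ <;> simp

omit hmin hprop in
theorem finite_proj_succ_fiber (k : ℕ) (z : D.Om) : (D.proj (k + 1) '' D.fiber k z).Finite := by
  have hfin : (⋃ e : D.B.Edge k, (fun s => D.pnt (k + 1) e.1 (D.off k e.1 e.2 + s)) ''
      {s | 0 ≤ s ∧ s ≤ D.ht k (D.B.src k e.1 e.2) ∧
        D.pnt k (D.B.src k e.1 e.2) s = D.proj k z}).Finite :=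
    finite_iUnion fun e => (finite_pnt_eq k _ _).image _
  refine hfin.subset ?_
  rintro _ ⟨y, hy, rfl⟩
  obtain ⟨v, i, s, h0, h1, h2, h3⟩ := D.gamMap_iff.1 (y.2 k)
  exact mem_iUnion.2 ⟨⟨v, i⟩, s, ⟨h0, h1, h3.symm.trans (D.mem_fiber.1 hy)⟩, h2.symm⟩

/-- For small times `s`, the points of a fibre are moved onto a finite union of fibres. -/
theorem exists_flow_fiber (k : ℕ) (z : D.Om) : ∃ d, 0 < d ∧ ∀ s, 0 ≤ s → s < d →
    (∀ y ∈ D.flow (-s) ⁻¹' D.fiber k z, D.fiber k y ⊆ D.flow (-s) ⁻¹' D.fiber k z) ∧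
    (D.proj k '' (D.flow (-s) ⁻¹' D.fiber k z)).Finite ∧
    (0 < s → ∃ v r, 0 < r ∧ r < D.ht k v ∧ D.proj k (D.flow s z) = D.pnt k v r) := by
  obtain ⟨a, d, ha, hd, h⟩ := exists_fiber_start hmin hprop k z
  refine ⟨d, hd, fun s hs0 hs1 => ⟨fun y hy y' hy' => ?_, ?_, fun hs0 => ?_⟩⟩
  · rcases hs0.eq_or_lt with rfl | hs0
    · simp only [neg_zero, mem_preimage, flow_zero hmin hprop, mem_fiber] at *
      exact hy'.trans hy
    · obtain ⟨v, hv, h1⟩ := h _ hy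
      have h2 := h1 s hs0.le hs1.le
      rw [flow_flow_neg hmin hprop, ← D.mem_fiber.1 hy'] at h2
      have h3 := proj_flow_of_interior hmin hprop (s := -s) h2 (by linarith) (by linarith)
        (by linarith) (by linarith)
      rw [mem_preimage, mem_fiber, h3, ← D.mem_fiber.1 hy, add_neg_cancel_right]
      have h4 := h1 0 le_rfl hd.le
      rw [flow_zero hmin hprop, add_zero] at h4
      exact h4.symm
  · refine (finite_range fun v => D.pnt k v (a + s)).subset ?_
    rintro _ ⟨y, hy, rfl⟩
    obtain ⟨v, hv, h1⟩ := h _ hy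
    have h2 := h1 s hs0 hs1.le
    rw [flow_flow_neg hmin hprop] at h2
    exact ⟨v, h2.symm⟩
  · obtain ⟨v, hv, h1⟩ := h z (D.mem_fiber.2 rfl)
    exact ⟨v, a + s, by linarith, by linarith, h1 s hs0.le hs1.le⟩

end

/-! ### Averages over fibres. -/

section Measure

variable {μ : Measure D.Om} [IsProbabilityMeasure μ] (hμ : ∀ t : ℝ, μ.map (D.flow t) = μ)

include hmin hprop

theorem NoReturn.preimage {C : Set D.Om} {T : ℝ} (hN : NoReturn C T) (a : ℝ) :
    NoReturn (D.flow a ⁻¹' C) T := fun y hy s h0 h1 h2 => by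
  refine hN _ hy s h0 h1 ?_
  rw [← flow_add hmin hprop, add_comm, flow_add hmin hprop]
  exact h2

include hμ

theorem isTransverse_trans (k : ℕ) (z : D.Om) : D.IsTransverse μ (D.fiber k z) (D.trans μ k z) := by
  have hex : ∃ ν, D.IsTransverse μ (D.fiber k z) ν :=
    ⟨_, (noReturn_fiber hmin hprop k z).isTransverse hmin hprop hμ (isClosed_fiber k z)
      (D.mht_pos k)⟩
  rw [trans, dif_pos hex]
  exact hex.choose_spec

theorem isFiniteMeasure_trans (k : ℕ) (z : D.Om) : IsFiniteMeasure (D.trans μ k z) :=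
  (isTransverse_trans hmin hprop hμ k z).1

/-- Uniqueness removes the choice made in `trans`; any valid return bound `T` computes the same
measure. -/
theorem trans_eq_sectionMeasure {k : ℕ} {z : D.Om} {T : ℝ} (hT : 0 < T)
    (hN : NoReturn (D.fiber k z) T) : D.trans μ k z = sectionMeasure μ (D.fiber k z) T :=
  hN.unique hmin hprop (isClosed_fiber k z) hT (isTransverse_trans hmin hprop hμ k z)
    (hN.isTransverse hmin hprop hμ (isClosed_fiber k z) hT)

theorem trans_eq_restrict {C : Set D.Om} (hC : IsClosed C) {T : ℝ} (hT : 0 < T) (hN : NoReturn C T)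
    {k : ℕ} {z : D.Om} (hz : D.fiber k z ⊆ C) :
    D.trans μ k z = (sectionMeasure μ C T).restrict (D.fiber k z) := by
  rw [trans_eq_sectionMeasure hmin hprop hμ hT (hN.mono hz le_rfl)]
  exact hN.sectionMeasure_restrict hmin hprop hC (isClosed_fiber k z) hz

/-- Averaging over the fibres which make up a transversal. -/
theorem integral_Pik {C : Set D.Om} (hC : IsClosed C) {T : ℝ} (hT : 0 < T) (hN : NoReturn C T) {k : ℕ}
    (hsat : ∀ y ∈ C, D.fiber k y ⊆ C) (hfin : (D.proj k '' C).Finite) {f : D.Om → ℝ}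
    (hf : Continuous f) :
    ∫ y, D.Pik μ k f y ∂(sectionMeasure μ C T) = ∫ y, f y ∂(sectionMeasure μ C T) := by
  classical
  have := isFiniteMeasure_sectionMeasure (μ := μ) C hT
  set ν := sectionMeasure μ C T with hν
  have hνC : ν.restrict C = ν := Measure.restrict_eq_self_of_ae_mem
    (show ∀ᵐ y ∂ν, y ∈ C from sectionMeasure_compl hmin hprop hC hN)
  have hCF : C = ⋃ x ∈ hfin.toFinset, D.proj k ⁻¹' {x} := by
    ext y
    simp only [Finite.mem_toFinset, mem_iUnion, mem_preimage, mem_singleton_iff, exists_prop,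
      exists_eq_right']
    constructor
    · exact mem_image_of_mem _
    · rintro ⟨y', hy', h⟩
      exact hsat y' hy' (D.mem_fiber.2 h.symm)
  have hmeas : ∀ x, MeasurableSet (D.proj k ⁻¹' {x}) := fun x =>
    (isClosed_singleton.preimage (D.continuous_proj k)).measurableSet
  have hdisj : (hfin.toFinset : Set (D.Gam k)).PairwiseDisjoint fun x => D.proj k ⁻¹' {x} :=
    fun x _ y _ hxy => disjoint_singleton.2 hxy |>.preimage _
  have hconst : ∀ y ∈ C, EqOn (D.Pik μ k f) (fun _ => D.Pik μ k f y) (D.proj k ⁻¹' {D.proj k y}) :=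
    fun y _ y' hy' => Pik_congr μ f hy'
  rw [← hνC, hCF, integral_biUnion_finset _ (fun x _ => hmeas x) hdisj,
    integral_biUnion_finset _ (fun x _ => hmeas x) hdisj]
  · refine Finset.sum_congr rfl fun x hx => ?_
    obtain ⟨y, hy, rfl⟩ := hfin.mem_toFinset.1 hx
    rw [setIntegral_congr_fun (hmeas _) (hconst y hy), setIntegral_const, Pik,
      trans_eq_restrict hmin hprop hμ hC hT hN (hsat y hy), fiber_eq_preimage, ← hν, Measure.real,
      Measure.real, Measure.restrict_apply_univ, smul_eq_mul]
    -- A null fibre contributes zero to both sides; otherwise its mass cancels against the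
    -- normalization of the average.
    by_cases h0 : ν (D.proj k ⁻¹' {D.proj k y}) = 0
    · rw [Measure.restrict_eq_zero.2 h0]; simp
    · rw [mul_inv_cancel_left₀ (ENNReal.toReal_ne_zero.2 ⟨h0, measure_ne_top _ _⟩)]
  · exact fun x _ => (integrable_of_continuous hf).integrableOn
  · intro x hx
    obtain ⟨y, hy, rfl⟩ := hfin.mem_toFinset.1 hx
    exact (integrableOn_const (measure_ne_top _ _)).congr_fun (hconst y hy).symm (hmeas _)

/-- The tower property: a fibre of level `k` is a finite union of fibres of level `k + 1`. -/
theorem Pik_Pik_succ (k : ℕ) {f : D.Om → ℝ} (hf : Continuous f) (z : D.Om) :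
    D.Pik μ k (D.Pik μ (k + 1) f) z = D.Pik μ k f z := by
  have hN := noReturn_fiber hmin hprop k z
  rw [Pik, Pik, trans_eq_sectionMeasure hmin hprop hμ (D.mht_pos k) hN,
    integral_Pik hmin hprop hμ (isClosed_fiber k z) (D.mht_pos k) hN (fun y hy y' hy' => ?_)
      (finite_proj_succ_fiber k z) hf]
  exact D.mem_fiber.2 ((D.proj_eq_of_le (Nat.le_succ k) (D.mem_fiber.1 hy')).trans
    (D.mem_fiber.1 hy))

/-- Averaging commutes with the flow, after integration over a fibre. -/
theorem exists_integral_Pik_flow (k : ℕ) (z : D.Om) : ∃ d, 0 < d ∧ ∀ s, 0 ≤ s → s < d →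
    ∀ f : D.Om → ℝ, Continuous f →
    ∫ y, D.Pik μ k f (D.flow s y) ∂(D.trans μ k z) = ∫ y, f (D.flow s y) ∂(D.trans μ k z) := by
  obtain ⟨d, hd, h⟩ := exists_flow_fiber hmin hprop k z
  refine ⟨d, hd, fun s hs0 hs1 f hf => ?_⟩
  have hN := noReturn_fiber hmin hprop k z
  have hme := measurableEmbedding_flow hmin hprop s
  rw [trans_eq_sectionMeasure hmin hprop hμ (D.mht_pos k) hN, ← hme.integral_map, ← hme.integral_map,
    ← sectionMeasure_image hmin hprop hμ (isClosed_fiber k z) hN s]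
  exact integral_Pik hmin hprop hμ ((isClosed_fiber k z).preimage (continuous_flow_right hmin hprop _))
    (D.mht_pos k) (hN.preimage hmin hprop _) (h s hs0 hs1).1 (h s hs0 hs1).2.1 hf

/-- Inside an edge, the flow maps transverse measures to transverse measures. -/
theorem map_sectionMeasure_edgeStart {k : ℕ} {v : D.B.V k} {s : ℝ} (h0 : 0 < s) (h1 : s < D.ht k v)
    {z : D.Om} (hz : D.proj k z = D.pnt k v s) :
    D.trans μ k z = (sectionMeasure μ (edgeStart k v) (D.ht k v)).map (D.flow s) := by
  have hN := noReturn_edgeStart hmin hprop k v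
  have hpre := preimage_edgeStart hmin hprop h0 h1 hz
  rw [← sectionMeasure_image hmin hprop hμ (isClosed_edgeStart hmin hprop k v) hN, hpre]
  refine trans_eq_sectionMeasure hmin hprop hμ (D.ht_pos k v) ?_
  rw [← hpre]
  exact hN.preimage hmin hprop _

/-- The boxes over the edges of level `k` partition `Ω`, and on each of them `μ` is a product. -/
theorem integral_eq_sum_edges (k : ℕ) {f : D.Om → ℝ} (hf : Continuous f) :
    ∫ z, f z ∂μ = ∑ v, ∫ s in Ico 0 (D.ht k v),
      ∫ y, f (D.flow s y) ∂(sectionMeasure μ (edgeStart k v) (D.ht k v)) := by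
  have hbox : ∀ v, MeasurableSet (box (edgeStart k v) (D.ht k v)) := fun v =>
    measurableSet_box hmin hprop (isClosed_edgeStart hmin hprop k v) _
  have huniv : ⋃ v, box (edgeStart k v) (D.ht k v) = univ :=
    eq_univ_of_forall fun z => mem_iUnion.2 (existsUnique_mem_box hmin hprop k z).exists
  rw [← setIntegral_univ, ← huniv, integral_iUnion_fintype hbox]
  · refine Finset.sum_congr rfl fun v _ => ?_
    have := isFiniteMeasure_sectionMeasure (μ := μ) (edgeStart k v) (D.ht_pos k v)
    have hcont := hf.comp (continuous_flow hmin hprop)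
    have hN := noReturn_edgeStart hmin hprop k v
    rw [hN.restrict_box hmin hprop hμ (isClosed_edgeStart hmin hprop k v) (D.ht_pos k v) le_rfl,
      integral_map (measurable_flow hmin hprop).aemeasurable hf.aestronglyMeasurable, integral_prod]
    obtain ⟨C, hC⟩ := isCompact_univ.exists_bound_of_continuousOn hf.continuousOn
    exact Integrable.of_bound hcont.aestronglyMeasurable C (ae_of_all _ fun p => hC _ (mem_univ _))
  · exact fun v w hvw => disjoint_left.2 fun z hv hw =>
      hvw ((existsUnique_mem_box hmin hprop k z).unique hv hw)
  · exact fun v => (integrable_of_continuous hf).integrableOn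

theorem integral_eq_zero_of_trans (k : ℕ) {g : D.Om → ℝ} (hg : Continuous g)
    (h : ∀ z, ∫ y, g y ∂(D.trans μ k z) = 0) : ∫ z, g z ∂μ = 0 := by
  rw [integral_eq_sum_edges hmin hprop hμ k hg]
  refine Finset.sum_eq_zero fun v _ => ?_
  rw [integral_Ico_eq_integral_Ioo]
  refine setIntegral_eq_zero_of_forall_eq_zero fun s hs => ?_
  obtain ⟨z, hz⟩ := D.proj_surjective k (D.pnt k v s)
  rw [← (measurableEmbedding_flow hmin hprop s).integral_map,
    ← map_sectionMeasure_edgeStart hmin hprop hμ hs.1 hs.2 hz]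
  exact h z

/-- If the measure over an interior point of `e_v` vanished, it would vanish along all of `e_v`,
hence along every longer edge containing it. By strong minimality these are all the edges of some
level, so `μ` would be zero. A fibre over a vertex is first moved into the interior of edges. -/
theorem trans_ne_zero (k : ℕ) (z : D.Om) : D.trans μ k z ≠ 0 := by
  have hint : ∀ k z v r, 0 < r → r < D.ht k v → D.proj k z = D.pnt k v r → D.trans μ k z ≠ 0 := by
    intro k z v r h0 h1 hz h
    have hC := isClosed_edgeStart hmin hprop k v
    have hz0 : sectionMeasure μ (edgeStart k v) (D.ht k v) = 0 := by
      rw [map_sectionMeasure_edgeStart hmin hprop hμ h0 h1 hz] at h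
      exact (Measure.map_eq_zero_iff (measurable_flow_right hmin hprop r).aemeasurable).1 h
    obtain ⟨n, hn⟩ := hmin k
    have hall : ∀ w, sectionMeasure μ (edgeStart (k + n) w) (D.ht (k + n) w) = 0 := by
      intro w
      obtain ⟨p, -⟩ := hn v w
      obtain ⟨c, hc0, hc1, hc⟩ := p.exists_offset
      have hv := D.ht_pos k v
      obtain ⟨y, hy⟩ := D.proj_surjective (k + n) (D.pnt (k + n) w (c + D.ht k v / 2))
      have hyk := hc y _ (by linarith) (by linarith) hy
      have hsub : D.fiber (k + n) y ⊆ D.fiber k y := fun y' hy' =>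
        D.mem_fiber.2 (D.proj_eq_of_le (Nat.le_add_right k n) (D.mem_fiber.1 hy'))
      have h2 := trans_eq_restrict hmin hprop hμ (isClosed_fiber k y) (D.mht_pos k)
        (noReturn_fiber hmin hprop k y) hsub
      rw [← trans_eq_sectionMeasure hmin hprop hμ (D.mht_pos k) (noReturn_fiber hmin hprop k y),
        map_sectionMeasure_edgeStart hmin hprop hμ (by linarith) (by linarith) hyk, hz0,
        Measure.map_zero, Measure.restrict_zero,
        map_sectionMeasure_edgeStart hmin hprop hμ (by linarith) (by linarith) hy] at h2
      exact (Measure.map_eq_zero_iff (measurable_flow_right hmin hprop _).aemeasurable).1 h2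
    have h3 := integral_eq_sum_edges hmin hprop hμ (k + n) (f := fun _ => 1) continuous_const
    simp [hall] at h3
  obtain ⟨d, hd, h⟩ := exists_flow_fiber hmin hprop k z
  obtain ⟨h1, -, h2⟩ := h (d / 2) (by linarith) (by linarith)
  obtain ⟨v, r, hr0, hr1, hr⟩ := h2 (by linarith)
  intro h0
  refine hint k _ v r hr0 hr1 hr ?_
  have hN := noReturn_fiber hmin hprop k z
  rw [trans_eq_restrict hmin hprop hμ
    ((isClosed_fiber k z).preimage (continuous_flow_right hmin hprop (-(d / 2)))) (D.mht_pos k)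
    (hN.preimage hmin hprop _) (h1 _ ?_),
    sectionMeasure_image hmin hprop hμ (isClosed_fiber k z) hN,
    ← trans_eq_sectionMeasure hmin hprop hμ (D.mht_pos k) hN, h0, Measure.map_zero,
    Measure.restrict_zero]
  rw [mem_preimage, flow_neg_flow hmin hprop]
  exact D.mem_fiber.2 rfl

theorem trans_real_univ_pos (k : ℕ) (z : D.Om) : 0 < (D.trans μ k z).real univ := by
  have := isFiniteMeasure_trans hmin hprop hμ k z
  exact ENNReal.toReal_pos (fun h => trans_ne_zero hmin hprop hμ k z (Measure.measure_univ_eq_zero.1 h))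
    (measure_ne_top _ _)

/-- In the product coordinates of its own box a fibre is the slice at time `0`, which is Lebesgue
null; there are finitely many vertices. -/
theorem measure_vertices (k : ℕ) : μ {z | D.IsVertex k (D.proj k z)} = 0 := by
  have hfib : ∀ z, μ (D.fiber k z) = 0 := by
    intro z
    have hN := noReturn_fiber hmin hprop k z
    have hC := isClosed_fiber k z
    have := isFiniteMeasure_sectionMeasure (μ := μ) (D.fiber k z) (D.mht_pos k)
    have hsub : D.fiber k z ⊆ box (D.fiber k z) (D.mht k) := fun y hy =>
      ⟨0, le_rfl, D.mht_pos k, by rwa [neg_zero, flow_zero hmin hprop]⟩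
    have h1 := congrArg (fun m => m (D.fiber k z))
      (hN.restrict_box hmin hprop hμ hC (D.mht_pos k) le_rfl)
    simp only [Measure.restrict_apply hC.measurableSet, inter_eq_left.2 hsub] at h1
    rw [h1, Measure.map_apply (measurable_flow hmin hprop) hC.measurableSet]
    have h2 : ∀ᵐ p ∂((volume.restrict (Ico (0 : ℝ) (D.mht k))).prod
        (sectionMeasure μ (D.fiber k z) (D.mht k))), p.2 ∈ D.fiber k z :=
      (Measure.quasiMeasurePreserving_snd).ae (show ∀ᵐ y ∂_, y ∈ D.fiber k z from
        sectionMeasure_compl hmin hprop hC hN)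
    have h3 : ∀ᵐ p ∂((volume.restrict (Ico (0 : ℝ) (D.mht k))).prod
        (sectionMeasure μ (D.fiber k z) (D.mht k))), p.1 ∈ Ioo 0 (D.mht k) := by
      rw [← Measure.restrict_congr_set Ioo_ae_eq_Ico]
      exact (Measure.quasiMeasurePreserving_fst).ae (ae_restrict_mem measurableSet_Ioo)
    refine measure_mono_null (t := {p | ¬ (p.2 ∈ D.fiber k z ∧ p.1 ∈ Ioo 0 (D.mht k))}) ?_ (h2.and h3)
    exact fun p hp hpp => hN _ hpp.1 _ hpp.2.1 hpp.2.2 hp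
  have hpt : ∀ x : D.Gam k, μ (D.proj k ⁻¹' {x}) = 0 := by
    intro x
    obtain ⟨z, rfl⟩ := D.proj_surjective k x
    rw [← fiber_eq_preimage]
    exact hfib z
  have : {z | D.IsVertex k (D.proj k z)} ⊆ ⋃ v : D.B.V k, (D.proj k ⁻¹' {D.pnt k v 0} ∪
      D.proj k ⁻¹' {D.pnt k v (D.ht k v)}) := by
    intro z hz
    obtain ⟨v, hv⟩ := D.isVertex_iff.1 hz
    exact mem_iUnion.2 ⟨v, hv⟩
  refine measure_mono_null this (measure_iUnion_null fun v => measure_union_null (hpt _) (hpt _))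

end Measure

end SolenoidDatum

namespace SolenoidDatum

variable {D : SolenoidDatum}

/-! ### Differentiable functions on the graphs -/

theorem exists_pt {k : ℕ} (a : D.Gam k) : ∃ v, ∃ t ∈ Icc 0 (D.len k v), a = D.pt k v t := by
  obtain ⟨⟨v, t, ht⟩, rfl⟩ := Quot.exists_rep a
  exact ⟨v, t, ht, by rw [pt, projIcc_of_mem _ ht]⟩

theorem IsDerivGam.derivGam_eq {k : ℕ} {g g' : D.Gam k → ℝ} (h : D.IsDerivGam k g g') :
    D.derivGam k g = g' := by
  have hex : ∃ g', D.IsDerivGam k g g' := ⟨g', h⟩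
  rw [derivGam, dif_pos hex]
  funext a
  obtain ⟨v, t, ht, rfl⟩ := exists_pt a
  exact (uniqueDiffOn_Icc (D.len_pos k v) t ht).eq_deriv _ (hex.choose_spec v t ht) (h v t ht)

theorem IsDerivGam.add {k : ℕ} {g g' f f' : D.Gam k → ℝ} (h : D.IsDerivGam k g g')
    (h' : D.IsDerivGam k f f') : D.IsDerivGam k (g + f) (g' + f') :=
  fun v t ht => (h v t ht).add (h' v t ht)

theorem IsDerivGam.const_smul {k : ℕ} {g g' : D.Gam k → ℝ} (h : D.IsDerivGam k g g') (c : ℝ) :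
    D.IsDerivGam k (c • g) (c • g') :=
  fun v t ht => (h v t ht).const_smul c

theorem IsDerivGam.sub_const {k : ℕ} {g g' : D.Gam k → ℝ} (h : D.IsDerivGam k g g') (c : ℝ) :
    D.IsDerivGam k (fun p => g p - c) g' :=
  fun v t ht => (h v t ht).sub_const c

theorem isCr_succ_iff {k r : ℕ} {g : D.Gam k → ℝ} : D.IsCr k (r + 1) g ↔
    Continuous g ∧ D.IsDerivGam k g (D.derivGam k g) ∧ D.IsCr k r (D.derivGam k g) := by
  constructor
  · rintro ⟨h1, g', h2, h3⟩
    rw [h2.derivGam_eq]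
    exact ⟨h1, h2, h3⟩
  · rintro ⟨h1, h2, h3⟩
    exact ⟨h1, _, h2, h3⟩

theorem IsCr.continuous {k r : ℕ} {g : D.Gam k → ℝ} (h : D.IsCr k r g) : Continuous g := by
  cases r with
  | zero => exact h
  | succ r => exact h.1

theorem IsCr.of_succ {k r : ℕ} {g : D.Gam k → ℝ} (h : D.IsCr k (r + 1) g) : D.IsCr k r g := by
  induction r generalizing g with
  | zero => exact h.1
  | succ r ih => exact ⟨h.1, h.2.imp fun _ h => ⟨h.1, ih h.2⟩⟩

theorem IsCr.add {k r : ℕ} {g f : D.Gam k → ℝ} (h : D.IsCr k r g) (h' : D.IsCr k r f) :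
    D.IsCr k r (g + f) := by
  induction r generalizing g f with
  | zero => exact Continuous.add h h'
  | succ r ih =>
    obtain ⟨h1, g', h2, h3⟩ := h
    obtain ⟨k1, f', k2, k3⟩ := h'
    exact ⟨h1.add k1, _, h2.add k2, ih h3 k3⟩

theorem IsCr.const_smul {k r : ℕ} {g : D.Gam k → ℝ} (h : D.IsCr k r g) (c : ℝ) :
    D.IsCr k r (c • g) := by
  induction r generalizing g with
  | zero => exact Continuous.const_smul h c
  | succ r ih =>
    obtain ⟨h1, g', h2, h3⟩ := h
    exact ⟨h1.const_smul c, _, h2.const_smul c, ih h3⟩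

theorem IsCr.sub_const {k r : ℕ} {g : D.Gam k → ℝ} (h : D.IsCr k r g) (c : ℝ) :
    D.IsCr k r (fun p => g p - c) := by
  cases r with
  | zero => exact Continuous.sub h continuous_const
  | succ r => exact ⟨h.1.sub continuous_const, h.2.imp fun _ h => ⟨h.1.sub_const c, h.2⟩⟩

theorem iterate_derivGam_add {k r j : ℕ} (hj : j ≤ r) {g f : D.Gam k → ℝ} (h : D.IsCr k r g)
    (h' : D.IsCr k r f) :
    (D.derivGam k)^[j] (g + f) = (D.derivGam k)^[j] g + (D.derivGam k)^[j] f := by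
  induction j generalizing r g f with
  | zero => rfl
  | succ j ih =>
    obtain ⟨r, rfl⟩ : ∃ s, r = s + 1 := ⟨r - 1, by omega⟩
    obtain ⟨-, h1, h2⟩ := isCr_succ_iff.1 h
    obtain ⟨-, k1, k2⟩ := isCr_succ_iff.1 h'
    simp only [Function.iterate_succ_apply, (h1.add k1).derivGam_eq]
    exact ih (by omega) h2 k2

theorem iterate_derivGam_smul {k r j : ℕ} (hj : j ≤ r) {g : D.Gam k → ℝ} (h : D.IsCr k r g) (c : ℝ) :
    (D.derivGam k)^[j] (c • g) = c • (D.derivGam k)^[j] g := by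
  induction j generalizing r g with
  | zero => rfl
  | succ j ih =>
    obtain ⟨r, rfl⟩ : ∃ s, r = s + 1 := ⟨r - 1, by omega⟩
    obtain ⟨-, h1, h2⟩ := isCr_succ_iff.1 h
    simp only [Function.iterate_succ_apply, (h1.const_smul c).derivGam_eq]
    exact ih (by omega) h2

theorem crNorm_of_isCr {k r : ℕ} {g : D.Gam k → ℝ} (h : D.IsCr k r g) :
    D.crNorm k r g = ∑ j ∈ Finset.range (r + 1), ⨆ p, ‖((D.derivGam k)^[j] g) p‖ₑ := if_pos h

theorem isCr_of_crNorm_ne_top {k r : ℕ} {g : D.Gam k → ℝ} (h : D.crNorm k r g ≠ ⊤) :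
    D.IsCr k r g := by
  by_contra hg
  exact h (if_neg hg)

theorem crNorm_add_le (k r : ℕ) (g f : D.Gam k → ℝ) :
    D.crNorm k r (g + f) ≤ D.crNorm k r g + D.crNorm k r f := by
  by_cases hg : D.IsCr k r g
  · by_cases hf : D.IsCr k r f
    · rw [crNorm_of_isCr hg, crNorm_of_isCr hf, crNorm_of_isCr (hg.add hf), ← Finset.sum_add_distrib]
      refine Finset.sum_le_sum fun j hj => iSup_le fun p => ?_
      rw [iterate_derivGam_add (Nat.lt_succ_iff.1 (Finset.mem_range.1 hj)) hg hf]
      exact (enorm_add_le _ _).trans (add_le_add (le_iSup (fun p => ‖((D.derivGam k)^[j] g) p‖ₑ) p)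
        (le_iSup (fun p => ‖((D.derivGam k)^[j] f) p‖ₑ) p))
    · rw [crNorm, crNorm, crNorm, if_neg hf, add_top]
      exact le_top
  · rw [crNorm, crNorm, crNorm, if_neg hg, top_add]
    exact le_top

theorem crNorm_smul {k r : ℕ} {g : D.Gam k → ℝ} (h : D.IsCr k r g) (c : ℝ) :
    D.crNorm k r (c • g) = ‖c‖ₑ * D.crNorm k r g := by
  rw [crNorm_of_isCr h, crNorm_of_isCr (h.const_smul c), Finset.mul_sum]
  refine Finset.sum_congr rfl fun j hj => ?_
  rw [iterate_derivGam_smul (Nat.lt_succ_iff.1 (Finset.mem_range.1 hj)) h, ENNReal.mul_iSup]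
  simp [enorm_mul]

theorem crNorm_succ {k r : ℕ} {g : D.Gam k → ℝ} (h : D.IsCr k (r + 1) g) :
    D.crNorm k (r + 1) g = (⨆ p, ‖g p‖ₑ) + D.crNorm k r (D.derivGam k g) := by
  rw [crNorm_of_isCr h, crNorm_of_isCr (isCr_succ_iff.1 h).2.2, Finset.sum_range_succ', add_comm]
  rfl

theorem enorm_le_crNorm {k r : ℕ} (g : D.Gam k → ℝ) (p : D.Gam k) : ‖g p‖ₑ ≤ D.crNorm k r g := by
  by_cases h : D.IsCr k r g
  · rw [crNorm_of_isCr h, Finset.sum_range_succ']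
    exact le_add_left (le_iSup (fun p => ‖g p‖ₑ) p)
  · rw [crNorm, if_neg h]
    exact le_top

/-! ### The oscillation of a function on the graph -/

section Flow

variable (hmin : D.B.StronglyMinimal) (hprop : D.B.ProperlyOrdered)

include hmin hprop

/-- One edge of a deep level runs through every edge of level `k`, so a single orbit covers `Γ^k`.
-/
theorem preconnectedSpace_gam (k : ℕ) : PreconnectedSpace (D.Gam k) := by
  obtain ⟨n, hn⟩ := hmin k
  let w : D.B.V (k + n) := Classical.arbitrary _
  have hw := D.ht_pos (k + n) w
  obtain ⟨z, hz⟩ := D.proj_surjective (k + n) (D.pnt (k + n) w (D.ht (k + n) w / 2))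
  have hcont : Continuous fun s => D.proj k (D.flow s z) :=
    (D.continuous_proj k).comp ((continuous_flow hmin hprop).comp (Continuous.prodMk_left z))
  refine DenseRange.preconnectedSpace (f := fun s => D.proj k (D.flow s z))
    (Function.Surjective.denseRange fun x => ?_) hcont
  obtain ⟨v, a, ha0, ha1, rfl⟩ := D.exists_pnt x
  obtain ⟨p, -⟩ := hn v w
  obtain ⟨c, hc0, hc1, hc⟩ := p.exists_offset
  refine ⟨c + a - D.ht (k + n) w / 2, hc _ a ha0 ha1 ?_⟩
  rw [proj_flow_of_interior hmin hprop hz (by linarith) (by linarith) (by linarith) (by linarith),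
    add_sub_cancel]

/-- By connectedness the interval from `g x` to `g y` is covered by the images of the edges, each of
Lebesgue measure at most `M` times its length. No path between `x` and `y` has to be chosen. -/
theorem sub_le_of_derivGam {k : ℕ} {g g' : D.Gam k → ℝ} (hg : Continuous g)
    (h : D.IsDerivGam k g g') {M : ℝ} (hM0 : 0 ≤ M) (hM : ∀ p, |g' p| ≤ M) (x y : D.Gam k) :
    g y - g x ≤ M * ∑ v, D.len k v := by
  have := preconnectedSpace_gam hmin hprop k
  have h1 : Icc (g x) (g y) ⊆ range g :=
    (isPreconnected_range hg).Icc_subset ⟨x, rfl⟩ ⟨y, rfl⟩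
  have h2 : range g ⊆ ⋃ v, (fun t => g (D.pt k v t)) '' Icc 0 (D.len k v) := by
    rintro _ ⟨p, rfl⟩
    obtain ⟨v, t, ht, rfl⟩ := exists_pt p
    exact mem_iUnion.2 ⟨v, t, ht, rfl⟩
  have h3 : ∀ v, volume ((fun t => g (D.pt k v t)) '' Icc 0 (D.len k v)) ≤
      ENNReal.ofReal (M * D.len k v) := by
    intro v
    refine (Real.volume_le_diam _).trans (Metric.ediam_le ?_)
    rintro _ ⟨s, hs, rfl⟩ _ ⟨t, ht, rfl⟩
    rw [edist_dist, Real.dist_eq]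
    refine ENNReal.ofReal_le_ofReal ?_
    have := (convex_Icc 0 (D.len k v)).norm_image_sub_le_of_norm_hasDerivWithin_le
      (f := fun t => g (D.pt k v t)) (fun t ht => h v t ht) (fun t _ => hM _) ht hs
    refine this.trans (mul_le_mul_of_nonneg_left ?_ hM0)
    rw [Real.norm_eq_abs, abs_le]
    constructor <;> linarith [hs.1, hs.2, ht.1, ht.2]
  have h4 : ENNReal.ofReal (g y - g x) ≤ ENNReal.ofReal (M * ∑ v, D.len k v) := by
    rw [← Real.volume_Icc]
    refine (measure_mono (h1.trans h2)).trans ((measure_iUnion_fintype_le _ _).trans ?_)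
    rw [Finset.mul_sum, ENNReal.ofReal_sum_of_nonneg fun v _ => mul_nonneg hM0 (D.len_nonneg k v)]
    exact Finset.sum_le_sum fun v _ => h3 v
  exact (ENNReal.ofReal_le_ofReal_iff
    (mul_nonneg hM0 (Finset.sum_nonneg fun v _ => D.len_nonneg k v))).1 h4

/-- The derivative along the flow of a function on `Γ^k`. -/
theorem IsDerivGam.hasDerivAt_flow {k : ℕ} {g g' : D.Gam k → ℝ} (h : D.IsDerivGam k g g')
    (z : D.Om) : HasDerivAt (fun s => g (D.proj k (D.flow s z)))
      ((D.lam ^ k)⁻¹ * g' (D.proj k z)) 0 := by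
  have hl := D.lam_pow_pos k
  have hpnt : ∀ v a, 0 ≤ a → a ≤ D.ht k v → HasDerivWithinAt (fun s => g (D.pnt k v s))
      ((D.lam ^ k)⁻¹ * g' (D.pnt k v a)) (Icc 0 (D.ht k v)) a := by
    intro v a h0 h1
    have hmaps : MapsTo (fun s => s / D.lam ^ k) (Icc 0 (D.ht k v)) (Icc 0 (D.len k v)) := by
      intro s hs
      rw [len_eq]
      exact ⟨div_nonneg hs.1 hl.le, div_le_div_of_nonneg_right hs.2 hl.le⟩
    have h2 := (h v (a / D.lam ^ k) (hmaps ⟨h0, h1⟩)).scomp a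
      ((hasDerivAt_id a).div_const (D.lam ^ k)).hasDerivWithinAt hmaps
    simp only [smul_eq_mul, one_div, Function.comp_def] at h2
    exact h2
  have hz0 := flow_zero hmin hprop z
  obtain ⟨v, a, ha0, ha1, hv, hv'⟩ := exists_start hmin hprop k z
  obtain ⟨w, b, hb0, hb1, hw, hw'⟩ := exists_end hmin hprop k z
  have hright : HasDerivWithinAt (fun s => g (D.proj k (D.flow s z)))
      ((D.lam ^ k)⁻¹ * g' (D.proj k z)) (Ici 0) 0 := by
    have h1 := hpnt v a ha0 ha1.le
    rw [← hv] at h1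
    have hmaps : MapsTo (fun s => a + s) (Icc 0 (D.ht k v - a)) (Icc 0 (D.ht k v)) :=
      fun s hs => ⟨by linarith [hs.1], by linarith [hs.2]⟩
    have h2 : HasDerivWithinAt (fun s => g (D.pnt k v (a + s)))
        ((D.lam ^ k)⁻¹ * g' (D.proj k z)) (Icc 0 (D.ht k v - a)) 0 := by
      have := HasDerivWithinAt.scomp (h := fun s => a + s) (h' := 1) 0 (by rwa [add_zero])
        ((hasDerivAt_id (0 : ℝ)).const_add a).hasDerivWithinAt hmaps
      simpa only [one_smul, Function.comp_def] using this
    refine (h2.congr (fun s hs => ?_) ?_).mono_of_mem_nhdsWithin (Icc_mem_nhdsGE (by linarith))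
    · rw [hv' s hs.1 hs.2]
    · rw [hv' 0 le_rfl (by linarith)]
  have hleft : HasDerivWithinAt (fun s => g (D.proj k (D.flow s z)))
      ((D.lam ^ k)⁻¹ * g' (D.proj k z)) (Iic 0) 0 := by
    have h1 := hpnt w b hb0.le hb1
    rw [← hw] at h1
    have hmaps : MapsTo (fun s => b + s) (Icc (-b) 0) (Icc 0 (D.ht k w)) :=
      fun s hs => ⟨by linarith [hs.1], by linarith [hs.2]⟩
    have h2 : HasDerivWithinAt (fun s => g (D.pnt k w (b + s)))
        ((D.lam ^ k)⁻¹ * g' (D.proj k z)) (Icc (-b) 0) 0 := by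
      have := HasDerivWithinAt.scomp (h := fun s => b + s) (h' := 1) 0 (by rwa [add_zero])
        ((hasDerivAt_id (0 : ℝ)).const_add b).hasDerivWithinAt hmaps
      simpa only [one_smul, Function.comp_def] using this
    refine (h2.congr (fun s hs => ?_) ?_).mono_of_mem_nhdsWithin (Icc_mem_nhdsLE (by linarith))
    · have := hw' (-s) (by linarith [hs.2]) (by linarith [hs.1])
      rw [neg_neg, sub_neg_eq_add] at this
      rw [this]
    · have := hw' 0 le_rfl hb0.le
      rw [neg_zero, sub_zero] at this
      rw [this, add_zero]
  have := hleft.union hright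
  rwa [Iic_union_Ici, hasDerivWithinAt_univ] at this

end Flow

/-! ### The total length of the graphs -/

/-- Half of the exponent `ε log λ` is spent on the number of vertices, half on the deviation of the
norm of `A_k ⋯ A_1 l` from `λ^k`. The finitely many levels before the asymptotics set in are
absorbed into the constant. -/
theorem exists_sum_len_le (hsub : D.B.SubexpVertices) (hKF : D.B.KFRegular D.lam) {ε : ℝ}
    (hε : 0 < ε) : ∃ C : ℝ, 0 ≤ C ∧ ∀ k : ℕ, ∑ v, D.len k v ≤ C * D.lam ^ (ε * k) := by
  have hl := D.one_lt_lam
  have hl0 : 0 < D.lam := by linarith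
  have hlog := Real.log_pos hl
  have hδ : 0 < ε * Real.log D.lam / 2 := by positivity
  set δ := ε * Real.log D.lam / 2
  obtain ⟨K, hK⟩ := hsub δ hδ
  have hK0 : 0 ≤ K := by
    have := (Nat.cast_nonneg _).trans (hK 0)
    simpa using this
  have hev := (hKF D.l D.l_pos).eventually_le_const (by linarith : Real.log D.lam < Real.log D.lam + δ)
  obtain ⟨N, hN⟩ := eventually_atTop.1 hev
  have hbig : ∀ k, N ≤ k → 0 < k → ∑ v, D.len k v ≤ K * D.lam ^ (ε * k) := by
    intro k hk hk0
    have hk0' : (0 : ℝ) < k := by exact_mod_cast hk0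
    set A := ‖(D.B.cocycle k).mulVec D.l‖ with hA
    have hApos : 0 < A := by
      refine norm_pos_iff.2 fun h => ?_
      have h1 := D.ht_pos k (Classical.arbitrary _)
      rw [ht, h] at h1
      exact lt_irrefl _ h1
    have h1 := hN k hk
    rw [div_le_iff₀ hk0'] at h1
    have h2 : A ≤ D.lam ^ k * Real.exp (δ * k) := by
      rw [← Real.exp_log hApos, ← Real.exp_log (D.lam_pow_pos k), ← Real.exp_add, Real.log_pow]
      exact Real.exp_le_exp.2 (by linarith)
    have h3 : ∀ v, D.len k v ≤ Real.exp (δ * k) := by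
      intro v
      rw [len_eq, div_le_iff₀ (D.lam_pow_pos k)]
      have := norm_le_pi_norm ((D.B.cocycle k).mulVec D.l) v
      rw [Real.norm_eq_abs] at this
      have h4 := le_abs_self (D.ht k v)
      rw [ht] at h4 ⊢
      linarith
    refine (Finset.sum_le_sum fun v _ => h3 v).trans ?_
    rw [Finset.sum_const, nsmul_eq_mul, Finset.card_univ]
    refine (mul_le_mul_of_nonneg_right (hK k) (Real.exp_pos _).le).trans (le_of_eq ?_)
    rw [mul_assoc, ← Real.exp_add, Real.rpow_def_of_pos hl0]
    congr 2
    ring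
  refine ⟨K + ∑ k ∈ Finset.range (N + 1), ∑ v, D.len k v, ?_, fun k => ?_⟩
  · exact add_nonneg hK0 (Finset.sum_nonneg fun k _ => Finset.sum_nonneg fun v _ => D.len_nonneg k v)
  have hpow : 1 ≤ D.lam ^ (ε * k) := Real.one_le_rpow hl.le (by positivity)
  by_cases hk : k < N + 1
  · have h1 := Finset.single_le_sum (f := fun k => ∑ v, D.len k v)
      (fun k _ => Finset.sum_nonneg fun v _ => D.len_nonneg k v) (Finset.mem_range.2 hk)
    refine le_trans (by linarith) (le_mul_of_one_le_right (add_nonneg hK0 (Finset.sum_nonneg fun k _ =>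
      Finset.sum_nonneg fun v _ => D.len_nonneg k v)) hpow)
  · refine (hbig k (by omega) (by omega)).trans (mul_le_mul_of_nonneg_right ?_ (by linarith))
    exact le_add_of_nonneg_right (Finset.sum_nonneg fun k _ =>
      Finset.sum_nonneg fun v _ => D.len_nonneg k v)

end SolenoidDatum

/-! ### Martingale differences and their derivatives along the flow. -/

namespace SolenoidDatum

variable {D : SolenoidDatum}

theorem push_comp_proj (k : ℕ) (g : D.Gam k → ℝ) : D.push k (g ∘ D.proj k) = g := by
  funext x
  obtain ⟨z, rfl⟩ := D.proj_surjective k x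
  exact Function.FactorsThrough.extend_apply (fun y y' h => congrArg g h) 0 z

theorem delta_congr (μ : Measure D.Om) {k : ℕ} (f : D.Om → ℝ) {y z : D.Om}
    (h : D.proj k y = D.proj k z) : D.delta μ k f y = D.delta μ k f z := by
  cases k with
  | zero => exact Pik_congr μ f h
  | succ k =>
    rw [delta, delta, Pik_congr μ f h, Pik_congr μ f (D.proj_eq_of_le (Nat.le_succ k) h)]

theorem push_delta_proj (μ : Measure D.Om) (k : ℕ) (f : D.Om → ℝ) (z : D.Om) :
    D.push k (D.delta μ k f) (D.proj k z) = D.delta μ k f z :=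
  Function.FactorsThrough.extend_apply (fun _ _ h => delta_congr μ f h) 0 z

theorem push_eq_of_forall {k : ℕ} {h : D.Om → ℝ} {g : D.Gam k → ℝ}
    (hg : ∀ z, h z = g (D.proj k z)) : D.push k h = g := by
  rw [show h = g ∘ D.proj k from funext hg, push_comp_proj]

theorem sum_delta (μ : Measure D.Om) (k : ℕ) (f : D.Om → ℝ) (z : D.Om) :
    ∑ j ∈ Finset.range (k + 1), D.delta μ j f z = D.Pik μ k f z := by
  induction k with
  | zero => simp [delta]
  | succ k ih => rw [Finset.sum_range_succ, ih, delta]; ring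

section Flow

variable (hmin : D.B.StronglyMinimal) (hprop : D.B.ProperlyOrdered)

/-- The fibres shrink to points. -/
theorem exists_fiber_close {f : D.Om → ℝ} (hf : Continuous f) {η : ℝ} (hη : 0 < η) :
    ∃ K, ∀ k, K ≤ k → ∀ y z, D.proj k y = D.proj k z → |f y - f z| < η := by
  by_contra! hcon
  let S : ℕ → Set (D.Om × D.Om) := fun k => {p | η ≤ |f p.1 - f p.2| ∧ D.proj k p.1 = D.proj k p.2}
  have hcl : ∀ k, IsClosed (S k) := fun k =>
    IsClosed.inter (s₁ := {p : D.Om × D.Om | η ≤ |f p.1 - f p.2|})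
      (isClosed_le continuous_const (by fun_prop))
      (isClosed_eq ((D.continuous_proj k).comp continuous_fst)
        ((D.continuous_proj k).comp continuous_snd))
  obtain ⟨p, hp⟩ := IsCompact.nonempty_iInter_of_sequence_nonempty_isCompact_isClosed S
    (fun k p hp => ⟨hp.1, D.proj_eq_of_le (Nat.le_succ k) hp.2⟩)
    (fun k => by
      obtain ⟨j, hj, y, z, h1, h2⟩ := hcon k
      exact ⟨(y, z), h2, D.proj_eq_of_le hj h1⟩) (hcl 0).isCompact hcl
  rw [mem_iInter] at hp
  have h1 : p.1 = p.2 := Om.ext fun k => (hp k).2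
  have h2 := (hp 0).1
  rw [h1, sub_self, abs_zero] at h2
  linarith

variable {μ : Measure D.Om} [IsProbabilityMeasure μ] (hμ : ∀ t : ℝ, μ.map (D.flow t) = μ)

include hmin hprop hμ

theorem abs_Pik_sub_le {k : ℕ} {f : D.Om → ℝ} (hf : Continuous f) {z : D.Om} {c η : ℝ}
    (h : ∀ y ∈ D.fiber k z, |f y - c| ≤ η) : |D.Pik μ k f z - c| ≤ η := by
  have := isFiniteMeasure_trans hmin hprop hμ k z
  have hpos := trans_real_univ_pos hmin hprop hμ k z
  have hmem : ∀ᵐ y ∂(D.trans μ k z), y ∈ D.fiber k z := (isTransverse_trans hmin hprop hμ k z).2.1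
  have h1 : D.Pik μ k f z - c =
      ((D.trans μ k z).real univ)⁻¹ * ∫ y, (f y - c) ∂(D.trans μ k z) := by
    rw [integral_sub (integrable_of_continuous hf) (integrable_const c), integral_const, mul_sub,
      smul_eq_mul, inv_mul_cancel_left₀ hpos.ne', Pik]
  have h2 := norm_integral_le_of_norm_le_const (f := fun y => f y - c) (hmem.mono h)
  rw [h1, abs_mul, abs_inv, abs_of_pos hpos, inv_mul_le_iff₀ hpos, mul_comm]
  exact h2

theorem Pik_eq_of_fiber {k : ℕ} {f : D.Om → ℝ} {z : D.Om} (h : ∀ y ∈ D.fiber k z, f y = f z) :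
    D.Pik μ k f z = f z := by
  have := isFiniteMeasure_trans hmin hprop hμ k z
  have hpos := trans_real_univ_pos hmin hprop hμ k z
  have hmem : ∀ᵐ y ∂(D.trans μ k z), y ∈ D.fiber k z := (isTransverse_trans hmin hprop hμ k z).2.1
  rw [Pik, integral_congr_ae (hmem.mono h : f =ᵐ[_] fun _ => f z), integral_const, smul_eq_mul,
    inv_mul_cancel_left₀ hpos.ne']

theorem tendsto_Pik {f : D.Om → ℝ} (hf : Continuous f) (z : D.Om) :
    Tendsto (fun k => D.Pik μ k f z) atTop (𝓝 (f z)) := by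
  refine Metric.tendsto_atTop.2 fun η hη => ?_
  obtain ⟨K, hK⟩ := exists_fiber_close hf (half_pos hη)
  refine ⟨K, fun k hk => ?_⟩
  rw [Real.dist_eq]
  refine (abs_Pik_sub_le hmin hprop hμ hf fun y hy => ?_).trans_lt (half_lt_self hη)
  exact (hK k hk y z (D.mem_fiber.1 hy)).le

theorem Pik_sub (k : ℕ) {f g : D.Om → ℝ} (hf : Continuous f) (hg : Continuous g) (z : D.Om) :
    D.Pik μ k (f - g) z = D.Pik μ k f z - D.Pik μ k g z := by
  have := isFiniteMeasure_trans hmin hprop hμ k z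
  rw [Pik, Pik, Pik, ← mul_sub,
    ← integral_sub (integrable_of_continuous hf) (integrable_of_continuous hg)]
  rfl

theorem delta_sub (k : ℕ) {f g : D.Om → ℝ} (hf : Continuous f) (hg : Continuous g) (z : D.Om) :
    D.delta μ k (f - g) z = D.delta μ k f z - D.delta μ k g z := by
  cases k with
  | zero => exact Pik_sub hmin hprop hμ 0 hf hg z
  | succ k =>
    rw [delta, delta, delta, Pik_sub hmin hprop hμ _ hf hg, Pik_sub hmin hprop hμ _ hf hg]
    ring

theorem delta_sub_const (k : ℕ) {f : D.Om → ℝ} (hf : Continuous f) (c : ℝ) (z : D.Om) :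
    D.delta μ k (fun z => f z - c) z = D.delta μ k f z - if k = 0 then c else 0 := by
  have h := delta_sub hmin hprop hμ k hf (continuous_const (y := c)) z
  have hc : ∀ k, D.Pik μ k (fun _ => c) z = c := fun k =>
    Pik_eq_of_fiber hmin hprop hμ (f := fun _ => c) fun _ _ => rfl
  refine h.trans ?_
  congr 1
  cases k with
  | zero => rw [delta, hc, if_pos rfl]
  | succ k => rw [delta, hc, hc, sub_self, if_neg (Nat.succ_ne_zero k)]

theorem normS_le_add (r : ℕ) (α : ℝ) {f g : D.Om → ℝ} (hf : Continuous f) (hg : Continuous g) :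
    D.normS μ r α f ≤ D.normS μ r α (f - g) + D.normS μ r α g := by
  rw [normS, normS, normS, ← ENNReal.tsum_add]
  refine ENNReal.tsum_le_tsum fun k => ?_
  rw [← mul_add]
  refine mul_le_mul_right ?_ _
  convert crNorm_add_le k r _ _ using 2
  refine push_eq_of_forall fun z => ?_
  rw [Pi.add_apply, push_delta_proj, push_delta_proj, delta_sub hmin hprop hμ k hf hg,
    sub_add_cancel]

theorem normS_lt_top_of_mem {r : ℕ} {α : ℝ} {f : D.Om → ℝ} (hf : f ∈ D.S μ r α) :
    D.normS μ r α f < ⊤ := by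
  obtain ⟨g, ⟨k, g', hg', rfl⟩, h1, h2⟩ := hf.2 1 one_pos
  have hg : Continuous (g' ∘ D.proj k) := (hg' 0).continuous.comp (D.continuous_proj k)
  exact (normS_le_add hmin hprop hμ r α hf.1 hg).trans_lt
    (ENNReal.add_lt_top.2 ⟨h2.trans ENNReal.one_lt_top, h1⟩)

omit [IsProbabilityMeasure μ] hμ in
/-- Differentiation of an integral along the flow. -/
theorem hasDerivAt_integral_flow {ν : Measure D.Om} [IsFiniteMeasure ν] {F F' : D.Om → ℝ}
    (hF : Continuous F) (hF' : Continuous F')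
    (h : ∀ z, HasDerivAt (fun s => F (D.flow s z)) (F' z) 0) :
    HasDerivAt (fun s => ∫ y, F (D.flow s y) ∂ν) (∫ y, F' y ∂ν) 0 := by
  obtain ⟨C, hC⟩ := isCompact_univ.exists_bound_of_continuousOn hF'.continuousOn
  have hd : ∀ s y, HasDerivAt (fun s => F (D.flow s y)) (F' (D.flow s y)) s := by
    intro s y
    have h1 := h (D.flow s y)
    rw [← sub_self s] at h1
    have := HasDerivAt.comp_sub_const s s h1
    refine this.congr_of_eventuallyEq (Eventually.of_forall fun t => ?_)
    simp only
    rw [← flow_add hmin hprop, add_sub_cancel]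
  have := (hasDerivAt_integral_of_dominated_loc_of_deriv_le (μ := ν) (𝕜 := ℝ) (bound := fun _ => C)
    (F := fun s y => F (D.flow s y)) (F' := fun s y => F' (D.flow s y)) (x₀ := 0)
    (s := univ) univ_mem
    (Eventually.of_forall fun s => (hF.comp (continuous_flow_right hmin hprop s)).aestronglyMeasurable)
    (integrable_of_continuous (hF.comp (continuous_flow_right hmin hprop 0)))
    (hF'.comp (continuous_flow_right hmin hprop 0)).aestronglyMeasurable
    (ae_of_all _ fun y s _ => hC _ (mem_univ _)) (integrable_const C)
    (ae_of_all _ fun y s _ => hd s y)).2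
  simpa only [flow_zero hmin hprop] using this

omit [IsProbabilityMeasure μ] hμ hmin hprop in
theorem IsC1.hasDerivAt {f : D.Om → ℝ} (hf : D.IsC1 f) (z : D.Om) :
    HasDerivAt (fun s => f (D.flow s z)) (D.X f z) 0 := (hf.2.1 z).hasDerivAt

/-- Off the vertices, averaging commutes with differentiation along the flow. -/
theorem hasDerivAt_Pik_of_not_isVertex {f : D.Om → ℝ} (hf : D.IsC1 f) {k : ℕ} {z : D.Om}
    (hz : ¬ D.IsVertex k (D.proj k z)) :
    HasDerivAt (fun s => D.Pik μ k f (D.flow s z)) (D.Pik μ k (D.X f) z) 0 := by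
  obtain ⟨v, a, ha0, ha1, hza⟩ := D.exists_pnt (D.proj k z)
  have ha0 : 0 < a := lt_of_le_of_ne ha0 fun h =>
    hz (D.isVertex_iff.2 ⟨v, Or.inl (by rw [hza, ← h])⟩)
  have ha1 : a < D.ht k v := lt_of_le_of_ne ha1 fun h =>
    hz (D.isVertex_iff.2 ⟨v, Or.inr (by rw [hza, ← h])⟩)
  have := isFiniteMeasure_trans hmin hprop hμ k z
  have h1 := (hasDerivAt_integral_flow hmin hprop (ν := D.trans μ k z) hf.1 hf.2.2
    hf.hasDerivAt).const_mul (((D.trans μ k z).real univ)⁻¹)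
  refine h1.congr_of_eventuallyEq ?_
  filter_upwards [Ioo_mem_nhds (show -a < 0 by linarith) (show 0 < D.ht k v - a by linarith)] with s hs
  have hs0 : 0 < a + s := by linarith [hs.1]
  have hs1 : a + s < D.ht k v := by linarith [hs.2]
  have hzs := proj_flow_of_interior hmin hprop hza ha0 ha1 hs0.le hs1.le
  have hme := measurableEmbedding_flow hmin hprop s
  -- While the orbit stays inside the edge, both measures are images of the one at the beginning of
  -- the edge, so the average becomes an integral of `f ∘ φ_s` against a fixed measure.
  have htr : D.trans μ k (D.flow s z) = (D.trans μ k z).map (D.flow s) := by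
    rw [map_sectionMeasure_edgeStart hmin hprop hμ hs0 hs1 hzs,
      map_sectionMeasure_edgeStart hmin hprop hμ ha0 ha1 hza,
      Measure.map_map hme.measurable (measurable_flow_right hmin hprop a)]
    congr 1
    funext y
    exact flow_add hmin hprop a s y
  rw [Pik, htr, hme.integral_map, map_measureReal_apply hme.measurable MeasurableSet.univ,
    preimage_univ]

theorem hasDerivAt_delta_of_not_isVertex {f : D.Om → ℝ} (hf : D.IsC1 f) {k : ℕ} {z : D.Om}
    (hz : ∀ j, j ≤ k → k ≤ j + 1 → ¬ D.IsVertex j (D.proj j z)) :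
    HasDerivAt (fun s => D.delta μ k f (D.flow s z)) (D.delta μ k (D.X f) z) 0 := by
  cases k with
  | zero => exact hasDerivAt_Pik_of_not_isVertex hmin hprop hμ hf (hz 0 le_rfl (by omega))
  | succ k =>
    exact (hasDerivAt_Pik_of_not_isVertex hmin hprop hμ hf (hz (k + 1) le_rfl (by omega))).sub
      (hasDerivAt_Pik_of_not_isVertex hmin hprop hμ hf (hz k (by omega) le_rfl))

/-! ### Functions of finite norm -/

omit [IsProbabilityMeasure μ] hmin hprop hμ in
theorem summable_crNorm {r : ℕ} {α : ℝ} (hα : 0 ≤ α) {f : D.Om → ℝ} (h : D.normS μ r α f < ⊤) :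
    ∑' k, D.crNorm k r (D.push k (D.delta μ k f)) < ⊤ := by
  refine lt_of_le_of_lt (ENNReal.tsum_le_tsum fun k => ?_) h
  refine le_mul_of_one_le_left' ?_
  rw [ENNReal.one_le_ofReal]
  exact Real.one_le_rpow D.one_lt_lam.le (by positivity)

omit [IsProbabilityMeasure μ] hmin hprop hμ in
theorem isCr_of_normS {r : ℕ} {α : ℝ} (hα : 0 ≤ α) {f : D.Om → ℝ} (h : D.normS μ r α f < ⊤) (k : ℕ) :
    D.IsCr k r (D.push k (D.delta μ k f)) :=
  isCr_of_crNorm_ne_top ((ENNReal.le_tsum k).trans_lt (summable_crNorm hα h)).ne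

omit [IsProbabilityMeasure μ] hmin hprop hμ in
theorem abs_le_crNorm_toReal {k r : ℕ} {g : D.Gam k → ℝ} (h : D.crNorm k r g ≠ ⊤) (p : D.Gam k) :
    |g p| ≤ (D.crNorm k r g).toReal := by
  have := ENNReal.toReal_mono h (enorm_le_crNorm (r := r) g p)
  rwa [toReal_enorm, Real.norm_eq_abs] at this

-- A common summable majorant for the terms and their flow derivatives; it exists because the
-- weights are at least `1` and the speeds `λ^{-k}` at most `1`.
omit [IsProbabilityMeasure μ] hmin hprop hμ in
theorem derivGam_bounds {r : ℕ} {α : ℝ} (hα : 0 ≤ α) {f : D.Om → ℝ} (h : D.normS μ (r + 1) α f < ⊤) :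
    ∃ u : ℕ → ℝ, Summable u ∧ (∀ k p, |D.push k (D.delta μ k f) p| ≤ u k) ∧
      ∀ k p, |(D.lam ^ k)⁻¹ * D.derivGam k (D.push k (D.delta μ k f)) p| ≤ u k := by
  have hs := summable_crNorm hα h
  have hfin : ∀ k, D.crNorm k (r + 1) (D.push k (D.delta μ k f)) ≠ ⊤ := fun k =>
    ((ENNReal.le_tsum k).trans_lt hs).ne
  refine ⟨fun k => (D.crNorm k (r + 1) (D.push k (D.delta μ k f))).toReal,
    ENNReal.summable_toReal hs.ne, fun k p => abs_le_crNorm_toReal (hfin k) p, fun k p => ?_⟩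
  have hle : D.crNorm k r (D.derivGam k (D.push k (D.delta μ k f))) ≤
      D.crNorm k (r + 1) (D.push k (D.delta μ k f)) := by
    rw [crNorm_succ (isCr_of_normS hα h k)]
    exact le_add_self
  have h1 := abs_le_crNorm_toReal (ne_top_of_le_ne_top (hfin k) hle) p
  have h2 := ENNReal.toReal_mono (hfin k) hle
  have h3 : (D.lam ^ k)⁻¹ ≤ 1 := inv_le_one_of_one_le₀ (one_le_pow₀ D.one_lt_lam.le)
  rw [abs_mul, abs_of_nonneg (inv_nonneg.2 (D.lam_pow_pos k).le)]
  exact (mul_le_of_le_one_left (abs_nonneg _) h3).trans (h1.trans h2)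

/-- Since the fibres shrink to points, `f` is the sum of its martingale differences, and the series
may be differentiated term by term. -/
theorem hasDerivAt_of_normS {r : ℕ} {α : ℝ} (hα : 0 ≤ α) {f : D.Om → ℝ} (hf : Continuous f)
    (h : D.normS μ (r + 1) α f < ⊤) :
    ∃ f' : D.Om → ℝ, Continuous f' ∧ ∀ z, HasDerivAt (fun s => f (D.flow s z)) (f' z) 0 := by
  obtain ⟨u, hu, hu1, hu2⟩ := derivGam_bounds hα h
  set g : ∀ k, D.Gam k → ℝ := fun k => D.push k (D.delta μ k f) with hg
  have hcr : ∀ k, D.IsCr k (r + 1) (g k) := isCr_of_normS hα h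
  have hder : ∀ k z, HasDerivAt (fun s => g k (D.proj k (D.flow s z)))
      ((D.lam ^ k)⁻¹ * D.derivGam k (g k) (D.proj k z)) 0 := fun k z =>
    (isCr_succ_iff.1 (hcr k)).2.1.hasDerivAt_flow hmin hprop z
  have hder' : ∀ k z s, HasDerivAt (fun s => g k (D.proj k (D.flow s z)))
      ((D.lam ^ k)⁻¹ * D.derivGam k (g k) (D.proj k (D.flow s z))) s := by
    intro k z s
    have h1 := hder k (D.flow s z)
    rw [← sub_self s] at h1
    have := HasDerivAt.comp_sub_const s s h1
    refine this.congr_of_eventuallyEq (Eventually.of_forall fun t => ?_)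
    simp only
    rw [← flow_add hmin hprop, add_sub_cancel]
  have hsum : ∀ z, f z = ∑' k, g k (D.proj k z) := by
    intro z
    have hs : Summable fun k => g k (D.proj k z) := Summable.of_norm_bounded hu fun k => hu1 k _
    refine tendsto_nhds_unique ((tendsto_Pik hmin hprop hμ hf z)) ?_
    refine ((tendsto_add_atTop_iff_nat 1).2 hs.hasSum.tendsto_sum_nat).congr fun k => ?_
    rw [← sum_delta]
    exact Finset.sum_congr rfl fun j _ => push_delta_proj μ j f z
  refine ⟨fun z => ∑' k, (D.lam ^ k)⁻¹ * D.derivGam k (g k) (D.proj k z), ?_, fun z => ?_⟩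
  · refine continuous_tsum (fun k => ?_) hu fun k z => hu2 k _
    exact continuous_const.mul
      ((isCr_succ_iff.1 (hcr k)).2.2.continuous.comp (D.continuous_proj k))
  · have h1 := hasDerivAt_tsum hu (fun k s => hder' k z s) (fun k s => hu2 k _)
      (y₀ := 0) (Summable.of_norm_bounded hu fun k => hu1 k _) 0
    simp only [flow_zero hmin hprop] at h1
    simpa only [hsum] using h1

theorem isC1_of_normS {r : ℕ} {α : ℝ} (hα : 0 ≤ α) {f : D.Om → ℝ} (hf : Continuous f)
    (h : D.normS μ (r + 1) α f < ⊤) : D.IsC1 f := by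
  obtain ⟨f', h1, h2⟩ := hasDerivAt_of_normS hmin hprop hμ hα hf h
  have hX : D.X f = f' := funext fun z => (h2 z).deriv
  exact ⟨hf, fun z => (h2 z).differentiableAt, by rwa [hX]⟩

omit [IsProbabilityMeasure μ] hμ in
theorem hasDerivAt_delta_of_normS {r : ℕ} {α : ℝ} (hα : 0 ≤ α) {f : D.Om → ℝ}
    (h : D.normS μ (r + 1) α f < ⊤) (k : ℕ) (z : D.Om) :
    HasDerivAt (fun s => D.delta μ k f (D.flow s z))
      ((D.lam ^ k)⁻¹ * D.derivGam k (D.push k (D.delta μ k f)) (D.proj k z)) 0 := by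
  have := (isCr_succ_iff.1 (isCr_of_normS hα h k)).2.1.hasDerivAt_flow hmin hprop z
  simpa only [push_delta_proj] using this

/-- For functions of finite norm, averaging commutes with differentiation at every point. -/
theorem hasDerivAt_Pik_of_normS {r : ℕ} {α : ℝ} (hα : 0 ≤ α) {f : D.Om → ℝ} (hf : Continuous f)
    (h : D.normS μ (r + 1) α f < ⊤) (k : ℕ) (z : D.Om) :
    HasDerivAt (fun s => D.Pik μ k f (D.flow s z)) (D.Pik μ k (D.X f) z) 0 := by
  have hC1 := isC1_of_normS hmin hprop hμ hα hf h
  have := isFiniteMeasure_trans hmin hprop hμ k z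
  have hpos := trans_real_univ_pos hmin hprop hμ k z
  have hcr := isCr_of_normS hα h
  -- `A` is the flow derivative of `Π_k f = ∑_{j ≤ k} δ_j f`. It depends on the `k`-th coordinate
  -- only, so its average over a fibre is its value.
  let A : D.Om → ℝ := fun z => ∑ j ∈ Finset.range (k + 1),
    (D.lam ^ j)⁻¹ * D.derivGam j (D.push j (D.delta μ j f)) (D.proj j z)
  have hAder : ∀ z, HasDerivAt (fun s => D.Pik μ k f (D.flow s z)) (A z) 0 := by
    intro z
    have h1 : HasDerivAt (fun s => ∑ j ∈ Finset.range (k + 1), D.delta μ j f (D.flow s z)) (A z) 0 :=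
      HasDerivAt.fun_sum fun j _ => hasDerivAt_delta_of_normS hmin hprop hα h j z
    simpa only [sum_delta] using h1
  have hAcont : Continuous A := continuous_finsetSum _ fun j _ => continuous_const.mul
    ((isCr_succ_iff.1 (hcr j)).2.2.continuous.comp (D.continuous_proj j))
  have hPcont : Continuous (D.Pik μ k f) := by
    have h1 : D.Pik μ k f = fun z => ∑ j ∈ Finset.range (k + 1),
        D.push j (D.delta μ j f) (D.proj j z) := by
      funext z
      simp only [push_delta_proj, sum_delta]
    rw [h1]
    exact continuous_finsetSum _ fun j _ => (hcr j).continuous.comp (D.continuous_proj j)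
  have hAconst : ∀ y ∈ D.fiber k z, A y = A z := fun y hy =>
    Finset.sum_congr rfl fun j hj => by rw [hy j (Nat.lt_succ_iff.1 (Finset.mem_range.1 hj))]
  have h1 := (hasDerivAt_integral_flow hmin hprop (ν := D.trans μ k z) hPcont hAcont
    hAder).hasDerivWithinAt (s := Ici 0)
  have h2 := (hasDerivAt_integral_flow hmin hprop (ν := D.trans μ k z) hf hC1.2.2
    hC1.hasDerivAt).hasDerivWithinAt (s := Ici 0)
  obtain ⟨d, hd, hds⟩ := exists_integral_Pik_flow hmin hprop hμ k z
  -- The integrals of `Π_k f ∘ φ_s` and `f ∘ φ_s` over the fibre are known to agree only for small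
  -- `s ≥ 0`, hence the comparison of right derivatives.
  have h3 : ∫ y, A y ∂(D.trans μ k z) = ∫ y, D.X f y ∂(D.trans μ k z) := by
    refine (uniqueDiffWithinAt_Ici (0 : ℝ)).eq_deriv _ (h1.congr_of_eventuallyEq ?_ ?_) h2
    · filter_upwards [Ico_mem_nhdsGE hd] with s hs
      exact (hds s hs.1 hs.2 f hf).symm
    · exact (hds 0 le_rfl hd f hf).symm
  have h4 : D.Pik μ k (D.X f) z = A z := by
    rw [← Pik_eq_of_fiber hmin hprop hμ hAconst, Pik, Pik, h3]
  rw [h4]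
  exact hAder z

theorem hasDerivAt_delta_X {r : ℕ} {α : ℝ} (hα : 0 ≤ α) {f : D.Om → ℝ} (hf : Continuous f)
    (h : D.normS μ (r + 1) α f < ⊤) (k : ℕ) (z : D.Om) :
    HasDerivAt (fun s => D.delta μ k f (D.flow s z)) (D.delta μ k (D.X f) z) 0 := by
  cases k with
  | zero => exact hasDerivAt_Pik_of_normS hmin hprop hμ hα hf h 0 z
  | succ k =>
    exact (hasDerivAt_Pik_of_normS hmin hprop hμ hα hf h (k + 1) z).sub
      (hasDerivAt_Pik_of_normS hmin hprop hμ hα hf h k z)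

/-- Two expressions for the derivative of `δ_k f` along the flow are compared; `λ^{-k}` is the speed
on `Γ^k`. Both norm estimates for `X` rest on this identity. -/
theorem push_delta_X {r : ℕ} {α : ℝ} (hα : 0 ≤ α) {f : D.Om → ℝ} (hf : Continuous f)
    (h : D.normS μ (r + 1) α f < ⊤) (k : ℕ) : D.push k (D.delta μ k (D.X f)) =
      (D.lam ^ k)⁻¹ • D.derivGam k (D.push k (D.delta μ k f)) :=
  push_eq_of_forall fun z => (hasDerivAt_delta_X hmin hprop hμ hα hf h k z).unique
    (hasDerivAt_delta_of_normS hmin hprop hα h k z)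

/-- The extra weight `λ^k` cancels the speed `λ^{-k}`, and the `C^r` norm of the derivative is the
`C^{r+1}` norm without its supremum term. -/
theorem normS_X_le {r : ℕ} {α : ℝ} (hα : 0 ≤ α) {f : D.Om → ℝ} (hf : Continuous f)
    (h : D.normS μ (r + 1) α f < ⊤) : D.normS μ r (α + 1) (D.X f) ≤ D.normS μ (r + 1) α f := by
  refine ENNReal.tsum_le_tsum fun k => ?_
  have hcr := isCr_of_normS hα h k
  have hl0 : 0 < D.lam := by linarith [D.one_lt_lam]
  rw [push_delta_X hmin hprop hμ hα hf h k, crNorm_smul (isCr_succ_iff.1 hcr).2.2, ← mul_assoc,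
    Real.enorm_eq_ofReal (inv_nonneg.2 (D.lam_pow_pos k).le),
    ← ENNReal.ofReal_mul (Real.rpow_nonneg hl0.le _)]
  have he : D.lam ^ ((α + 1) * k) * (D.lam ^ k)⁻¹ = D.lam ^ (α * k) := by
    rw [add_mul, one_mul, Real.rpow_add hl0, Real.rpow_natCast,
      mul_inv_cancel_right₀ (D.lam_pow_pos k).ne']
  rw [he, crNorm_succ hcr]
  exact mul_le_mul_right le_add_self _

omit [IsProbabilityMeasure μ] hμ in
theorem X_mem_Ctlc {g : D.Om → ℝ} (hg : g ∈ D.Ctlc) : D.X g ∈ D.Ctlc := by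
  obtain ⟨k, g, hg, rfl⟩ := hg
  refine ⟨k, (D.lam ^ k)⁻¹ • D.derivGam k g,
    fun r => (isCr_succ_iff.1 (hg (r + 1))).2.2.const_smul _, funext fun z => ?_⟩
  exact ((isCr_succ_iff.1 (hg 1)).2.1.hasDerivAt_flow hmin hprop z).deriv

theorem X_mem_S {r : ℕ} {α : ℝ} (hα : 0 ≤ α) {f : D.Om → ℝ} (hf : f ∈ D.S μ (r + 1) α) :
    D.X f ∈ D.S μ r (α + 1) := by
  have hfC := isC1_of_normS hmin hprop hμ hα hf.1 (normS_lt_top_of_mem hmin hprop hμ hf)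
  refine ⟨hfC.2.2, fun η hη => ?_⟩
  obtain ⟨g, hg, h1, h2⟩ := hf.2 η hη
  have hgc : Continuous g := by
    obtain ⟨k, g, hg, rfl⟩ := hg
    exact (hg 0).continuous.comp (D.continuous_proj k)
  have hgC := isC1_of_normS hmin hprop hμ hα hgc h1
  have hX : D.X f - D.X g = D.X (f - g) :=
    funext fun z => ((hfC.hasDerivAt z).sub (hgC.hasDerivAt z)).deriv.symm
  refine ⟨D.X g, X_mem_Ctlc hmin hprop hg,
    (normS_X_le hmin hprop hμ hα hgc h1).trans_lt h1, ?_⟩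
  rw [hX]
  exact (normS_X_le hmin hprop hμ hα (hf.1.sub hgc) (h2.trans_le le_top)).trans_lt h2

/-! ### The inverse of the derivation -/

omit [IsProbabilityMeasure μ] hμ hmin hprop in
theorem exists_nonpos_of_integral_eq_zero {ν : Measure D.Om} [IsFiniteMeasure ν] (hν : ν ≠ 0)
    {g : D.Om → ℝ} (hg : Continuous g) (h : ∫ y, g y ∂ν = 0) : ∃ y, g y ≤ 0 := by
  by_contra! hcon
  have h1 := (integral_pos_iff_support_of_nonneg (fun y => (hcon y).le)
    (integrable_of_continuous (ν := ν) hg)).2 (by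
      rw [show Function.support g = univ from eq_univ_of_forall fun y => (hcon y).ne']
      exact pos_iff_ne_zero.2 fun h => hν (Measure.measure_univ_eq_zero.1 h))
  exact h1.ne' h

/-- The martingale differences of a function of mean zero have mean zero in a suitable sense. -/
theorem exists_integral_delta_eq_zero {f : D.Om → ℝ} (hf : Continuous f)
    (hcont : ∀ k, Continuous (D.delta μ k f)) (k : ℕ) :
    ∃ ν : Measure D.Om, IsFiniteMeasure ν ∧ ν ≠ 0 ∧
      ∫ y, D.delta μ k (fun z => f z - ∫ y, f y ∂μ) y ∂ν = 0 := by
  simp only [delta_sub_const hmin hprop hμ _ hf]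
  have hPcont : ∀ k, Continuous (D.Pik μ k f) := fun k => by
    have h1 : D.Pik μ k f = fun z => ∑ j ∈ Finset.range (k + 1), D.delta μ j f z :=
      funext fun z => (sum_delta μ k f z).symm
    rw [h1]
    exact continuous_finsetSum _ fun j _ => hcont j
  cases k with
  | zero =>
    -- At level `0` the measure is `μ` itself: `f` and `Π_0 f` have the same integral, as they have
    -- over every fibre.
    refine ⟨μ, inferInstance, IsProbabilityMeasure.ne_zero μ, ?_⟩
    have h1 : ∫ z, (f - D.Pik μ 0 f) z ∂μ = 0 := by
      refine integral_eq_zero_of_trans hmin hprop hμ 0 (hf.sub (hPcont 0)) fun z => ?_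
      have hpos := trans_real_univ_pos hmin hprop hμ 0 z
      have h2 := Pik_sub hmin hprop hμ 0 hf (hPcont 0) z
      rw [Pik_eq_of_fiber hmin hprop hμ (f := D.Pik μ 0 f)
        fun y hy => Pik_congr μ f (D.mem_fiber.1 hy), sub_self, Pik] at h2
      exact (mul_eq_zero.1 h2).resolve_left (inv_ne_zero hpos.ne')
    simp only [Pi.sub_apply] at h1
    rw [integral_sub (integrable_of_continuous hf) (integrable_of_continuous (hPcont 0))] at h1
    simp only [delta, if_true]
    rw [integral_sub (integrable_of_continuous (hPcont 0)) (integrable_const _), integral_const]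
    simp only [probReal_univ, one_smul]
    linarith
  | succ k =>
    obtain ⟨z, -⟩ := D.proj_surjective k (D.pnt k (Classical.arbitrary _) 0)
    have hpos := trans_real_univ_pos hmin hprop hμ k z
    -- For `δ_{k+1}` any fibre of level `k` serves, by the tower property.
    refine ⟨D.trans μ k z, isFiniteMeasure_trans hmin hprop hμ k z,
      trans_ne_zero hmin hprop hμ k z, ?_⟩
    have h2 := Pik_sub hmin hprop hμ k (hPcont (k + 1)) (hPcont k) z
    rw [Pik_eq_of_fiber hmin hprop hμ (f := D.Pik μ k f)
      fun y hy => Pik_congr μ f (D.mem_fiber.1 hy), Pik_Pik_succ hmin hprop hμ k hf, sub_self,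
      Pik] at h2
    simpa [delta, hpos.ne'] using h2

/-- The `C^r` norm is bounded by the `C^{r+1}` norm, that is, by a supremum plus the norm of the
derivative. The derivative is `λ^k` times `δ_k X f`, which accounts for the summand `1`; the
supremum is an oscillation over `Γ^k`, which accounts for the total length. -/
theorem crNorm_delta_sub_integral_le {r : ℕ} {α : ℝ} (hα : 0 ≤ α) {f : D.Om → ℝ}
    (hf : Continuous f) (h : D.normS μ (r + 1) α f < ⊤) (k : ℕ) :
    D.crNorm k r (D.push k (D.delta μ k fun z => f z - ∫ y, f y ∂μ)) ≤
      ENNReal.ofReal (D.lam ^ k * (∑ v, D.len k v + 1)) *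
        D.crNorm k r (D.push k (D.delta μ k (D.X f))) := by
  have hl := D.lam_pow_pos k
  have hL : 0 ≤ ∑ v, D.len k v := Finset.sum_nonneg fun v _ => D.len_nonneg k v
  have hcr := isCr_of_normS hα h
  have hcont : ∀ k, Continuous (D.delta μ k f) := fun k => by
    rw [show D.delta μ k f = fun z => D.push k (D.delta μ k f) (D.proj k z) from
      funext fun z => (push_delta_proj μ k f z).symm]
    exact (hcr k).continuous.comp (D.continuous_proj k)
  obtain ⟨-, hder, hcr'⟩ := isCr_succ_iff.1 (hcr k)
  set g := D.push k (D.delta μ k f) with hg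
  set c : ℝ := if k = 0 then ∫ y, f y ∂μ else 0
  have hpush : D.push k (D.delta μ k fun z => f z - ∫ y, f y ∂μ) = fun p => g p - c :=
    push_eq_of_forall fun z => by rw [delta_sub_const hmin hprop hμ k hf, ← push_delta_proj μ k f z]
  have hXeq : D.derivGam k g = D.lam ^ k • D.push k (D.delta μ k (D.X f)) := by
    rw [push_delta_X hmin hprop hμ hα hf h k, smul_smul, mul_inv_cancel₀ hl.ne', one_smul]
  have hXcr : D.IsCr k r (D.push k (D.delta μ k (D.X f))) := by
    rw [push_delta_X hmin hprop hμ hα hf h k]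
    exact hcr'.const_smul _
  set q := D.push k (D.delta μ k (D.X f)) with hq
  have hgc : D.IsCr k (r + 1) (fun p => g p - c) := (hcr k).sub_const c
  have hN := crNorm_succ hgc
  have hle : D.crNorm k r (fun p => g p - c) ≤ D.crNorm k (r + 1) (fun p => g p - c) := by
    rw [crNorm_of_isCr hgc, crNorm_of_isCr hgc.of_succ]
    exact Finset.sum_le_sum_of_subset (Finset.range_mono (by omega))
  rw [hpush]
  refine hle.trans ?_
  rw [hN, (hder.sub_const c).derivGam_eq, hXeq, crNorm_smul hXcr, Real.enorm_eq_ofReal hl.le,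
    mul_add, mul_one, ENNReal.ofReal_add (mul_nonneg hl.le hL) hl.le, add_mul]
  refine add_le_add (iSup_le fun p => ?_) le_rfl
  by_cases hfin : D.crNorm k r q = ⊤
  · exfalso
    rw [hXeq] at hcr'
    have hs := (ENNReal.le_tsum k).trans_lt (summable_crNorm hα h)
    rw [← hg, crNorm_succ (hcr k), hXeq, crNorm_smul hXcr, hfin,
      ENNReal.mul_top (by simpa using hl.ne')] at hs
    simp at hs
  set M := (D.crNorm k r q).toReal
  have hM0 : 0 ≤ M := ENNReal.toReal_nonneg
  have hbd : ∀ p, |D.derivGam k g p| ≤ D.lam ^ k * M := by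
    intro p
    rw [hXeq, Pi.smul_apply, smul_eq_mul, abs_mul, abs_of_pos hl]
    exact mul_le_mul_of_nonneg_left (abs_le_crNorm_toReal hfin p) hl.le
  obtain ⟨ν, hν, hν0, hint⟩ := exists_integral_delta_eq_zero hmin hprop hμ hf hcont k
  have hδ : ∀ z, D.delta μ k (fun z => f z - ∫ y, f y ∂μ) z = g (D.proj k z) - c := fun z => by
    rw [delta_sub_const hmin hprop hμ k hf, ← push_delta_proj μ k f z]
  simp only [hδ] at hint
  have hcontg : Continuous fun z => g (D.proj k z) - c :=
    ((hcr k).continuous.comp (D.continuous_proj k)).sub continuous_const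
  -- The function `g - c` is nonpositive at `y` and nonnegative at `y'`, so the oscillation bound
  -- controls it from above and below.
  obtain ⟨y, hy⟩ := exists_nonpos_of_integral_eq_zero hν0 hcontg hint
  obtain ⟨y', hy'⟩ := exists_nonpos_of_integral_eq_zero hν0 hcontg.neg (by
    simp only [Pi.neg_apply]
    rw [integral_neg, hint, neg_zero])
  rw [Pi.neg_apply] at hy'
  have h1 := sub_le_of_derivGam hmin hprop (hcr k).continuous hder (mul_nonneg hl.le hM0) hbd
    (D.proj k y) p
  have h2 := sub_le_of_derivGam hmin hprop (hcr k).continuous hder (mul_nonneg hl.le hM0) hbd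
    p (D.proj k y')
  rw [Real.enorm_eq_ofReal_abs, ← ENNReal.ofReal_toReal hfin,
    ← ENNReal.ofReal_mul (mul_nonneg hl.le hL)]
  rw [← hg] at h1 h2
  have hcomm : D.lam ^ k * M * ∑ v, D.len k v = (D.lam ^ k * ∑ v, D.len k v) * M := by ring
  refine ENNReal.ofReal_le_ofReal (abs_le.2 ⟨?_, ?_⟩) <;> linarith

theorem exists_normS_le (hsub : D.B.SubexpVertices) (hKF : D.B.KFRegular D.lam) {ε : ℝ}
    (hε : 0 < ε) : ∃ C : ℝ≥0, ∀ (α : ℝ), 1 < α → ∀ (r : ℕ), ∀ f : D.Om → ℝ, Continuous f →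
      D.normS μ (r + 1) α f < ⊤ → D.normS μ r α (fun z => f z - ∫ y, f y ∂μ) ≤
        (C : ℝ≥0∞) * D.normS μ r (α + 1 + ε) (D.X f) := by
  obtain ⟨C, hC0, hC⟩ := exists_sum_len_le hsub hKF hε
  have hl0 : 0 < D.lam := by linarith [D.one_lt_lam]
  -- The added `1` absorbs the summand `1` next to the total length, as `λ^{εk} ≥ 1`. Neither `α`
  -- nor `r` enters the constant.
  refine ⟨Real.toNNReal (C + 1), fun α hα r f hf h => ?_⟩
  rw [normS, normS, ← ENNReal.tsum_mul_left]
  refine ENNReal.tsum_le_tsum fun k => ?_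
  refine (mul_le_mul_right (crNorm_delta_sub_integral_le hmin hprop hμ (by linarith) hf h k) _).trans ?_
  rw [← mul_assoc, ← mul_assoc, ← ENNReal.ofReal_mul (Real.rpow_nonneg hl0.le _)]
  refine mul_le_mul_left ?_ _
  rw [show ((Real.toNNReal (C + 1) : ℝ≥0) : ℝ≥0∞) = ENNReal.ofReal (C + 1) from rfl,
    ← ENNReal.ofReal_mul (by linarith)]
  refine ENNReal.ofReal_le_ofReal ?_
  have hpow : 1 ≤ D.lam ^ (ε * k) := Real.one_le_rpow D.one_lt_lam.le (by positivity)
  have he : D.lam ^ ((α + 1 + ε) * k) = D.lam ^ (α * k) * D.lam ^ k * D.lam ^ (ε * k) := by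
    rw [add_mul, add_mul, one_mul, Real.rpow_add hl0, Real.rpow_add hl0, Real.rpow_natCast]
  rw [he]
  have h1 := hC k
  have h2 : 0 < D.lam ^ (α * k) * D.lam ^ k := mul_pos (Real.rpow_pos_of_pos hl0 _) (D.lam_pow_pos k)
  calc D.lam ^ (α * k) * (D.lam ^ k * (∑ v, D.len k v + 1))
      = D.lam ^ (α * k) * D.lam ^ k * (∑ v, D.len k v + 1) := by ring
    _ ≤ D.lam ^ (α * k) * D.lam ^ k * ((C + 1) * D.lam ^ (ε * k)) :=
        mul_le_mul_of_nonneg_left (by linarith) h2.le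
    _ = (C + 1) * (D.lam ^ (α * k) * D.lam ^ k * D.lam ^ (ε * k)) := by ring

end Flow

theorem normR_le_normS (μ : Measure D.Om) (r : ℕ) {α ε : ℝ} (hε : 0 < ε) (f : D.Om → ℝ) :
    D.normR μ r α ε f ≤ D.normS μ r α f := by
  refine iSup_le fun k => le_trans (mul_le_mul_left (ENNReal.ofReal_le_ofReal
    (Real.rpow_le_rpow_of_exponent_le D.one_lt_lam.le ?_)) _) (ENNReal.le_tsum k)
  rw [mul_comm]
  exact mul_le_mul_of_nonneg_right (by linarith) (Nat.cast_nonneg k)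

end SolenoidDatum

/-! ### Assembly of the four assertions. -/

theorem mainTheorem7 (D : SolenoidDatum) (hmin : D.B.StronglyMinimal)
    (hprop : D.B.ProperlyOrdered) (hsub : D.B.SubexpVertices) (hKF : D.B.KFRegular D.lam)
    (μ : Measure D.Om) [IsProbabilityMeasure μ] (hμ : ∀ t : ℝ, μ.map (D.flow t) = μ) :
    -- (i) `[X, δ_k] = 0` on `C¹`, off the null set of the points over vertices
    ((∀ k, μ {z | D.IsVertex k (D.proj k z)} = 0) ∧
      ∀ f, D.IsC1 f → ∀ (k : ℕ) (z : D.Om),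
        (∀ j, j ≤ k → k ≤ j + 1 → ¬ D.IsVertex j (D.proj j z)) →
        HasDerivAt (fun s => D.delta μ k f (D.flow s z)) (D.delta μ k (D.X f) z) 0) ∧
    -- (i) `[X, δ_k] = 0` at every point for the functions in the spaces `S`
    (∀ (r : ℕ) (α : ℝ), 1 < α → ∀ f ∈ D.S μ (r + 1) α, ∀ (k : ℕ) (z : D.Om),
      HasDerivAt (fun s => D.delta μ k f (D.flow s z)) (D.delta μ k (D.X f) z) 0) ∧
    -- (ii)
    (∀ (r : ℕ) (α : ℝ), 1 < α → ∀ f ∈ D.S μ (r + 1) α,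
      D.IsC1 f ∧ D.X f ∈ D.S μ r (α + 1) ∧
        D.normS μ r (α + 1) (D.X f) ≤ D.normS μ (r + 1) α f) ∧
    -- (iii)
    (∀ ε : ℝ, 0 < ε → ∃ C : ℝ≥0, ∀ (α : ℝ), 1 < α → ∀ (r : ℕ), ∀ f ∈ D.S μ (r + 1) α,
      D.normS μ r α (fun z => f z - ∫ y, f y ∂μ) ≤
        (C : ℝ≥0∞) * D.normS μ r (α + 1 + ε) (D.X f)) ∧
    -- (iv)
    (∀ (r : ℕ) (α : ℝ), 1 < α → ∀ ε : ℝ, 0 < ε → ε < α →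
      D.S μ r α ⊆ D.R μ r α ε ∧
      (∀ f ∈ D.S μ r α, D.normR μ r α ε f ≤ D.normS μ r α f) ∧
      (∀ f ∈ D.S μ r α, ∀ g ∈ D.S μ r α,
        D.normR μ r α ε (f - g) ≤ D.normS μ r α (f - g))) := by
  refine ⟨⟨SolenoidDatum.measure_vertices hmin hprop hμ, fun f hf k z hz =>
    SolenoidDatum.hasDerivAt_delta_of_not_isVertex hmin hprop hμ hf hz⟩, ?_, ?_, ?_, ?_⟩
  · exact fun r α hα f hf k z => SolenoidDatum.hasDerivAt_delta_X hmin hprop hμ (by linarith) hf.1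
      (SolenoidDatum.normS_lt_top_of_mem hmin hprop hμ hf) k z
  · intro r α hα f hf
    have hnorm := SolenoidDatum.normS_lt_top_of_mem hmin hprop hμ hf
    have hα0 : 0 ≤ α := by linarith
    exact ⟨SolenoidDatum.isC1_of_normS hmin hprop hμ hα0 hf.1 hnorm,
      SolenoidDatum.X_mem_S hmin hprop hμ hα0 hf,
      SolenoidDatum.normS_X_le hmin hprop hμ hα0 hf.1 hnorm⟩
  · intro ε hε
    obtain ⟨C, hC⟩ := SolenoidDatum.exists_normS_le hmin hprop hμ hsub hKF hε
    exact ⟨C, fun α hα r f hf =>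
      hC α hα r f hf.1 (SolenoidDatum.normS_lt_top_of_mem hmin hprop hμ hf)⟩
  · refine fun r α _ ε hε _ => ⟨fun f hf => ⟨hf.1, fun η hη => ?_⟩,
      fun f _ => SolenoidDatum.normR_le_normS μ r hε f,
      fun f _ g _ => SolenoidDatum.normR_le_normS μ r hε (f - g)⟩
    -- The approximants for the stronger norm also serve for the weaker one.
    obtain ⟨g, hg, h1, h2⟩ := hf.2 η hη
    exact ⟨g, hg, (SolenoidDatum.normR_le_normS μ r hε g).trans_lt h1,
      (SolenoidDatum.normR_le_normS μ r hε (f - g)).trans_lt h2⟩
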